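/- Let $M$ be a smooth manifold of dimension $n\ge 3$ with a conformal class of pseudo-Riemannian metrics of arbitrary signature, with its standard tractor bundle $\mathcal T=\mathbb E[1]\oplus \mathbb E^a[-1]\oplus\mathbb E[-1]$, tractor metric $\langle\cdot,\cdot\rangle$ and tractor connection. Let $r\ge 0$ and let $\Gamma$ be an $r$-null curve, smoothly parametrized by $t$ in an open interval $I$: for a (hence any) metric in the class, the tangent vector $U$ and its covariant derivatives $U',\dots,U^{(r-1)}$ along the curve are linearly independent and null, and $U^{(r)}$ is nowhere null. Put $u=\sqrt{|\langle U^{(r)},U^{(r)}\rangle|}$, let $T=(0,0,u^{-1})$ be the associated tractor along $\Gamma$, let $T^{(i)}$ be its derivatives along $\Gamma$, and let $$\epsilon=\langle T^{(r+1)},T^{(r+1)}\rangle=\pm1,\qquad \alpha=\langle T^{(r+2)},T^{(r+2)}\rangle,\qquad \beta=\langle T^{(r+3)},T^{(r+3)}\rangle .$$ Then: (1) There are unique functions $q_0,\dots,q_{2r+2}$ on $I$ for which $T^{(2r+3)}+q_{2r+2}T^{(2r+2)}+\dots+q_1T'+q_0T$ is orthogonal to $T,T',\dots,T^{(2r+2)}$;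 they are smooth, and where $T,T',\dots,T^{(2r+3)}$ are linearly dependent, one has the tractor ODE $T^{(2r+3)}+q_{2r+2}T^{(2r+2)}+\dots+q_0T=0$. (2) Consider the scalar linear ODE $y^{(2r+3)}+q_{2r+2}y^{(2r+2)}+\dots+q_0y=0$ on $I$ and its Wilczynski invariants $\Theta_3,\dots,\Theta_{2r+3}$. Here $\Theta_m$ of an equation of order $k$ is defined as follows: near a given point there is a change of variables $y(t)=\mu(t)z(\varphi(t))$ that transforms the equation to the Laguerre–Forsyth form $z^{(k)}+p_{k-3}z^{(k-3)}+\dots+p_0z=0$, and $$\Theta_m(t)=\varphi'(t)^m\,\binom km\,\frac12\sum_{j=0}^{m-3}(-1)^j\frac{(m-2)!\,m!\,(2m-j-2)!}{(m-j-1)!\,(m-j)!\,(2m-3)!\,j!}\,\frac{p_{k-m+j}^{(j)}}{\binom{k}{m-j}}\Big|_{\varphi(t)} .$$ For the invariants occurring below, such a change of variables exists near each point of $I$ and the value does not depend on its choice. On $I$, $\Theta_3=0$, and if $r\ge1$ then $\Theta_5=0$ and $$\Theta_4=-\epsilon\beta-\frac{r(r+3)}{10}\,\epsilon\alpha''+\frac{(r+3)(2r+5)(5r+4)}{10(r+1)(r+2)(2r+3)}\,\alpha^2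 .$$ (3) For every $r\ge0$, $\alpha$ is smooth, and the right-hand side of the last formula is a relative conformal invariant of weight $4$: it does not depend on the choice of the metric in the conformal class, and for a smooth reparametrization $\tilde t=\psi(t)$, $\psi'\neq0$, its value $\widetilde\Theta_4$ for the reparametrized curve satisfies $\widetilde\Theta_4(\psi(t))=\psi'(t)^{-4}\Theta_4(t)$. -/

import Mathlib

open scoped Manifold ContDiff

noncomputable section

/-- The model space of an `n`-dimensional manifold. -/
abbrev Model (n : ℕ) : Type := EuclideanSpace ℝ (Fin n)

/-! ### Local differential geometry of a metric on a domain of `ℝⁿ`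

`G y u v` is the metric at the point `y` applied to the vectors `u`, `v`. Nothing is assumed about
the signature. -/

/-- The coordinate vector field `∂ᵢ`. -/
def coordVec {n : ℕ} (i : Fin n) : Model n := EuclideanSpace.single i 1

/-- Index raising: the vector dual to a covector `ξ` with respect to `G y`. -/
def sharp {n : ℕ} (G : Model n → Model n →L[ℝ] Model n →L[ℝ] ℝ) (y : Model n)
    (ξ : Model n →L[ℝ] ℝ) : Model n :=
  (G y).inverse ξ

/-- The Levi-Civita connection in coordinates:
`G (Γ(u, v), w) = ½ (∂ᵤ G(v, w) + ∂ᵥ G(u, w) - ∂_w G(u, v))`. -/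
def christoffel {n : ℕ} (G : Model n → Model n →L[ℝ] Model n →L[ℝ] ℝ) (y u v : Model n) :
    Model n :=
  sharp G y ((1 / 2 : ℝ) •
    (fderiv ℝ G y u v + fderiv ℝ G y v u - ((fderiv ℝ G y).flip u).flip v))

/-- The curvature `R(u, v) w` of the Levi-Civita connection. -/
def curvature {n : ℕ} (G : Model n → Model n →L[ℝ] Model n →L[ℝ] ℝ) (y u v w : Model n) :
    Model n :=
  fderiv ℝ (fun z => christoffel G z v w) y u - fderiv ℝ (fun z => christoffel G z u w) y v
    + christoffel G y u (christoffel G y v w) - christoffel G y v (christoffel G y u w)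

/-- The Ricci tensor `Ric(v, w) = tr (u ↦ R(u, v) w)`. -/
def ricci {n : ℕ} (G : Model n → Model n →L[ℝ] Model n →L[ℝ] ℝ) (y v w : Model n) : ℝ :=
  ∑ i : Fin n, curvature G y (coordVec i) v w i

/-- The scalar curvature. -/
def scalarCurvature {n : ℕ} (G : Model n → Model n →L[ℝ] Model n →L[ℝ] ℝ) (y : Model n) : ℝ :=
  ∑ i : Fin n, ∑ j : Fin n,
    sharp G y (EuclideanSpace.proj i) j * ricci G y (coordVec i) (coordVec j)

/-- The Schouten tensor `P = (Ric - Sc / (2 (n - 1)) G) / (n - 2)`. -/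
def schouten {n : ℕ} (G : Model n → Model n →L[ℝ] Model n →L[ℝ] ℝ) (y v w : Model n) : ℝ :=
  (ricci G y v w - scalarCurvature G y / (2 * ((n : ℝ) - 1)) * G y v w) / ((n : ℝ) - 2)

/-- The vector `v^c P_c^b`. -/
def schoutenVec {n : ℕ} (G : Model n → Model n →L[ℝ] Model n →L[ℝ] ℝ) (y v : Model n) :
    Model n :=
  ∑ i : Fin n, schouten G y v (coordVec i) • sharp G y (EuclideanSpace.proj i)

/-- The covariant derivative along the curve `c` of a vector field `V` along `c`. -/
def covDeriv {n : ℕ} (G : Model n → Model n →L[ℝ] Model n →L[ℝ] ℝ) (c : ℝ → Model n)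
    (V : ℝ → Model n) (t : ℝ) : Model n :=
  deriv V t + christoffel G (c t) (deriv c t) (V t)

/-- The derived vectors `U, U', U'', …` of a curve. -/
def derivedVector {n : ℕ} (G : Model n → Model n →L[ℝ] Model n →L[ℝ] ℝ) (c : ℝ → Model n)
    (i : ℕ) : ℝ → Model n :=
  (covDeriv G c)^[i] (deriv c)

/-- Standard tractors in the scale given by the metric: triples `(σ, μ, ρ)` (top, middle and
bottom slot). -/
abbrev Tractor (n : ℕ) : Type := ℝ × Model n × ℝ

/-- The standard tractor metric. -/
def tractorMetric {n : ℕ} (G : Model n → Model n →L[ℝ] Model n →L[ℝ] ℝ) (y : Model n)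
    (X Y : Tractor n) : ℝ :=
  G y X.2.1 Y.2.1 + X.1 * Y.2.2 + X.2.2 * Y.1

/-- The standard tractor connection along the curve `c`:
`(σ, μ, ρ)' = (σ' - ⟨U, μ⟩, μ' + ρ U + σ P(U), ρ' - P(U, μ))`. -/
def tractorDeriv {n : ℕ} (G : Model n → Model n →L[ℝ] Model n →L[ℝ] ℝ) (c : ℝ → Model n)
    (X : ℝ → Tractor n) (t : ℝ) : Tractor n :=
  (deriv (fun s => (X s).1) t - G (c t) (deriv c t) (X t).2.1,
    covDeriv G c (fun s => (X s).2.1) t + (X t).2.2 • deriv c t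
      + (X t).1 • schoutenVec G (c t) (deriv c t),
    deriv (fun s => (X s).2.2) t - schouten G (c t) (deriv c t) (X t).2.1)

/-- The lift `T = (0, 0, u⁻¹)`, where `u = √|⟨U⁽ʳ⁾, U⁽ʳ⁾⟩|`. -/
def tractorLift {n : ℕ} (r : ℕ) (G : Model n → Model n →L[ℝ] Model n →L[ℝ] ℝ)
    (c : ℝ → Model n) (t : ℝ) : Tractor n :=
  (0, 0, (Real.sqrt |G (c t) (derivedVector G c r t) (derivedVector G c r t)|)⁻¹)

/-- The derived tractors `T, T', T'', …`; thus `U⁽ⁱ⁾ = T⁽ⁱ⁺¹⁾` for the derived tractors of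
`U = T'`. -/
def derivedTractor {n : ℕ} (r : ℕ) (G : Model n → Model n →L[ℝ] Model n →L[ℝ] ℝ)
    (c : ℝ → Model n) (i : ℕ) : ℝ → Tractor n :=
  (tractorDeriv G c)^[i] (tractorLift r G c)

/-! ### Pseudo-Riemannian and conformal manifolds -/

/-- The expression of a field of bilinear forms in the preferred chart at `x`. -/
def inChart {n : ℕ} {M : Type*} [TopologicalSpace M] [ChartedSpace (Model n) M]
    (val : ∀ x : M, TangentSpace (𝓡 n) x →L[ℝ] TangentSpace (𝓡 n) x →L[ℝ] ℝ)
    (x : M) (y : Model n) : Model n →L[ℝ] Model n →L[ℝ] ℝ :=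
  let D : Model n →L[ℝ] Model n := mfderiv (𝓡 n) (𝓡 n) (chartAt (Model n) x).symm y
  let B : Model n →L[ℝ] Model n →L[ℝ] ℝ := val ((chartAt (Model n) x).symm y)
  B.bilinearComp D D

/-- Smooth pseudo-Riemannian metrics of arbitrary signature. -/
structure PseudoRiemannianMetric (n : ℕ) (M : Type*) [TopologicalSpace M]
    [ChartedSpace (Model n) M] where
  val : ∀ x : M, TangentSpace (𝓡 n) x →L[ℝ] TangentSpace (𝓡 n) x →L[ℝ] ℝ
  symm : ∀ x v w, val x v w = val x w v
  nondegenerate : ∀ x v, (∀ w, val x v w = 0) → v = 0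
  smooth : ∀ x, ContDiffOn ℝ ∞ (inChart val x) (chartAt (Model n) x).target

/-- Two metrics belong to the same conformal class: they differ by an everywhere positive (smooth)
function. -/
def ConformallyEquivalent {n : ℕ} {M : Type*} [TopologicalSpace M] [ChartedSpace (Model n) M]
    (g g' : PseudoRiemannianMetric n M) : Prop :=
  ∃ f : M → ℝ, ContMDiff (𝓡 n) 𝓘(ℝ, ℝ) ∞ f ∧ (∀ x, 0 < f x) ∧
    ∀ x v w, g'.val x v w = f x * g.val x v w

/-- The curve `γ`, near the parameter `t`, in the preferred chart at `γ t`. -/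
def curveInChart {n : ℕ} {M : Type*} [TopologicalSpace M] [ChartedSpace (Model n) M]
    (γ : ℝ → M) (t : ℝ) (s : ℝ) : Model n :=
  chartAt (Model n) (γ t) (γ s)

/-- The derived vector `U⁽ⁱ⁾` at the parameter `t`, in the preferred chart at `γ t`. -/
def derivedVectorAt {n : ℕ} {M : Type*} [TopologicalSpace M] [ChartedSpace (Model n) M]
    (g : PseudoRiemannianMetric n M) (γ : ℝ → M) (i : ℕ) (t : ℝ) : Model n :=
  derivedVector (inChart g.val (γ t)) (curveInChart γ t) i t

/-- The metric at `γ t` in the preferred chart at `γ t`. -/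
def metricAt {n : ℕ} {M : Type*} [TopologicalSpace M] [ChartedSpace (Model n) M]
    (g : PseudoRiemannianMetric n M) (γ : ℝ → M) (t : ℝ) : Model n →L[ℝ] Model n →L[ℝ] ℝ :=
  inChart g.val (γ t) (curveInChart γ t t)

/-- An `r`-null curve, smoothly parametrized by an open interval `I`: the vectors
`U, …, U⁽ʳ⁻¹⁾` are linearly independent and null, whereas `U⁽ʳ⁾` is not null. -/
structure IsNullCurve {n : ℕ} {M : Type*} [TopologicalSpace M] [ChartedSpace (Model n) M]
    (r : ℕ) (g : PseudoRiemannianMetric n M) (γ : ℝ → M) (I : Set ℝ) : Prop where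
  isOpen : IsOpen I
  ordConnected : I.OrdConnected
  smooth : ContMDiffOn 𝓘(ℝ, ℝ) (𝓡 n) ∞ γ I
  linearIndependent : ∀ t ∈ I, LinearIndependent ℝ (fun i : Fin r => derivedVectorAt g γ i t)
  null : ∀ t ∈ I, ∀ i < r, metricAt g γ t (derivedVectorAt g γ i t) (derivedVectorAt g γ i t) = 0
  not_null : ∀ t ∈ I, metricAt g γ t (derivedVectorAt g γ r t) (derivedVectorAt g γ r t) ≠ 0

/-- The derived tractor `T⁽ⁱ⁾` at the parameter `t`, in the preferred chart at `γ t` and in the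
scale given by `g`. -/
def tractorAt {n : ℕ} {M : Type*} [TopologicalSpace M] [ChartedSpace (Model n) M]
    (r : ℕ) (g : PseudoRiemannianMetric n M) (γ : ℝ → M) (i : ℕ) (t : ℝ) : Tractor n :=
  derivedTractor r (inChart g.val (γ t)) (curveInChart γ t) i t

/-- The tractor metric over `γ t`, in the preferred chart at `γ t` and in the scale given by
`g`. -/
def tractorMetricAt {n : ℕ} {M : Type*} [TopologicalSpace M] [ChartedSpace (Model n) M]
    (g : PseudoRiemannianMetric n M) (γ : ℝ → M) (t : ℝ) (X Y : Tractor n) : ℝ :=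
  tractorMetric (inChart g.val (γ t)) (curveInChart γ t t) X Y

/-- `ε = ⟨U⁽ʳ⁾, U⁽ʳ⁾⟩` (tractors). -/
def nullEpsilon {n : ℕ} {M : Type*} [TopologicalSpace M] [ChartedSpace (Model n) M]
    (r : ℕ) (g : PseudoRiemannianMetric n M) (γ : ℝ → M) (t : ℝ) : ℝ :=
  tractorMetricAt g γ t (tractorAt r g γ (r + 1) t) (tractorAt r g γ (r + 1) t)

/-- `α = ⟨U⁽ʳ⁺¹⁾, U⁽ʳ⁺¹⁾⟩` (tractors). -/
def nullAlpha {n : ℕ} {M : Type*} [TopologicalSpace M] [ChartedSpace (Model n) M]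
    (r : ℕ) (g : PseudoRiemannianMetric n M) (γ : ℝ → M) (t : ℝ) : ℝ :=
  tractorMetricAt g γ t (tractorAt r g γ (r + 2) t) (tractorAt r g γ (r + 2) t)

/-- `β = ⟨U⁽ʳ⁺²⁾, U⁽ʳ⁺²⁾⟩` (tractors). -/
def nullBeta {n : ℕ} {M : Type*} [TopologicalSpace M] [ChartedSpace (Model n) M]
    (r : ℕ) (g : PseudoRiemannianMetric n M) (γ : ℝ → M) (t : ℝ) : ℝ :=
  tractorMetricAt g γ t (tractorAt r g γ (r + 3) t) (tractorAt r g γ (r + 3) t)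

/-- `-εβ - r(r+3)/10 εα'' + (r+3)(2r+5)(5r+4) / (10(r+1)(r+2)(2r+3)) α²`. -/
def thetaFour {n : ℕ} {M : Type*} [TopologicalSpace M] [ChartedSpace (Model n) M]
    (r : ℕ) (g : PseudoRiemannianMetric n M) (γ : ℝ → M) (t : ℝ) : ℝ :=
  -(nullEpsilon r g γ t * nullBeta r g γ t)
    - (r : ℝ) * (r + 3) / 10 * nullEpsilon r g γ t * iteratedDeriv 2 (nullAlpha r g γ) t
    + ((r : ℝ) + 3) * (2 * r + 5) * (5 * r + 4) / (10 * (r + 1) * (r + 2) * (2 * r + 3))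
      * nullAlpha r g γ t ^ 2

/-- The tractor `T⁽²ʳ⁺³⁾ + c_{2r+2} T⁽²ʳ⁺²⁾ + … + c₁ T' + c₀ T` at the parameter `t`. -/
def tractorOperatorAt {n : ℕ} {M : Type*} [TopologicalSpace M] [ChartedSpace (Model n) M]
    (r : ℕ) (g : PseudoRiemannianMetric n M) (γ : ℝ → M) (t : ℝ) (c : ℕ → ℝ) : Tractor n :=
  tractorAt r g γ (2 * r + 3) t + ∑ i ∈ Finset.range (2 * r + 3), c i • tractorAt r g γ i t

/-- `c₀, …, c_{2r+2}` are the coefficients, at the parameter `t`, of the tractor linear ODE of the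
curve. They are determined by pairing the equation with `T, T', …, T⁽²ʳ⁺²⁾`; this makes sense also
if `T, T', …, T⁽²ʳ⁺³⁾` are linearly independent, and then gives the associated operator. -/
def IsTractorODECoeff {n : ℕ} {M : Type*} [TopologicalSpace M] [ChartedSpace (Model n) M]
    (r : ℕ) (g : PseudoRiemannianMetric n M) (γ : ℝ → M) (t : ℝ) (c : ℕ → ℝ) : Prop :=
  ∀ j < 2 * r + 3,
    tractorMetricAt g γ t (tractorOperatorAt r g γ t c) (tractorAt r g γ j t) = 0

/-- `Φ`, a quantity that is computed from a metric and a parametrized curve, is a relative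
conformal invariant of weight `w` of the curve `γ`, parametrized by `I`, with respect to the
conformal class of `g`: it does not depend on the choice of the metric in the conformal class, and
under a reparametrization `ψ` it is multiplied by `(ψ')⁻ʷ`. Here `γ'` is the reparametrized
curve. -/
def IsRelativeConformalInvariant {n : ℕ} {M : Type*} [TopologicalSpace M]
    [ChartedSpace (Model n) M] (w : ℕ) (Φ : PseudoRiemannianMetric n M → (ℝ → M) → ℝ → ℝ)
    (g : PseudoRiemannianMetric n M) (γ : ℝ → M) (I : Set ℝ) : Prop :=
  ∀ g' : PseudoRiemannianMetric n M, ConformallyEquivalent g g' →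
    ∀ (ψ : ℝ → ℝ) (γ' : ℝ → M), ContDiffOn ℝ ∞ ψ I → (∀ t ∈ I, deriv ψ t ≠ 0) →
      (∀ t ∈ I, γ' (ψ t) = γ t) →
      ∀ t ∈ I, Φ g' γ' (ψ t) = (deriv ψ t ^ w)⁻¹ * Φ g γ t

/-! ### Wilczynski invariants of scalar linear ODEs -/

/-- The operator `y ↦ y⁽ᵏ⁾ + q_{k-1} y⁽ᵏ⁻¹⁾ + … + q₀ y`. -/
def linearODEOp (k : ℕ) (q : ℕ → ℝ → ℝ) (y : ℝ → ℝ) (t : ℝ) : ℝ :=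
  iteratedDeriv k y t + ∑ i ∈ Finset.range k, q i t * iteratedDeriv i y t

/-- On the open set `J`, the substitution `y(t) = μ(t) z(φ(t))` transforms the equation
`y⁽ᵏ⁾ + q_{k-1} y⁽ᵏ⁻¹⁾ + … + q₀ y = 0` into `z⁽ᵏ⁾ + p_{k-1} z⁽ᵏ⁻¹⁾ + … + p₀ z = 0`, and
the latter is in the canonical Laguerre–Forsyth form `p_{k-1} = p_{k-2} = 0`. -/
structure IsLaguerreForsythForm (k : ℕ) (q : ℕ → ℝ → ℝ) (J : Set ℝ) (φ μ : ℝ → ℝ)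
    (p : ℕ → ℝ → ℝ) : Prop where
  isOpen : IsOpen J
  smooth_param : ContDiffOn ℝ ∞ φ J
  deriv_ne_zero : ∀ t ∈ J, deriv φ t ≠ 0
  injOn : Set.InjOn φ J
  smooth_factor : ContDiffOn ℝ ∞ μ J
  factor_ne_zero : ∀ t ∈ J, μ t ≠ 0
  smooth_coeff : ∀ i < k, ContDiffOn ℝ ∞ (p i) (φ '' J)
  transform : ∀ z : ℝ → ℝ, ContDiff ℝ ∞ z → ∀ t ∈ J,
    linearODEOp k q (fun s => μ s * z (φ s)) t = μ t * deriv φ t ^ k * linearODEOp k p z (φ t)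
  canonical_one : ∀ s ∈ φ '' J, p (k - 1) s = 0
  canonical_two : ∀ s ∈ φ '' J, p (k - 2) s = 0

/-- Wilczynski's linear invariant of weight `m` of an equation of order `k` in the canonical
Laguerre–Forsyth form. With `p_{k-i} = (k choose i) P_i` it is the linear invariant
`½ ∑_{j=0}^{m-3} (-1)ʲ (m-2)! m! (2m-j-2)! / ((m-j-1)! (m-j)! (2m-3)! j!) P_{m-j}⁽ʲ⁾`, multiplied
by `(k choose m)` so that the coefficient of `p_{k-m}` is one. -/
def canonicalInvariant (k m : ℕ) (p : ℕ → ℝ → ℝ) (s : ℝ) : ℝ :=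
  (k.choose m : ℝ) * (1 / 2) * ∑ j ∈ Finset.range (m - 2),
    (-1) ^ j * (((m - 2).factorial * m.factorial * (2 * m - j - 2).factorial : ℕ) : ℝ)
      / (((m - j - 1).factorial * (m - j).factorial * (2 * m - 3).factorial * j.factorial : ℕ) : ℝ)
      * (iteratedDeriv j (p (k - (m - j))) s / (k.choose (m - j) : ℝ))

/-- `θ` is the value at `t` of the Wilczynski invariant `Θ_m` (`3 ≤ m ≤ k`) of the equation
`y⁽ᵏ⁾ + q_{k-1} y⁽ᵏ⁻¹⁾ + … + q₀ y = 0`: the equation is brought to the canonical form near `t`, and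
the linear invariant of weight `m` of the canonical form is carried back. -/
def IsWilczynskiInvariant (k : ℕ) (q : ℕ → ℝ → ℝ) (m : ℕ) (t θ : ℝ) : Prop :=
  ∃ (J : Set ℝ) (φ μ : ℝ → ℝ) (p : ℕ → ℝ → ℝ), t ∈ J ∧ IsLaguerreForsythForm k q J φ μ p ∧
    θ = deriv φ t ^ m * canonicalInvariant k m p (φ t)

end

/-! Put `N = r + 1` and let `h i j` be the pairing of `T⁽ⁱ⁾` with `T⁽ʲ⁾`. Everything follows from
the shape of this Gram matrix. Differentiation gives `hᵢⱼ' = h_{i+1,j} + h_{i,j+1}`, so each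
antidiagonal `i + j = m + 1` is determined by the previous one and a single entry. On an odd
antidiagonal symmetry fixes that entry as well. For an `r`-null curve all entries with `i + j < 2N`
vanish, and the normalisation by `u` makes those with `i + j = 2N` equal to `±1` with alternating
signs. Hence the antidiagonal `2N + 1` vanishes, `2N + 2` carries `α`, `2N + 3` carries `α'`, and
`2N + 4` carries `β` and `α''` (`level_succ` to `level_five`). Reversing the rows makes the Gram
matrix of `T, …, T⁽²ᴺ⁾` triangular with diagonal `±1`. Its determinant is therefore nonzero, and
Cramer's rule produces the unique smooth coefficients `q`.

A substitution `y = μ · (z ∘ φ)` in the scalar equation corresponds to passing from `T` to the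
sections `Wᵢ` obtained from `μ⁻¹ T` by differentiating with respect to the parameter `φ`. The `Wᵢ`
satisfy the transformed equation after pairing with each of `W₀, …, W_{2N}` (`rescaled_equation`),
and their Gram matrix has the same structure. In canonical form the two missing coefficients force
its antidiagonals `2N + 1` and `2N + 2` to vanish. Pairing with `W₂`, `W₃`, `W₄` then gives `p_{k-3}
= 0`, `p_{k-4} = -h_{0,2N+4} / h_{0,2N}` and `p_{k-5} = ((2N - 3) / 2) p_{k-4}'`, that is, `Θ₃ = 0`,
`Θ₄ = φ'⁴ p_{k-4}` and `Θ₅ = 0` (`canonicalInvariant_eq`).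

To express `Θ₄` in the original parameter one uses `gramTheta`, a combination of `h_{0,2N+2}`, its
second derivative and `h_{0,2N+4}` that is multiplied by `w⁴` under every such change of parameter
(`gramTheta_transform`). For the `Wᵢ` it reduces to `p_{k-4}`, for the `T⁽ⁱ⁾` to the formula with
`ε`, `α`, `β` (`theta_eq`). A canonical form exists locally because the condition on `φ` is a
Riccati equation for `φ'' / φ'` (`exists_isLaguerreForsythForm`).

The same transformation law with `w = ψ'` gives the weight under reparametrization. Independence of
the metric holds because the change of splitting of the tractor bundle preserves the tractor metric,
commutes with the tractor connection and carries `T` to `T` (`IsConformalChangeOn.tractorDeriv_eq`,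
`tractorLift_eq`). Quantities at different parameters are defined in different charts; naturality
under isometries (`IsLocalIsometryOn`) allows all computations near a point to be made in one chart.
-/

/-! ### Change of variables in iterated derivatives -/

/-- The coefficients `B_{ji}` of the expansion `(μ · (z ∘ φ))⁽ʲ⁾ = ∑ᵢ B_{ji} · (z⁽ⁱ⁾ ∘ φ)`, where
`w = φ'`. -/
noncomputable def chainCoeff (w μ : ℝ → ℝ) : ℕ → ℕ → ℝ → ℝ
  | 0, 0 => μ
  | 0, _ + 1 => 0
  | j + 1, 0 => deriv (chainCoeff w μ j 0)
  | j + 1, i + 1 => fun t => deriv (chainCoeff w μ j (i + 1)) t + w t * chainCoeff w μ j i t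

section chainCoeff

variable {J : Set ℝ} {w μ : ℝ → ℝ}

lemma ContDiffOn.deriv_isOpen {E : Type*} [NormedAddCommGroup E] [NormedSpace ℝ E] {f : ℝ → E}
    (hf : ContDiffOn ℝ ∞ f J) (hJ : IsOpen J) : ContDiffOn ℝ ∞ (deriv f) J :=
  hf.deriv_of_isOpen hJ (by simp)

lemma ContDiffOn.differentiableAt_isOpen {E : Type*} [NormedAddCommGroup E] [NormedSpace ℝ E]
    {f : ℝ → E} (hf : ContDiffOn ℝ ∞ f J) (hJ : IsOpen J) {t : ℝ} (ht : t ∈ J) :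
    DifferentiableAt ℝ f t :=
  (hf.contDiffAt (hJ.mem_nhds ht)).differentiableAt (by simp)

lemma Set.EqOn.eventuallyEq_isOpen {X Y : Type*} [TopologicalSpace X] {s : Set X} {f g : X → Y}
    (h : Set.EqOn f g s) (hs : IsOpen s) {x : X} (hx : x ∈ s) : f =ᶠ[nhds x] g :=
  h.eventuallyEq_of_mem (hs.mem_nhds hx)

lemma chainCoeff_smooth (hJ : IsOpen J) (hw : ContDiffOn ℝ ∞ w J) (hμ : ContDiffOn ℝ ∞ μ J)
    (j i : ℕ) : ContDiffOn ℝ ∞ (chainCoeff w μ j i) J := by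
  induction j generalizing i with
  | zero =>
    cases i with
    | zero => simpa [chainCoeff] using hμ
    | succ i => exact contDiffOn_const (c := (0 : ℝ))
  | succ j ih =>
    cases i with
    | zero => exact (ih 0).deriv_isOpen hJ
    | succ i => exact ((ih (i + 1)).deriv_isOpen hJ).add (hw.mul (ih i))

lemma chainCoeff_of_lt {j i : ℕ} (h : j < i) : chainCoeff w μ j i = 0 := by
  induction j generalizing i with
  | zero =>
    cases i with
    | zero => omega
    | succ i => rfl
  | succ j ih =>
    cases i with
    | zero => omega
    | succ i =>
      funext t
      simp [chainCoeff, ih (show j < i + 1 by omega), ih (show j < i by omega)]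

lemma chainCoeff_diag (j : ℕ) (t : ℝ) : chainCoeff w μ j j t = μ t * w t ^ j := by
  induction j with
  | zero => simp [chainCoeff]
  | succ j ih =>
    simp only [chainCoeff, chainCoeff_of_lt (show j < j + 1 by omega), ih]
    simp only [deriv_zero, Pi.zero_apply]
    ring

/-- The recursion along the diagonals `j - i = const` for the coefficients `B_{ji}`, if
`μ' = -N f μ` with `f = w' / w`. -/
lemma chainCoeff_diag_step (hJ : IsOpen J) {f : ℝ → ℝ} {N : ℝ}
    (hw : ∀ t ∈ J, HasDerivAt w (f t * w t) t) (hμ : ∀ t ∈ J, HasDerivAt μ (-N * f t * μ t) t)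
    {s : ℕ} {c c' d : ℕ → ℝ → ℝ}
    (hc : ∀ i, ∀ t ∈ J, chainCoeff w μ (i + s) i t = μ t * w t ^ i * c i t)
    (hc' : ∀ i, ∀ t ∈ J, HasDerivAt (c i) (c' i t) t)
    (hd0 : ∀ t ∈ J, d 0 t = c' 0 t - N * f t * c 0 t)
    (hd : ∀ i : ℕ, ∀ t ∈ J,
      d (i + 1) t = c' (i + 1) t + (i + 1 - N) * f t * c (i + 1) t + d i t) :
    ∀ i, ∀ t ∈ J, chainCoeff w μ (i + (s + 1)) i t = μ t * w t ^ i * d i t := by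
  -- The logarithmic derivative of `μ wⁱ` is `(i - N) f`, which is the source of that factor in the
  -- recursion.
  have key : ∀ i, ∀ t ∈ J, deriv (chainCoeff w μ (i + s) i) t
      = μ t * w t ^ i * (c' i t + (i - N) * f t * c i t) := by
    intro i t ht
    have h1 : chainCoeff w μ (i + s) i =ᶠ[nhds t] fun t => μ t * w t ^ i * c i t :=
      Set.EqOn.eventuallyEq_isOpen (fun t ht => hc i t ht) hJ ht
    rw [h1.deriv_eq]
    refine (((hμ t ht).mul ((hw t ht).pow i)).mul (hc' i t ht)).deriv.trans ?_
    simp only [Pi.mul_apply, Pi.pow_apply]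
    rcases i with _ | i
    · simp only [Nat.cast_zero, zero_mul, pow_zero, mul_zero, add_zero]; ring
    · simp only [Nat.cast_add, Nat.cast_one, Nat.add_sub_cancel]; ring
  intro i
  induction i with
  | zero =>
    intro t ht
    have := key 0 t ht
    rw [show 0 + (s + 1) = (0 + s) + 1 by ring, chainCoeff, this, hd0 t ht]
    push_cast; ring
  | succ i ih =>
    intro t ht
    have := key (i + 1) t ht
    rw [show i + 1 + (s + 1) = (i + 1 + s) + 1 by ring]
    simp only [chainCoeff]
    rw [this, hd i t ht, show i + 1 + s = i + (s + 1) by ring, ih t ht]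
    push_cast; ring

end chainCoeff

/-! ### Explicit lower diagonals of the matrix `B_{ji}` -/

section diagonals

variable {J : Set ℝ} {w μ f f₁ f₂ f₃ : ℝ → ℝ} {N : ℝ}

/-- The first four lower diagonals of the coefficients `B_{ji}`, divided by `μ wⁱ`, as polynomials
in `f = w' / w` and its derivatives. -/
noncomputable def diagPoly (N : ℝ) (f f₁ f₂ f₃ : ℝ → ℝ) : ℕ → ℕ → ℝ → ℝ
  | 0, _, _ => 1
  | 1, i, t => (i + 1) / 2 * (i - 2 * N) * f t
  | 2, i, t => (i + 1) * (i + 2) * ((i / 6 - N / 2) * f₁ t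
      + (N ^ 2 / 2 + i / 24 - i * N / 2 + i ^ 2 / 8) * f t ^ 2)
  | 3, i, t => (i + 1) * (i + 2) * (i + 3) * ((i / 24 - N / 6) * f₂ t
      + (N ^ 2 / 2 + i / 24 - 5 * i * N / 12 + i ^ 2 / 12) * f t * f₁ t
      + (i - 2 * N) * (N ^ 2 / 12 + i / 48 - i * N / 12 + i ^ 2 / 48) * f t ^ 3)
  | _, i, t => (i + 1) * (i + 2) * (i + 3) * (i + 4) * ((i / 120 - N / 24) * f₃ t
      + (N ^ 2 / 8 + i / 90 - i * N / 12 + i ^ 2 / 72) * f₁ t ^ 2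
      + (N ^ 2 / 6 + i / 80 - i * N / 8 + i ^ 2 / 48) * f t * f₂ t
      + (-N ^ 3 / 4 + i / 720 - i * N / 16 + i * N ^ 2 / 3 + i ^ 2 / 36 - 7 * i ^ 2 * N / 48
        + i ^ 3 / 48) * f t ^ 2 * f₁ t
      + (N ^ 4 / 24 - i / 2880 + i * N ^ 2 / 48 - i * N ^ 3 / 12 + i ^ 2 / 1152 - i ^ 2 * N / 48
        + i ^ 2 * N ^ 2 / 16 + i ^ 3 / 192 - i ^ 3 * N / 48 + i ^ 4 / 384) * f t ^ 4)

/-- Each diagonal arises from the preceding one by `chainCoeff_diag_step`, so it suffices that the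
stated polynomials satisfy the recursion in `i`. The functions `c'` are their `t`-derivatives. The
fourth diagonal is the last one that enters `h_{0,2N+4}`. -/
lemma chainCoeff_eq_diagPoly (hJ : IsOpen J)
    (hw : ∀ t ∈ J, HasDerivAt w (f t * w t) t) (hμ : ∀ t ∈ J, HasDerivAt μ (-N * f t * μ t) t)
    (hf : ∀ t ∈ J, HasDerivAt f (f₁ t) t) (hf₁ : ∀ t ∈ J, HasDerivAt f₁ (f₂ t) t)
    (hf₂ : ∀ t ∈ J, HasDerivAt f₂ (f₃ t) t) {s : ℕ} (hs : s ≤ 4) (i : ℕ) {t : ℝ} (ht : t ∈ J) :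
    chainCoeff w μ (i + s) i t = μ t * w t ^ i * diagPoly N f f₁ f₂ f₃ s i t := by
  have h0 : ∀ i : ℕ, ∀ t ∈ J,
      chainCoeff w μ (i + 0) i t = μ t * w t ^ i * diagPoly N f f₁ f₂ f₃ 0 i t := by
    intro i t _
    simp [chainCoeff_diag, diagPoly]
  have h1 := chainCoeff_diag_step hJ hw hμ (d := diagPoly N f f₁ f₂ f₃ 1) h0
    (c' := fun i t => 0) (fun i t _ => hasDerivAt_const t (1 : ℝ))
    (by intro t _; simp only [diagPoly]; push_cast; ring)
    (by intro i t _; simp only [diagPoly]; push_cast; ring)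
  have h2 := chainCoeff_diag_step hJ hw hμ (d := diagPoly N f f₁ f₂ f₃ 2) h1
    (c' := fun i t => (i + 1) / 2 * (i - 2 * N) * f₁ t)
    (fun i t ht => (hf t ht).const_mul _)
    (by intro t _; simp only [diagPoly]; push_cast; ring)
    (by intro i t _; simp only [diagPoly]; push_cast; ring)
  have h3 := chainCoeff_diag_step hJ hw hμ (d := diagPoly N f f₁ f₂ f₃ 3) h2
    (c' := fun i t => (i + 1) * (i + 2) * ((i / 6 - N / 2) * f₂ t
      + (N ^ 2 / 2 + i / 24 - i * N / 2 + i ^ 2 / 8) * (2 * f t * f₁ t)))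
    (fun i t ht => by
      refine ((((hf₁ t ht).const_mul _).add (((hf t ht).pow 2).const_mul _)).const_mul _).congr_deriv ?_
      simp)
    (by intro t _; simp only [diagPoly]; push_cast; ring)
    (by intro i t _; simp only [diagPoly]; push_cast; ring)
  have h4 := chainCoeff_diag_step hJ hw hμ (d := diagPoly N f f₁ f₂ f₃ 4) h3
    (c' := fun i t => (i + 1) * (i + 2) * (i + 3) * ((i / 24 - N / 6) * f₃ t
      + (N ^ 2 / 2 + i / 24 - 5 * i * N / 12 + i ^ 2 / 12) * (f₁ t ^ 2 + f t * f₂ t)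
      + (i - 2 * N) * (N ^ 2 / 12 + i / 48 - i * N / 12 + i ^ 2 / 48) * (3 * f t ^ 2 * f₁ t)))
    (fun i t ht => by
      refine (((((hf₂ t ht).const_mul _).add (((hf t ht).const_mul _).mul (hf₁ t ht))).add
        (((hf t ht).pow 3).const_mul _)).const_mul _).congr_deriv ?_
      simp only [Nat.cast_ofNat]; ring)
    (by intro t _; simp only [diagPoly]; push_cast; ring)
    (by intro i t _; simp only [diagPoly]; push_cast; ring)
  interval_cases s
  · exact h0 i t ht
  · exact h1 i t ht
  · exact h2 i t ht
  · exact h3 i t ht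
  · exact h4 i t ht

end diagonals

/-! ### Covariant derivatives of vector-valued functions of one variable -/

/-- `D` acts on smooth functions on `J` as a covariant derivative in the direction `d / dt`. -/
structure IsConnectionOn {V : Type*} [NormedAddCommGroup V] [NormedSpace ℝ V] (J : Set ℝ)
    (D : (ℝ → V) → ℝ → V) : Prop where
  congr : ∀ X Y, Set.EqOn X Y J → Set.EqOn (D X) (D Y) J
  smooth : ∀ X, ContDiffOn ℝ ∞ X J → ContDiffOn ℝ ∞ (D X) J
  add : ∀ X Y, ContDiffOn ℝ ∞ X J → ContDiffOn ℝ ∞ Y J → ∀ t ∈ J,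
    D (fun s => X s + Y s) t = D X t + D Y t
  smul : ∀ (a : ℝ → ℝ) X, ContDiffOn ℝ ∞ a J → ContDiffOn ℝ ∞ X J → ∀ t ∈ J,
    D (fun s => a s • X s) t = deriv a t • X t + a t • D X t

namespace IsConnectionOn

variable {V : Type*} [NormedAddCommGroup V] [NormedSpace ℝ V] {J : Set ℝ} {D : (ℝ → V) → ℝ → V}

lemma iterate_smooth (hD : IsConnectionOn J D) {X : ℝ → V} (hX : ContDiffOn ℝ ∞ X J) (j : ℕ) :
    ContDiffOn ℝ ∞ (D^[j] X) J := by
  induction j with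
  | zero => exact hX
  | succ j ih => rw [Function.iterate_succ_apply']; exact hD.smooth _ ih

lemma zero (hD : IsConnectionOn J D) {t : ℝ} (ht : t ∈ J) : D (fun _ => 0) t = 0 := by
  have := hD.smul (fun _ => 0) (fun _ => 0) contDiffOn_const contDiffOn_const t ht
  simpa using this

lemma sum (hD : IsConnectionOn J D) {ι : Type*} (s : Finset ι) {X : ι → ℝ → V}
    (hX : ∀ i ∈ s, ContDiffOn ℝ ∞ (X i) J) {t : ℝ} (ht : t ∈ J) :
    D (fun t => ∑ i ∈ s, X i t) t = ∑ i ∈ s, D (X i) t := by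
  classical
  induction s using Finset.induction_on with
  | empty => simpa using hD.zero ht
  | insert i s hi ih =>
    simp only [Finset.sum_insert hi]
    rw [hD.add _ _ (hX i (by simp)) (ContDiffOn.sum fun j hj => hX j (by simp [hj])) t ht,
      ih fun j hj => hX j (by simp [hj])]

/-- The Leibniz rule and the chain rule for iterated covariant derivatives of `Z₀ = μ W₀`, where
`Wᵢ` are the iterated derivatives with respect to a parameter with differential `w dt`. -/
theorem eq_sum_chainCoeff (hD : IsConnectionOn J D) (hJ : IsOpen J) {w μ : ℝ → ℝ}
    (hw : ContDiffOn ℝ ∞ w J) (hμ : ContDiffOn ℝ ∞ μ J) {Z W : ℕ → ℝ → V}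
    (hZ : ∀ j, ∀ t ∈ J, Z (j + 1) t = D (Z j) t)
    (hWs : ∀ i, ContDiffOn ℝ ∞ (W i) J) (hW : ∀ i, ∀ t ∈ J, D (W i) t = w t • W (i + 1) t)
    (h0 : ∀ t ∈ J, Z 0 t = μ t • W 0 t) (j : ℕ) {t : ℝ} (ht : t ∈ J) :
    Z j t = ∑ i ∈ Finset.range (j + 1), chainCoeff w μ j i t • W i t := by
  induction j generalizing t with
  | zero => simp [chainCoeff, h0 t ht]
  | succ j ih =>
    have hB := chainCoeff_smooth hJ hw hμ j
    rw [hZ j t ht, hD.congr _ _ (fun t ht => ih ht) ht,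
      hD.sum _ (X := fun i s => chainCoeff w μ j i s • W i s) (fun i _ => (hB i).smul (hWs i)) ht,
      Finset.sum_congr rfl fun i _ => hD.smul _ _ (hB i) (hWs i) t ht, Finset.sum_add_distrib,
      Finset.sum_range_succ' _ (j + 1), Finset.sum_range_succ' _ j, Finset.sum_congr rfl
        fun i _ => show chainCoeff w μ (j + 1) (i + 1) t • W (i + 1) t =
          deriv (chainCoeff w μ j (i + 1)) t • W (i + 1) t
            + chainCoeff w μ j i t • w t • W (i + 1) t by
          simp only [chainCoeff, add_smul, smul_smul, mul_comm],
      Finset.sum_add_distrib]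
    rw [Finset.sum_range_succ (fun i => deriv (chainCoeff w μ j (i + 1)) t • W (i + 1) t) j,
      chainCoeff_of_lt (show j < j + 1 by omega)]
    simp only [deriv_zero, Pi.zero_apply, zero_smul, add_zero, chainCoeff, hW _ t ht]
    abel

end IsConnectionOn

/-- The scalar case. It makes the same coefficients `chainCoeff` govern both the scalar equation and
the tractors. -/
lemma isConnectionOn_deriv {J : Set ℝ} (hJ : IsOpen J) :
    IsConnectionOn J (deriv : (ℝ → ℝ) → ℝ → ℝ) where
  congr X Y h t ht := (h.eventuallyEq_isOpen hJ ht).deriv_eq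
  smooth X hX := hX.deriv_isOpen hJ
  add X Y hX hY t ht :=
    deriv_fun_add (hX.differentiableAt_isOpen hJ ht) (hY.differentiableAt_isOpen hJ ht)
  smul a X ha hX t ht := by
    simp only [smul_eq_mul]
    exact deriv_fun_mul (ha.differentiableAt_isOpen hJ ht) (hX.differentiableAt_isOpen hJ ht)

/-! ### Gram matrices of derived vectors -/

/-- The functions `hᵢⱼ = ⟨W⁽ⁱ⁾, W⁽ʲ⁾⟩` on the open set `J` for a section `W` of a bundle with a
symmetric bilinear form and a connection; the derivatives are taken with respect to a parameter
with differential `w dt`. The lowest possibly nonzero ones are those with `i + j = 2 N`. -/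
structure IsGramSystem (J : Set ℝ) (N : ℕ) (w : ℝ → ℝ) (h : ℕ → ℕ → ℝ → ℝ) : Prop where
  isOpen : IsOpen J
  symm : ∀ i j, ∀ t ∈ J, h i j t = h j i t
  hasDerivAt : ∀ i j, ∀ t ∈ J, HasDerivAt (h i j) (w t * (h (i + 1) j t + h i (j + 1) t)) t
  ne_zero : ∀ t ∈ J, w t ≠ 0
  vanish_zero : ∀ j < 2 * N, ∀ t ∈ J, h 0 j t = 0

lemma HasDerivAt.eq_of_eqOn {J : Set ℝ} (hJ : IsOpen J) {f g : ℝ → ℝ} {a b t : ℝ} (ht : t ∈ J)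
    (hf : HasDerivAt f a t) (hg : HasDerivAt g b t) (h : ∀ s ∈ J, f s = g s) : a = b :=
  hf.unique (hg.congr_of_eventuallyEq (Set.EqOn.eventuallyEq_isOpen h hJ ht))

namespace IsGramSystem

variable {J : Set ℝ} {N : ℕ} {w : ℝ → ℝ} {h : ℕ → ℕ → ℝ → ℝ}

/-- If the entries with `i + j = m` are known, those with `i + j = m + 1` are determined by one of
them. -/
lemma level_succ (H : IsGramSystem J N w h) {m : ℕ} {x x' y : ℕ → ℝ → ℝ}
    (hx : ∀ i j, i + j = m → ∀ t ∈ J, h i j t = (-1) ^ i * x i t)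
    (hx' : ∀ i ≤ m, ∀ t ∈ J, HasDerivAt (x i) (w t * x' i t) t)
    (hy0 : ∀ t ∈ J, h 0 (m + 1) t = y 0 t)
    (hy : ∀ i ≤ m, ∀ t ∈ J, y (i + 1) t = y i t - x' i t) :
    ∀ i j, i + j = m + 1 → ∀ t ∈ J, h i j t = (-1) ^ i * y i t := by
  intro i
  induction i with
  | zero =>
    intro j hj t ht
    rw [show j = m + 1 by omega, hy0 t ht]; simp
  | succ i ih =>
    intro j hj t ht
    have h1 := HasDerivAt.eq_of_eqOn H.isOpen ht (H.hasDerivAt i j t ht)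
      ((hx' i (by omega) t ht).const_mul ((-1) ^ i)) (hx i j (by omega))
    -- The derivative of `hᵢⱼ` is known in two ways. One of the two entries on the next antidiagonal
    -- is known by induction on `i`, so the other one follows with the opposite sign.
    have h2 : h (i + 1) j t + h i (j + 1) t = (-1) ^ i * x' i t :=
      mul_left_cancel₀ (H.ne_zero t ht) (by rw [h1]; ring)
    rw [ih (j + 1) (by omega) t ht] at h2
    rw [hy i (by omega) t ht, pow_succ]
    linear_combination h2

/-- An antidiagonal of zeros is propagated to the next one as long as the entry in row `0` vanishes.
-/
lemma vanish (H : IsGramSystem J N w h) {i j : ℕ} (hij : i + j < 2 * N) {t : ℝ} (ht : t ∈ J) :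
    h i j t = 0 := by
  suffices ∀ m < 2 * N, ∀ i j, i + j = m → ∀ t ∈ J, h i j t = (-1) ^ i * (0 : ℕ → ℝ → ℝ) i t by
    simpa using this _ hij i j rfl t ht
  intro m
  induction m with
  | zero =>
    intro hm i j hij t ht
    obtain ⟨rfl, rfl⟩ : i = 0 ∧ j = 0 := by omega
    simp [H.vanish_zero 0 hm t ht]
  | succ m ih =>
    intro hm
    refine H.level_succ (x' := 0) (ih (by omega)) ?_ ?_ ?_
    · intro i _ t _; simp [hasDerivAt_zero]
    · intro t ht; simp [H.vanish_zero _ hm t ht]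
    · simp

lemma level_zero (H : IsGramSystem J N w h) :
    ∀ i j, i + j = 2 * N → ∀ t ∈ J, h i j t = (-1) ^ i * h 0 (2 * N) t := by
  rcases N with _ | N
  · intro i j hij t ht
    obtain ⟨rfl, rfl⟩ : i = 0 ∧ j = 0 := by omega
    simp
  · refine H.level_succ (m := 2 * N + 1) (x := 0) (x' := 0)
      (y := fun _ => h 0 (2 * (N + 1))) ?_ ?_ ?_ ?_
    · intro i j hij t ht; simp [H.vanish (show i + j < 2 * (N + 1) by omega) ht]
    · intro i _ t _; simp [hasDerivAt_zero]
    · intro t _; rfl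
    · simp

/-- The derivative of `h_{0,2N}`. -/
lemma hasDerivAt_level_zero (H : IsGramSystem J N w h) {t : ℝ} (ht : t ∈ J) :
    HasDerivAt (h 0 (2 * N)) (w t * ((-1) ^ N * (2 * h N (N + 1) t))) t := by
  have h1 : HasDerivAt (h N N) _ t := H.hasDerivAt N N t ht
  have h2 : h 0 (2 * N) =ᶠ[nhds t] fun s => (-1) ^ N * h N N s :=
    Set.EqOn.eventuallyEq_isOpen (s := J) (fun s hs => by
      rw [H.level_zero N N (by ring) s hs, ← mul_assoc, ← pow_add, ← two_mul,
        (even_two_mul N).neg_one_pow, one_mul]) H.isOpen ht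
  refine ((h1.const_mul ((-1) ^ N)).congr_of_eventuallyEq h2).congr_deriv ?_
  rw [H.symm (N + 1) N t ht]; ring

/-- If `h_{0,2N+1}` vanishes, then `h_{0,2N}` is locally constant. -/
lemma hasDerivAt_level_zero_of_vanish (H : IsGramSystem J N w h)
    (h1 : ∀ t ∈ J, h 0 (2 * N + 1) t = 0) {t : ℝ} (ht : t ∈ J) :
    HasDerivAt (h 0 (2 * N)) 0 t := by
  have h2 : ∀ t ∈ J, HasDerivAt (h 0 (2 * N)) (w t * ((-1) ^ N * (2 * h N (N + 1) t))) t :=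
    fun t ht => H.hasDerivAt_level_zero ht
  have h3 := H.level_succ (m := 2 * N) (x := fun _ => h 0 (2 * N))
    (x' := fun _ t => (-1) ^ N * (2 * h N (N + 1) t))
    (y := fun i t => -i * ((-1) ^ N * (2 * h N (N + 1) t))) H.level_zero (fun i _ => h2)
    -- Starting from zero in row `0`, the entry of row `i` is `-i` times the derivative of
    -- `h_{0,2N}` up to sign. In row `N` this derivative is itself twice the entry, whence `(2N + 1)
    -- h_{N,N+1} = 0`.
    (by intro t ht; simp [h1 t ht]) (by intro i _ t _; push_cast; ring) N (N + 1) (by ring) t ht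
  have h4 : ((-1 : ℝ) ^ N) * (-1) ^ N = 1 := by
    rw [← pow_add, ← two_mul, (even_two_mul N).neg_one_pow]
  have h5 : (2 * (N : ℝ) + 1) * h N (N + 1) t = 0 := by
    linear_combination h3 - 2 * N * h N (N + 1) t * h4
  have h6 : h N (N + 1) t = 0 :=
    (mul_eq_zero.mp h5).resolve_left (by positivity)
  simpa [h6] using h2 t ht

/-- If `h_{0,2N}` is locally constant, then all entries with `i + j = 2 N + 1` vanish. -/
lemma level_one (H : IsGramSystem J N w h) (h0 : ∀ t ∈ J, HasDerivAt (h 0 (2 * N)) 0 t) :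
    ∀ i j, i + j = 2 * N + 1 → ∀ t ∈ J, h i j t = 0 := by
  have h1 := H.level_succ (m := 2 * N) (x := fun _ => h 0 (2 * N)) (x' := 0)
    (y := fun _ => h 0 (2 * N + 1)) H.level_zero (fun i _ t ht => by simpa using h0 t ht)
    (by intro t _; rfl) (by simp)
  intro i j hij t ht
  have h2 := h1 N (N + 1) (by ring) t ht
  -- The middle entry `h_{N,N+1}` is half the derivative of the locally constant `h_{N,N}` divided
  -- by `w`. As all entries of this antidiagonal agree up to sign, one zero suffices.
  have h3 := (H.hasDerivAt_level_zero ht).unique (h0 t ht)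
  have h4 : h N (N + 1) t = 0 := by
    have h5 : ((-1 : ℝ) ^ N) ≠ 0 := by simp
    simpa [H.ne_zero t ht, h5] using h3
  rw [h4] at h2
  have h5 : h 0 (2 * N + 1) t = 0 := by simpa using h2.symm
  rw [h1 i j hij t ht, h5, mul_zero]

lemma level_two (H : IsGramSystem J N w h) (h0 : ∀ t ∈ J, HasDerivAt (h 0 (2 * N)) 0 t) :
    ∀ i j, i + j = 2 * N + 2 → ∀ t ∈ J, h i j t = (-1) ^ i * h 0 (2 * N + 2) t :=
  H.level_succ (m := 2 * N + 1) (x := 0) (x' := 0) (y := fun _ => h 0 (2 * N + 2))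
    (fun i j hij t ht => by simp [H.level_one h0 i j hij t ht])
    (fun i _ t _ => by simp [hasDerivAt_zero]) (by intro t _; rfl) (by simp)

/-- The recursion gives row `i` as `h_{0,2N+3} - i A₁` up to sign. The two middle entries are equal
by symmetry but carry opposite signs, which forces `h_{0,2N+3} = (2N + 3) / 2 · A₁`. -/
lemma level_three (H : IsGramSystem J N w h) (h0 : ∀ t ∈ J, HasDerivAt (h 0 (2 * N)) 0 t)
    {A₁ : ℝ → ℝ} (hA₁ : ∀ t ∈ J, HasDerivAt (h 0 (2 * N + 2)) (w t * A₁ t) t) :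
    ∀ i j, i + j = 2 * N + 3 → ∀ t ∈ J,
      h i j t = (-1) ^ i * (((2 * N + 3) / 2 - i) * A₁ t) := by
  have h1 := H.level_succ (m := 2 * N + 2) (x := fun _ => h 0 (2 * N + 2)) (x' := fun _ => A₁)
    (y := fun i t => h 0 (2 * N + 3) t - i * A₁ t) (H.level_two h0)
    (fun i _ => hA₁) (by intro t _; simp) (by intro i _ t _; push_cast; ring)
  intro i j hij t ht
  have h2 := h1 (N + 1) (N + 2) (by ring) t ht
  rw [H.symm _ _ t ht, h1 (N + 2) (N + 1) (by ring) t ht] at h2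
  have h3 : ((-1 : ℝ) ^ N) * (-1) ^ N = 1 := by
    rw [← pow_add, ← two_mul, (even_two_mul N).neg_one_pow]
  have h4 : h 0 (2 * N + 3) t = (2 * N + 3) / 2 * A₁ t := by
    have h5 : (-1 : ℝ) ^ N ≠ 0 := by simp
    apply mul_left_cancel₀ h5
    push_cast [pow_succ] at h2
    linear_combination h2 / 2
  rw [h1 i j hij t ht, h4]; ring

/-- The coefficient of `A₂` is the sum of `(2N + 3) / 2 - l` over `l < i`. This antidiagonal is
even, so `h_{0,2N+4}` remains free. -/
lemma level_four (H : IsGramSystem J N w h) (h0 : ∀ t ∈ J, HasDerivAt (h 0 (2 * N)) 0 t)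
    {A₁ A₂ : ℝ → ℝ} (hA₁ : ∀ t ∈ J, HasDerivAt (h 0 (2 * N + 2)) (w t * A₁ t) t)
    (hA₂ : ∀ t ∈ J, HasDerivAt A₁ (w t * A₂ t) t) :
    ∀ i j, i + j = 2 * N + 4 → ∀ t ∈ J,
      h i j t = (-1) ^ i * (h 0 (2 * N + 4) t - i * (2 * N + 4 - i) / 2 * A₂ t) :=
  H.level_succ (m := 2 * N + 3) (x := fun i t => ((2 * N + 3) / 2 - i) * A₁ t)
    (x' := fun i t => ((2 * N + 3) / 2 - i) * A₂ t)
    (y := fun i t => h 0 (2 * N + 4) t - i * (2 * N + 4 - i) / 2 * A₂ t) (H.level_three h0 hA₁)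
    (fun i _ t ht => ((hA₂ t ht).const_mul _).congr_deriv (by ring)) (by intro t _; simp)
    (by intro i _ t _; push_cast; ring)

/-- The entries with `i + j = 2 N + 5` if those with `i + j = 2 N + 2` vanish. -/
lemma level_five (H : IsGramSystem J N w h) (h0 : ∀ t ∈ J, HasDerivAt (h 0 (2 * N)) 0 t)
    (h2 : ∀ t ∈ J, h 0 (2 * N + 2) t = 0) {Z₁ : ℝ → ℝ}
    (hZ₁ : ∀ t ∈ J, HasDerivAt (h 0 (2 * N + 4)) (w t * Z₁ t) t) :
    ∀ i j, i + j = 2 * N + 5 → ∀ t ∈ J,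
      h i j t = (-1) ^ i * (((2 * N + 5) / 2 - i) * Z₁ t) := by
  have hA₁ : ∀ t ∈ J, HasDerivAt (h 0 (2 * N + 2)) (w t * (0 : ℝ → ℝ) t) t := fun t ht => by
    simpa using (hasDerivAt_const t (0 : ℝ)).congr_of_eventuallyEq
      (Set.EqOn.eventuallyEq_isOpen h2 H.isOpen ht)
  have h4 := H.level_four (A₂ := 0) h0 hA₁ (fun t _ => by simp [hasDerivAt_zero])
  have h1 := H.level_succ (m := 2 * N + 4) (x := fun _ => h 0 (2 * N + 4)) (x' := fun _ => Z₁)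
    (y := fun i t => h 0 (2 * N + 5) t - i * Z₁ t)
    (fun i j hij t ht => by simpa using h4 i j hij t ht)
    (fun i _ => hZ₁) (by intro t _; simp) (by intro i _ t _; push_cast; ring)
  intro i j hij t ht
  have h2 := h1 (N + 2) (N + 3) (by ring) t ht
  rw [H.symm _ _ t ht, h1 (N + 3) (N + 2) (by ring) t ht] at h2
  have h4 : h 0 (2 * N + 5) t = (2 * N + 5) / 2 * Z₁ t := by
    have h5 : (-1 : ℝ) ^ N ≠ 0 := by simp
    apply mul_left_cancel₀ h5
    push_cast [pow_succ] at h2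
    linear_combination -h2 / 2
  rw [h1 i j hij t ht, h4]; ring

end IsGramSystem

/-! ### The invariant of weight four -/

/-- The invariant `Θ₄`, expressed through the entries `E = h_{0,2N}`, `A = h_{0,2N+2}`,
`Z = h_{0,2N+4}` of the Gram matrix and the second derivative `A₂` of `A`. -/
noncomputable def gramTheta (N : ℕ) (E A A₂ Z : ℝ) : ℝ :=
  -(Z - (N + 2) ^ 2 / 2 * A₂) / E + (N - 1) * (N + 2) / 10 * (A₂ / E)
    + (N + 2) * (2 * N + 3) * (5 * N - 1) / (10 * N * (N + 1) * (2 * N + 1)) * (A / E) ^ 2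

section transform

variable {J : Set ℝ} {N : ℕ} {w μ : ℝ → ℝ} {h H : ℕ → ℕ → ℝ → ℝ}

/-- The factor `μ` is, up to a constant, `w⁻ᴺ`. -/
lemma hasDerivAt_factor (hh : IsGramSystem J N 1 h) (hH : IsGramSystem J N w H)
    (hw : ContDiffOn ℝ ∞ w J) (hμ : ContDiffOn ℝ ∞ μ J) (hμ0 : ∀ t ∈ J, μ t ≠ 0)
    (hE : ∀ t ∈ J, h 0 (2 * N) t ≠ 0) (hE' : ∀ t ∈ J, HasDerivAt (h 0 (2 * N)) 0 t)
    (hF' : ∀ t ∈ J, HasDerivAt (H 0 (2 * N)) 0 t)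
    (hT : ∀ j, ∀ t ∈ J, h 0 j t
      = μ t * ∑ i ∈ Finset.range (j + 1), chainCoeff w μ j i t * H 0 i t) :
    (∀ t ∈ J, h 0 (2 * N) t = μ t ^ 2 * w t ^ (2 * N) * H 0 (2 * N) t) ∧
    ∀ t ∈ J, HasDerivAt μ (-(N : ℝ) * (deriv w t / w t) * μ t) t := by
  have h1 : ∀ t ∈ J, h 0 (2 * N) t = μ t ^ 2 * w t ^ (2 * N) * H 0 (2 * N) t := by
    intro t ht
    rw [hT _ t ht, Finset.sum_range_succ, Finset.sum_eq_zero, chainCoeff_diag]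
    · ring
    · intro i hi
      rw [hH.vanish_zero i (Finset.mem_range.mp hi) t ht, mul_zero]
  refine ⟨h1, fun t ht => ?_⟩
  have dw := (hw.differentiableAt_isOpen hh.isOpen ht).hasDerivAt
  have dμ := (hμ.differentiableAt_isOpen hh.isOpen ht).hasDerivAt
  -- Both `h_{0,2N}` and `H_{0,2N}` have derivative zero, so `μ² w²ᴺ` is locally constant and its
  -- logarithmic derivative vanishes.
  have h2 := HasDerivAt.eq_of_eqOn hh.isOpen ht (hE' t ht)
    (((dμ.pow 2).mul (dw.pow (2 * N))).mul (hF' t ht)) h1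
  refine dμ.congr_deriv ?_
  have hw0 := hH.ne_zero t ht
  have hF : H 0 (2 * N) t ≠ 0 := fun h0 => hE t ht (by rw [h1 t ht, h0, mul_zero])
  simp only [Pi.mul_apply, Pi.pow_apply, mul_zero, add_zero] at h2
  -- The case `N = 0` is separate because of the exponent `2N - 1` in the derivative of the power.
  rcases N with _ | N
  · have h3 : 2 * μ t * deriv μ t * H 0 0 t = 0 := by
      simp only [mul_zero, pow_zero, Nat.cast_ofNat] at h2
      linear_combination -h2
    have := hμ0 t ht
    have : deriv μ t = 0 := by simpa [this, hF] using h3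
    simp [this]
  · rw [show 2 * (N + 1) = 2 * N + 1 + 1 by ring] at h2
    simp only [Nat.add_sub_cancel] at h2
    push_cast at h2 ⊢
    have h3 : (2 * μ t * w t ^ (2 * N + 1) * H 0 (2 * N + 1 + 1) t)
        * (w t * deriv μ t + (N + 1) * deriv w t * μ t) = 0 := by
      linear_combination -h2
    have := hμ0 t ht
    have hF : H 0 (2 * N + 1 + 1) t ≠ 0 := hF
    have h4 : w t * deriv μ t + (N + 1) * deriv w t * μ t = 0 := by
      simpa [hw0, this, hF] using h3
    field_simp
    linear_combination h4

/-- Under `(w, μ)` with `μ` proportional to `w⁻ᴺ`, the quotients by `h_{0,2N}` transform by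
expressions in `f = w' / w` and its derivatives. The coefficients in `gramTheta` are those for which
every term involving `f`, `f'`, `f''`, `f'''` cancels. This one law serves both the canonical form
of the equation and reparametrizations of the curve. -/
theorem gramTheta_transform (hN : 1 ≤ N) (hh : IsGramSystem J N 1 h) (hH : IsGramSystem J N w H)
    (hw : ContDiffOn ℝ ∞ w J) (hμ : ContDiffOn ℝ ∞ μ J) (hμ0 : ∀ t ∈ J, μ t ≠ 0)
    (hE : ∀ t ∈ J, h 0 (2 * N) t ≠ 0) (hE' : ∀ t ∈ J, HasDerivAt (h 0 (2 * N)) 0 t)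
    (hF' : ∀ t ∈ J, HasDerivAt (H 0 (2 * N)) 0 t)
    (hT : ∀ j, ∀ t ∈ J, h 0 j t
      = μ t * ∑ i ∈ Finset.range (j + 1), chainCoeff w μ j i t * H 0 i t)
    {a₁ a₂ A₁ A₂ : ℝ → ℝ} (ha₁ : ∀ t ∈ J, HasDerivAt (h 0 (2 * N + 2)) (a₁ t) t)
    (ha₂ : ∀ t ∈ J, HasDerivAt a₁ (a₂ t) t)
    (hA₁ : ∀ t ∈ J, HasDerivAt (H 0 (2 * N + 2)) (w t * A₁ t) t)
    (hA₂ : ∀ t ∈ J, HasDerivAt A₁ (w t * A₂ t) t) {t : ℝ} (ht : t ∈ J) :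
    gramTheta N (h 0 (2 * N) t) (h 0 (2 * N + 2) t) (a₂ t) (h 0 (2 * N + 4) t)
      = w t ^ 4 *
        gramTheta N (H 0 (2 * N) t) (H 0 (2 * N + 2) t) (A₂ t) (H 0 (2 * N + 4) t) := by
  obtain ⟨hEF, hμ'⟩ := hasDerivAt_factor hh hH hw hμ hμ0 hE hE' hF' hT
  have hJ := hh.isOpen
  set f : ℝ → ℝ := fun t => deriv w t / w t with hf
  have sf : ContDiffOn ℝ ∞ f J := (hw.deriv_isOpen hJ).div hw hH.ne_zero
  have sf₁ := sf.deriv_isOpen hJ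
  have sf₂ := sf₁.deriv_isOpen hJ
  have df : ∀ t ∈ J, HasDerivAt f (deriv f t) t :=
    fun t ht => (sf.differentiableAt_isOpen hJ ht).hasDerivAt
  have df₁ : ∀ t ∈ J, HasDerivAt (deriv f) (deriv (deriv f) t) t :=
    fun t ht => (sf₁.differentiableAt_isOpen hJ ht).hasDerivAt
  have df₂ : ∀ t ∈ J, HasDerivAt (deriv (deriv f)) (deriv (deriv (deriv f)) t) t :=
    fun t ht => (sf₂.differentiableAt_isOpen hJ ht).hasDerivAt
  have dw : ∀ t ∈ J, HasDerivAt w (f t * w t) t := fun t ht =>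
    (hw.differentiableAt_isOpen hJ ht).hasDerivAt.congr_deriv
      (by simp only [hf]; field_simp [hH.ne_zero t ht])
  have hB : ∀ s ≤ 4, ∀ i : ℕ, ∀ t ∈ J, chainCoeff w μ (i + s) i t
      = μ t * w t ^ i * diagPoly N f (deriv f) (deriv (deriv f)) (deriv (deriv (deriv f))) s i t :=
    fun s hs i t ht => chainCoeff_eq_diagPoly hJ dw hμ' df df₁ df₂ hs i ht
  have hF0 : ∀ t ∈ J, H 0 (2 * N) t ≠ 0 := fun t ht h0 => hE t ht (by rw [hEF t ht, h0, mul_zero])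
  have hwt := hH.ne_zero t ht
  have hμt := hμ0 t ht
  have hz : ∀ j, ∀ t ∈ J, ∑ i ∈ Finset.range (2 * N), chainCoeff w μ j i t * H 0 i t = 0 := by
    intro j t ht
    refine Finset.sum_eq_zero fun i hi => ?_
    rw [hH.vanish_zero i (Finset.mem_range.mp hi) t ht, mul_zero]
  -- the entry `h_{0,2N+2}`
  have hA : ∀ t ∈ J, h 0 (2 * N + 2) t = μ t ^ 2 * w t ^ (2 * N) * (w t ^ 2 * H 0 (2 * N + 2) t
      + diagPoly N f (deriv f) (deriv (deriv f)) (deriv (deriv (deriv f))) 2 (2 * N : ℕ) t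
        * H 0 (2 * N) t) := by
    intro t ht
    rw [hT _ t ht, Finset.sum_range_succ, Finset.sum_range_succ, Finset.sum_range_succ, hz _ t ht,
      hB 2 (by norm_num) _ t ht, hH.level_one hF' 0 (2 * N + 1) (by ring) t ht, chainCoeff_diag]
    ring
  -- The third diagonal is absent because it multiplies `H_{0,2N+1} = 0`. The terms below `2N`
  -- vanish by nullity.
  have hZ : h 0 (2 * N + 4) t = μ t ^ 2 * w t ^ (2 * N) * (w t ^ 4 * H 0 (2 * N + 4) t
      + w t ^ 3 * diagPoly N f (deriv f) (deriv (deriv f)) (deriv (deriv (deriv f))) 1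
        (2 * N + 3 : ℕ) t * ((2 * N + 3) / 2 * A₁ t)
      + w t ^ 2 * diagPoly N f (deriv f) (deriv (deriv f)) (deriv (deriv (deriv f))) 2
        (2 * N + 2 : ℕ) t * H 0 (2 * N + 2) t
      + diagPoly N f (deriv f) (deriv (deriv f)) (deriv (deriv (deriv f))) 4 (2 * N : ℕ) t
        * H 0 (2 * N) t) := by
    rw [hT _ t ht]
    iterate 5 rw [Finset.sum_range_succ]
    rw [hz _ t ht, hB 4 (by norm_num) _ t ht,
      hH.level_one hF' 0 (2 * N + 1) (by ring) t ht, chainCoeff_diag,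
      show 2 * N + 4 = (2 * N + 3) + 1 by ring, hB 1 (by norm_num) _ t ht,
      hH.level_three hF' hA₁ 0 (2 * N + 3) (by ring) t ht,
      show 2 * N + 3 + 1 = (2 * N + 2) + 2 by ring, hB 2 (by norm_num) _ t ht]
    simp only [pow_zero, CharP.cast_eq_zero, sub_zero, one_mul]
    ring
  -- the normalised entry `a = h_{0,2N+2} / h_{0,2N}` and its derivatives
  have hR : ∀ t ∈ J, h 0 (2 * N + 2) t / h 0 (2 * N) t = w t ^ 2 * (H 0 (2 * N + 2) t
      / H 0 (2 * N) t)
      -- The inhomogeneous term is a constant multiple of the Schwarzian expression `f' - f² / 2`.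
      + (2 * N + 1) * (2 * N + 2) * (-(N / 6) * deriv f t + N / 12 * f t ^ 2) := by
    intro t ht
    have h1 := hF0 t ht
    have h2 := hH.ne_zero t ht
    have h3 := hμ0 t ht
    rw [hA t ht, hEF t ht]
    simp only [diagPoly]
    push_cast
    field_simp
    ring
  have hR₁ : ∀ t ∈ J, a₁ t / h 0 (2 * N) t = w t ^ 2 * (2 * f t * (H 0 (2 * N + 2) t
      / H 0 (2 * N) t) + w t * (A₁ t / H 0 (2 * N) t))
      + (2 * N + 1) * (2 * N + 2) * (-(N / 6) * deriv (deriv f) t + N / 6 * f t * deriv f t) := by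
    intro t ht
    have h1 := hF0 t ht
    have h2 := hE t ht
    have d := HasDerivAt.eq_of_eqOn hJ ht ((ha₁ t ht).div (hE' t ht) h2)
      ((((dw t ht).pow 2).mul ((hA₁ t ht).div (hF' t ht) h1)).add
        ((((df₁ t ht).const_mul (-((N : ℝ) / 6))).add
          (((df t ht).pow 2).const_mul ((N : ℝ) / 12))).const_mul
            ((2 * (N : ℝ) + 1) * (2 * N + 2)))) hR
    simp only [Pi.pow_apply, Pi.div_apply] at d
    have e : a₁ t / h 0 (2 * N) t
        = (a₁ t * h 0 (2 * N) t - h 0 (2 * N + 2) t * 0) / h 0 (2 * N) t ^ 2 := by field_simp; ring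
    rw [e, d]
    field_simp
    push_cast
    ring
  have hR₂ : a₂ t / h 0 (2 * N) t = w t ^ 2 * (2 * f t * (2 * f t * (H 0 (2 * N + 2) t
      / H 0 (2 * N) t) + w t * (A₁ t / H 0 (2 * N) t)) + 2 * deriv f t * (H 0 (2 * N + 2) t
      / H 0 (2 * N) t) + 3 * f t * w t * (A₁ t / H 0 (2 * N) t)
      + w t ^ 2 * (A₂ t / H 0 (2 * N) t))
      + (2 * N + 1) * (2 * N + 2) * (-(N / 6) * deriv (deriv (deriv f)) t
        + N / 6 * (deriv f t ^ 2 + f t * deriv (deriv f) t)) := by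
    have h1 := hF0 t ht
    have h2 := hE t ht
    have d := HasDerivAt.eq_of_eqOn hJ ht ((ha₂ t ht).div (hE' t ht) h2)
      ((((dw t ht).pow 2).mul ((((df t ht).const_mul 2).mul ((hA₁ t ht).div (hF' t ht) h1)).add
          ((dw t ht).mul ((hA₂ t ht).div (hF' t ht) h1)))).add
        ((((df₂ t ht).const_mul (-((N : ℝ) / 6))).add
          (((df t ht).const_mul ((N : ℝ) / 6)).mul (df₁ t ht))).const_mul
            ((2 * (N : ℝ) + 1) * (2 * N + 2)))) hR₁
    simp only [Pi.pow_apply, Pi.div_apply, Pi.mul_apply, Pi.add_apply] at d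
    have e : a₂ t / h 0 (2 * N) t
        = (a₂ t * h 0 (2 * N) t - a₁ t * 0) / h 0 (2 * N) t ^ 2 := by field_simp; ring
    rw [e, d]
    field_simp
    push_cast
    ring
  have hRZ : h 0 (2 * N + 4) t / h 0 (2 * N) t = w t ^ 4 * (H 0 (2 * N + 4) t / H 0 (2 * N) t)
      + w t ^ 3 * diagPoly N f (deriv f) (deriv (deriv f)) (deriv (deriv (deriv f))) 1
        (2 * N + 3 : ℕ) t * ((2 * N + 3) / 2 * (A₁ t / H 0 (2 * N) t))
      + w t ^ 2 * diagPoly N f (deriv f) (deriv (deriv f)) (deriv (deriv (deriv f))) 2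
        (2 * N + 2 : ℕ) t * (H 0 (2 * N + 2) t / H 0 (2 * N) t)
      + diagPoly N f (deriv f) (deriv (deriv f)) (deriv (deriv (deriv f))) 4 (2 * N : ℕ) t := by
    have h1 := hF0 t ht
    rw [hZ, hEF t ht]
    field_simp
  have hN0 : (N : ℝ) ≠ 0 := by positivity
  have e1 : ∀ E A A₂ Z : ℝ, gramTheta N E A A₂ Z = -(Z / E - (N + 2) ^ 2 / 2 * (A₂ / E))
      + (N - 1) * (N + 2) / 10 * (A₂ / E)
      + (N + 2) * (2 * N + 3) * (5 * N - 1) / (10 * N * (N + 1) * (2 * N + 1)) * (A / E) ^ 2 := by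
    intro E A A₂ Z; simp only [gramTheta]; ring
  -- What remains is a rational identity in which `f` and its derivatives, `w`, and the quotients of
  -- the `H`-entries may be treated as independent variables.
  rw [e1, e1, hR t ht, hR₂, hRZ]
  simp only [diagPoly]
  push_cast
  generalize H 0 (2 * N + 2) t / H 0 (2 * N) t = A
  generalize A₁ t / H 0 (2 * N) t = A₁
  generalize A₂ t / H 0 (2 * N) t = A₂
  generalize H 0 (2 * N + 4) t / H 0 (2 * N) t = Z
  generalize deriv (deriv (deriv f)) t = f₃
  generalize deriv (deriv f) t = f₂
  generalize deriv f t = f₁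
  generalize f t = f
  generalize w t = w
  generalize hN' : (N : ℝ) = n at hN0 ⊢
  have : n + 1 ≠ 0 := by rw [← hN']; positivity
  have : 2 * n + 1 ≠ 0 := by rw [← hN']; positivity
  field_simp
  ring

end transform

/-! ### Smooth changes of parameter -/

section parameter

variable {J : Set ℝ} {φ : ℝ → ℝ}

lemma image_mem_nhds_of_deriv_ne_zero (hJ : IsOpen J) (hφ : ContDiffOn ℝ ∞ φ J)
    (h0 : ∀ t ∈ J, deriv φ t ≠ 0) {t : ℝ} (ht : t ∈ J) : φ '' J ∈ nhds (φ t) := by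
  have h1 : HasStrictDerivAt φ (deriv φ t) t :=
    (hφ.contDiffAt (hJ.mem_nhds ht)).hasStrictDerivAt (by simp)
  rw [← h1.map_nhds_eq (h0 t ht)]
  exact Filter.image_mem_map (hJ.mem_nhds ht)

lemma isOpen_image_of_deriv_ne_zero (hJ : IsOpen J) (hφ : ContDiffOn ℝ ∞ φ J)
    (h0 : ∀ t ∈ J, deriv φ t ≠ 0) : IsOpen (φ '' J) := by
  rw [isOpen_iff_mem_nhds]
  rintro _ ⟨t, ht, rfl⟩
  exact image_mem_nhds_of_deriv_ne_zero hJ hφ h0 ht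

/-- The inverse of an injective smooth function with nonvanishing derivative is smooth. -/
lemma contDiffOn_invFunOn (hJ : IsOpen J) (hφ : ContDiffOn ℝ ∞ φ J)
    (h0 : ∀ t ∈ J, deriv φ t ≠ 0) (hinj : Set.InjOn φ J) :
    ContDiffOn ℝ ∞ (Function.invFunOn φ J) (φ '' J) := by
  rintro _ ⟨t, ht, rfl⟩
  apply ContDiffAt.contDiffWithinAt
  have h1 := hφ.contDiffAt (hJ.mem_nhds ht)
  have h2 := (hφ.differentiableAt_isOpen hJ ht).hasDerivAt.hasFDerivAt_equiv (h0 t ht)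
  have h3 := h1.to_localInverse h2 (by simp)
  have h4 := h1.hasStrictFDerivAt' h2 (by simp)
  refine h3.congr_of_eventuallyEq ?_
  have h5 := h4.eventually_right_inverse
  have h6 : ∀ᶠ s in nhds (φ t), h4.localInverse φ _ t s ∈ J := by
    have hc := h3.continuousAt
    -- The inverse function theorem supplies its own local inverse. By injectivity it agrees with
    -- `invFunOn` where its values stay in `J`.
    have h7 : h1.localInverse h2 (by simp) (φ t) = t := h4.localInverse_apply_image
    exact hc.eventually_mem (by rw [h7]; exact hJ.mem_nhds ht)
  filter_upwards [h5, h6] with s hs hs'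
  have h8 : Function.invFunOn φ J (φ (h4.localInverse φ _ t s)) = h4.localInverse φ _ t s :=
    hinj.leftInvOn_invFunOn hs'
  rw [hs] at h8
  exact h8

end parameter

/-! ### Metric connections along a curve -/

/-- A connection that is compatible with the symmetric bilinear forms `b t`. -/
structure IsMetricConnectionOn {V : Type*} [NormedAddCommGroup V] [NormedSpace ℝ V] (J : Set ℝ)
    (D : (ℝ → V) → ℝ → V) (b : ℝ → LinearMap.BilinForm ℝ V) : Prop extends
    IsConnectionOn J D where
  symm : ∀ t ∈ J, ∀ x y, b t x y = b t y x
  hasDerivAt : ∀ X Y, ContDiffOn ℝ ∞ X J → ContDiffOn ℝ ∞ Y J → ∀ t ∈ J,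
    HasDerivAt (fun s => b s (X s) (Y s)) (b t (D X t) (Y t) + b t (X t) (D Y t)) t

namespace IsMetricConnectionOn

variable {V : Type*} [NormedAddCommGroup V] [NormedSpace ℝ V] {J : Set ℝ} {D : (ℝ → V) → ℝ → V}
  {b : ℝ → LinearMap.BilinForm ℝ V} {N : ℕ} {w : ℝ → ℝ}

lemma isGramSystem (hD : IsMetricConnectionOn J D b) (hJ : IsOpen J) {W : ℕ → ℝ → V}
    (hW : ∀ i, ContDiffOn ℝ ∞ (W i) J) (hDW : ∀ i, ∀ t ∈ J, D (W i) t = w t • W (i + 1) t)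
    (hw : ∀ t ∈ J, w t ≠ 0) (h0 : ∀ j < 2 * N, ∀ t ∈ J, b t (W 0 t) (W j t) = 0) :
    IsGramSystem J N w fun i j t => b t (W i t) (W j t) where
  isOpen := hJ
  symm i j t ht := hD.symm t ht _ _
  hasDerivAt i j t ht := (hD.hasDerivAt _ _ (hW i) (hW j) t ht).congr_deriv (by
    rw [hDW i t ht, hDW j t ht]; simp; ring)
  ne_zero := hw
  vanish_zero := h0

/-- The forms `b t` are not assumed to vary smoothly. The derivative of a pairing is a sum of
pairings of smooth sections, so smoothness follows by bootstrapping. -/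
lemma contDiffOn_pairing (hD : IsMetricConnectionOn J D b) (hJ : IsOpen J) {X Y : ℝ → V}
    (hX : ContDiffOn ℝ ∞ X J) (hY : ContDiffOn ℝ ∞ Y J) :
    ContDiffOn ℝ ∞ (fun t => b t (X t) (Y t)) J := by
  rw [contDiffOn_infty]
  intro m
  induction m generalizing X Y with
  | zero =>
    rw [Nat.cast_zero, contDiffOn_zero]
    exact fun t ht => (hD.hasDerivAt X Y hX hY t ht).continuousAt.continuousWithinAt
  | succ m ih =>
    rw [Nat.cast_succ, contDiffOn_succ_iff_deriv_of_isOpen hJ]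
    refine ⟨fun t ht => (hD.hasDerivAt X Y hX hY t ht).differentiableAt.differentiableWithinAt,
      by simp, ?_⟩
    refine ((ih (hD.smooth _ hX) hY).add (ih hX (hD.smooth _ hY))).congr fun t ht => ?_
    exact (hD.hasDerivAt X Y hX hY t ht).deriv

/-- The expansion of `⟨Z₀, Zⱼ⟩` if `Z₀ = μ W₀`. -/
lemma pairing_eq_sum (hD : IsMetricConnectionOn J D b) (hJ : IsOpen J) {μ : ℝ → ℝ}
    (hw : ContDiffOn ℝ ∞ w J) (hμ : ContDiffOn ℝ ∞ μ J) {Z W : ℕ → ℝ → V}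
    (hZ : ∀ j, ∀ t ∈ J, Z (j + 1) t = D (Z j) t)
    (hWs : ∀ i, ContDiffOn ℝ ∞ (W i) J) (hW : ∀ i, ∀ t ∈ J, D (W i) t = w t • W (i + 1) t)
    (h0 : ∀ t ∈ J, Z 0 t = μ t • W 0 t) (j : ℕ) {t : ℝ} (ht : t ∈ J) :
    b t (Z 0 t) (Z j t)
      = μ t * ∑ i ∈ Finset.range (j + 1), chainCoeff w μ j i t * b t (W 0 t) (W i t) := by
  rw [hD.eq_sum_chainCoeff hJ hw hμ hZ hWs hW h0 j ht, h0 t ht]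
  simp [Finset.mul_sum, mul_left_comm]

end IsMetricConnectionOn

/-! ### The Laguerre–Forsyth form of the tractor equation -/

/-- The coefficients of a monic operator of order `k`, including the leading one. -/
def monicCoeff (k : ℕ) (q : ℕ → ℝ → ℝ) (i : ℕ) (t : ℝ) : ℝ := if i = k then 1 else q i t

lemma linearODEOp_eq_sum (k : ℕ) (q : ℕ → ℝ → ℝ) (y : ℝ → ℝ) (t : ℝ) :
    linearODEOp k q y t = ∑ i ∈ Finset.range (k + 1), monicCoeff k q i t * iteratedDeriv i y t := by
  rw [linearODEOp, Finset.sum_range_succ, add_comm]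
  congr 1
  · exact Finset.sum_congr rfl fun i hi => by
      rw [monicCoeff, if_neg (Finset.mem_range.mp hi).ne]
  · simp [monicCoeff]

namespace IsLaguerreForsythForm

variable {k : ℕ} {q p : ℕ → ℝ → ℝ} {J : Set ℝ} {φ μ : ℝ → ℝ}

lemma mono (H : IsLaguerreForsythForm k q J φ μ p) {J' : Set ℝ} (hJ' : IsOpen J') (h : J' ⊆ J) :
    IsLaguerreForsythForm k q J' φ μ p where
  isOpen := hJ'
  smooth_param := H.smooth_param.mono h
  deriv_ne_zero t ht := H.deriv_ne_zero t (h ht)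
  injOn := H.injOn.mono h
  smooth_factor := H.smooth_factor.mono h
  factor_ne_zero t ht := H.factor_ne_zero t (h ht)
  smooth_coeff i hi := (H.smooth_coeff i hi).mono (Set.image_mono h)
  transform z hz t ht := H.transform z hz t (h ht)
  canonical_one s hs := H.canonical_one s (Set.image_mono h hs)
  canonical_two s hs := H.canonical_two s (Set.image_mono h hs)

end IsLaguerreForsythForm

/-- The expansion of `(μ · (z ∘ φ))⁽ʲ⁾`. -/
lemma iteratedDeriv_mul_comp {J : Set ℝ} (hJ : IsOpen J) {φ μ z : ℝ → ℝ}
    (hφ : ContDiffOn ℝ ∞ φ J) (hμ : ContDiffOn ℝ ∞ μ J) (hz : ContDiff ℝ ∞ z) (j : ℕ) {t : ℝ}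
    (ht : t ∈ J) : iteratedDeriv j (fun s => μ s * z (φ s)) t
      = ∑ i ∈ Finset.range (j + 1), chainCoeff (deriv φ) μ j i t * iteratedDeriv i z (φ t) := by
  have hz' : ∀ i, ContDiff ℝ ∞ (iteratedDeriv i z) := fun i => by
    rw [iteratedDeriv_eq_iterate, ← contDiffOn_univ]
    exact (isConnectionOn_deriv isOpen_univ).iterate_smooth hz.contDiffOn i
  refine (isConnectionOn_deriv hJ).eq_sum_chainCoeff hJ (hφ.deriv_isOpen hJ) hμ
    (Z := fun j => iteratedDeriv j (fun s => μ s * z (φ s)))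
    (W := fun i s => iteratedDeriv i z (φ s)) (fun j s _ => by rw [iteratedDeriv_succ])
    (fun i => (hz' i).comp_contDiffOn hφ) (fun i s hs => ?_) (fun s _ => by simp) j ht
  have h1 : HasDerivAt (iteratedDeriv i z) (iteratedDeriv (i + 1) z (φ s)) (φ s) := by
    rw [iteratedDeriv_succ]
    exact ((hz' i).differentiable (by simp) _).hasDerivAt
  refine (h1.comp s (hφ.differentiableAt_isOpen hJ hs).hasDerivAt).deriv.trans ?_
  rw [smul_eq_mul, mul_comm]

/-- The coefficients of an equation and of the transformed equation. -/
lemma sum_monicCoeff_mul_chainCoeff {k : ℕ} {q p : ℕ → ℝ → ℝ} {J : Set ℝ} {φ μ : ℝ → ℝ}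
    (hJ : IsOpen J) (hφ : ContDiffOn ℝ ∞ φ J) (hμ : ContDiffOn ℝ ∞ μ J) {t c : ℝ} (ht : t ∈ J) :
    (∀ z : ℝ → ℝ, ContDiff ℝ ∞ z →
      linearODEOp k q (fun s => μ s * z (φ s)) t = c * linearODEOp k p z (φ t)) ↔
    ∀ i ≤ k, ∑ j ∈ Finset.range (k + 1), monicCoeff k q j t * chainCoeff (deriv φ) μ j i t
      = c * monicCoeff k p i (φ t) := by
  have key : ∀ z : ℝ → ℝ, ContDiff ℝ ∞ z → linearODEOp k q (fun s => μ s * z (φ s)) t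
      = ∑ i ∈ Finset.range (k + 1), (∑ j ∈ Finset.range (k + 1),
        monicCoeff k q j t * chainCoeff (deriv φ) μ j i t) * iteratedDeriv i z (φ t) := by
    intro z hz
    rw [linearODEOp_eq_sum]
    simp only [Finset.sum_mul]
    rw [Finset.sum_comm]
    refine Finset.sum_congr rfl fun j hj => ?_
    rw [iteratedDeriv_mul_comp hJ hφ hμ hz j ht, Finset.mul_sum]
    have hjk : Finset.range (j + 1) ⊆ Finset.range (k + 1) :=
      Finset.range_mono (by have := Finset.mem_range.mp hj; omega)
    rw [← Finset.sum_subset hjk]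
    · exact Finset.sum_congr rfl fun i _ => by ring
    · intro i _ hi
      rw [chainCoeff_of_lt (show j < i by simpa using hi)]
      simp
  constructor
  · intro h m hm
    -- At `φ t` only the `m`-th derivative of this test function is nonzero, which isolates the
    -- coefficient with index `m`.
    have h1 := h (fun x => (x - φ t) ^ m) (by fun_prop)
    rw [key (fun x => (x - φ t) ^ m) (by fun_prop), linearODEOp_eq_sum] at h1
    have h2 : ∀ i, iteratedDeriv i (fun x => (x - φ t) ^ m) (φ t)
        = if i = m then (m.factorial : ℝ) else 0 := by
      intro i
      have := congrFun (iteratedDeriv_comp_sub_const (n := i) (f := fun x : ℝ => x ^ m)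
        (s := φ t)) (φ t)
      rw [this, sub_self, iteratedDeriv_fun_pow_zero]
      split_ifs <;> simp
    simp only [h2, mul_ite, mul_zero, Finset.sum_ite_eq', Finset.mem_range] at h1
    rw [if_pos (by omega), if_pos (by omega)] at h1
    have h3 : (m.factorial : ℝ) ≠ 0 := by positivity
    apply mul_right_cancel₀ h3
    rw [h1]; ring
  · intro h z hz
    rw [key z hz, linearODEOp_eq_sum, Finset.mul_sum]
    refine Finset.sum_congr rfl fun i hi => ?_
    rw [h i (by have := Finset.mem_range.mp hi; omega)]; ring

/-- Used where vanishing Gram entries or chain coefficients leave only the top few terms of an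
equation. -/
lemma sum_range_eq_top {x : ℕ → ℝ} {k m l : ℕ} (hk : k = m + l) (hx : ∀ i < m, x i = 0) :
    ∑ i ∈ Finset.range k, x i = ∑ i ∈ Finset.range l, x (m + i) := by
  rw [hk, Finset.sum_range_add, Finset.sum_eq_zero fun i hi => hx i (Finset.mem_range.mp hi),
    zero_add]

/-! ### The sections transformed along with the equation, and the resulting invariants -/

section uniqueness

variable {V : Type*} [NormedAddCommGroup V] [NormedSpace ℝ V] {J : Set ℝ} {D : (ℝ → V) → ℝ → V}
  {b : ℝ → LinearMap.BilinForm ℝ V} {N : ℕ} {φ μ : ℝ → ℝ} {q p : ℕ → ℝ → ℝ}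

/-- The sections `W⁽ⁱ⁾` that are obtained from `W⁽⁰⁾ = μ⁻¹ T` by covariant differentiation with
respect to a parameter with differential `w dt`. -/
noncomputable def rescaledSection (D : (ℝ → V) → ℝ → V) (w μ : ℝ → ℝ) (T : ℝ → V) (i : ℕ) :
    ℝ → V :=
  (fun X t => (w t)⁻¹ • D X t)^[i] fun t => (μ t)⁻¹ • T t

lemma rescaledSection_smooth (hD : IsConnectionOn J D) {w : ℝ → ℝ} {T : ℝ → V}
    (hw : ContDiffOn ℝ ∞ w J) (hw0 : ∀ t ∈ J, w t ≠ 0) (hμ : ContDiffOn ℝ ∞ μ J)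
    (hμ0 : ∀ t ∈ J, μ t ≠ 0) (hT : ContDiffOn ℝ ∞ T J) (i : ℕ) :
    ContDiffOn ℝ ∞ (rescaledSection D w μ T i) J := by
  induction i with
  | zero => exact (hμ.inv hμ0).smul hT
  | succ i ih =>
    rw [rescaledSection, Function.iterate_succ_apply']
    exact (hw.inv hw0).smul (hD.smooth _ ih)

lemma rescaledSection_deriv {w : ℝ → ℝ} {T : ℝ → V} (i : ℕ) {t : ℝ} (hw0 : w t ≠ 0) :
    D (rescaledSection D w μ T i) t = w t • rescaledSection D w μ T (i + 1) t := by
  simp only [rescaledSection, Function.iterate_succ_apply', smul_smul, mul_inv_cancel₀ hw0,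
    one_smul]

/-- The transformed equation is satisfied by the rescaled section. -/
theorem rescaled_equation (hD : IsMetricConnectionOn J D b) (hJ : IsOpen J) {T : ℝ → V}
    (hT : ContDiffOn ℝ ∞ T J) {k : ℕ}
    (hq : ∀ t ∈ J, ∀ j < k,
      ∑ i ∈ Finset.range (k + 1), monicCoeff k q i t * b t (D^[i] T t) (D^[j] T t) = 0)
    (H : IsLaguerreForsythForm k q J φ μ p) {t : ℝ} (ht : t ∈ J) {j : ℕ} (hj : j < k) :
    ∑ i ∈ Finset.range (k + 1), monicCoeff k p i (φ t)
      * b t (rescaledSection D (deriv φ) μ T i t) (rescaledSection D (deriv φ) μ T j t) = 0 := by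
  have hw := H.smooth_param.deriv_isOpen hJ
  set W := rescaledSection D (deriv φ) μ T with hW
  have hWs : ∀ i, ContDiffOn ℝ ∞ (W i) J := rescaledSection_smooth hD.toIsConnectionOn hw
    H.deriv_ne_zero H.smooth_factor H.factor_ne_zero hT
  have hTW : ∀ j, D^[j] T t = ∑ i ∈ Finset.range (j + 1), chainCoeff (deriv φ) μ j i t • W i t := by
    intro j
    refine hD.eq_sum_chainCoeff hJ hw H.smooth_factor (Z := fun j => D^[j] T)
      (fun j t _ => by rw [Function.iterate_succ_apply']) hWs
      (fun i t ht => rescaledSection_deriv i (H.deriv_ne_zero t ht)) (fun t ht => ?_) j ht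
    simp [hW, rescaledSection, smul_smul, H.factor_ne_zero t ht]
  set S := ∑ i ∈ Finset.range (k + 1), monicCoeff k p i (φ t) • W i t with hS
  have hc : μ t * deriv φ t ^ k ≠ 0 :=
    mul_ne_zero (H.factor_ne_zero t ht) (pow_ne_zero _ (H.deriv_ne_zero t ht))
  -- The transformation hypothesis concerns scalar functions. Read as an identity between
  -- coefficients, it applies equally to vector-valued sections.
  have h1 := (sum_monicCoeff_mul_chainCoeff hJ H.smooth_param H.smooth_factor ht).mp
    (fun z hz => H.transform z hz t ht)
  have h2 : (μ t * deriv φ t ^ k) • S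
      = ∑ j ∈ Finset.range (k + 1), monicCoeff k q j t • D^[j] T t := by
    rw [hS, Finset.smul_sum]
    have h3 : ∀ j ∈ Finset.range (k + 1), monicCoeff k q j t • D^[j] T t
        = ∑ i ∈ Finset.range (k + 1),
          (monicCoeff k q j t * chainCoeff (deriv φ) μ j i t) • W i t := by
      intro j hj
      rw [hTW j, Finset.smul_sum]
      have hjk : Finset.range (j + 1) ⊆ Finset.range (k + 1) :=
        Finset.range_mono (by have := Finset.mem_range.mp hj; omega)
      rw [← Finset.sum_subset hjk]
      · exact Finset.sum_congr rfl fun i _ => by rw [smul_smul]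
      · intro i _ hi
        rw [chainCoeff_of_lt (show j < i by simpa using hi)]
        simp
    rw [Finset.sum_congr rfl h3, Finset.sum_comm]
    refine Finset.sum_congr rfl fun i hi => ?_
    rw [← Finset.sum_smul, h1 i (by have := Finset.mem_range.mp hi; omega), smul_smul]
  have h3 : ∀ j < k, b t S (D^[j] T t) = 0 := by
    intro j hj
    have h4 : b t ((μ t * deriv φ t ^ k) • S) (D^[j] T t) = 0 := by
      rw [h2]
      simpa using hq t ht j hj
    simpa [hc, H.factor_ne_zero t ht, H.deriv_ne_zero t ht] using h4
  -- `T⁽ʲ⁾` is a combination of `W₀, …, W_j` with nonzero leading coefficient `μ φ'ʲ`, so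
  -- orthogonality passes from the `T⁽ʲ⁾` to the `W_j` by strong induction.
  have h4 : ∀ j < k, b t S (W j t) = 0 := by
    intro j
    induction j using Nat.strong_induction_on with
    | _ j ih =>
      intro hj
      have h5 := h3 j hj
      rw [hTW j, Finset.sum_range_succ, map_add, map_sum, Finset.sum_eq_zero, zero_add,
        chainCoeff_diag, map_smul, smul_eq_mul] at h5
      · simpa [H.factor_ne_zero t ht, H.deriv_ne_zero t ht] using h5
      · intro i hi
        have := Finset.mem_range.mp hi
        rw [map_smul, ih i this (by omega), smul_zero]
  have h5 := h4 j hj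
  rw [hS] at h5
  simpa using h5

/-- The Wilczynski invariants of weight three, four and five of the equation of a curve. -/
theorem canonicalInvariant_eq (hD : IsMetricConnectionOn J D b) (hJ : IsOpen J) {T : ℝ → V}
    (hT : ContDiffOn ℝ ∞ T J) (hN : 1 ≤ N)
    (h0 : ∀ j < 2 * N, ∀ t ∈ J, b t (T t) (D^[j] T t) = 0)
    (hE : ∀ t ∈ J, b t (T t) (D^[2 * N] T t) ≠ 0)
    (hE' : ∀ t ∈ J, HasDerivAt (fun t => b t (T t) (D^[2 * N] T t)) 0 t)
    {a₁ a₂ : ℝ → ℝ}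
    (ha₁ : ∀ t ∈ J, HasDerivAt (fun t => b t (T t) (D^[2 * N + 2] T t)) (a₁ t) t)
    (ha₂ : ∀ t ∈ J, HasDerivAt a₁ (a₂ t) t)
    (hq : ∀ t ∈ J, ∀ j < 2 * N + 1, ∑ i ∈ Finset.range (2 * N + 1 + 1),
      monicCoeff (2 * N + 1) q i t * b t (D^[i] T t) (D^[j] T t) = 0)
    (H : IsLaguerreForsythForm (2 * N + 1) q J φ μ p) {t : ℝ} (ht : t ∈ J) :
    deriv φ t ^ 3 * canonicalInvariant (2 * N + 1) 3 p (φ t) = 0 ∧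
    (2 ≤ N → deriv φ t ^ 4 * canonicalInvariant (2 * N + 1) 4 p (φ t)
      = gramTheta N (b t (T t) (D^[2 * N] T t)) (b t (T t) (D^[2 * N + 2] T t)) (a₂ t)
        (b t (T t) (D^[2 * N + 4] T t))) ∧
    (2 ≤ N → deriv φ t ^ 5 * canonicalInvariant (2 * N + 1) 5 p (φ t) = 0) := by
  have hw := H.smooth_param.deriv_isOpen hJ
  have hw0 := H.deriv_ne_zero
  set W := rescaledSection D (deriv φ) μ T with hW
  have hWs : ∀ i, ContDiffOn ℝ ∞ (W i) J := rescaledSection_smooth hD.toIsConnectionOn hw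
    hw0 H.smooth_factor H.factor_ne_zero hT
  have hDW : ∀ i, ∀ t ∈ J, D (W i) t = deriv φ t • W (i + 1) t :=
    fun i t ht => rescaledSection_deriv i (hw0 t ht)
  have hTs := hD.iterate_smooth hT
  have hTW0 : ∀ t ∈ J, D^[0] T t = μ t • W 0 t := fun t ht => by
    simp [hW, rescaledSection, smul_smul, H.factor_ne_zero t ht]
  have hpair := fun (j : ℕ) (t : ℝ) (ht : t ∈ J) => hD.pairing_eq_sum hJ hw H.smooth_factor
    (Z := fun j => D^[j] T) (fun j t _ => by rw [Function.iterate_succ_apply']) hWs hDW hTW0 j ht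
  -- the Gram matrices of both sequences
  have G : IsGramSystem J N 1 fun i j t => b t (D^[i] T t) (D^[j] T t) :=
    hD.isGramSystem hJ hTs (fun i t _ => by rw [Function.iterate_succ_apply']; simp)
      (by simp) h0
  have hW0 : ∀ j < 2 * N, ∀ t ∈ J, b t (W 0 t) (W j t) = 0 := by
    intro j
    induction j using Nat.strong_induction_on with
    | _ j ih =>
      intro hj t ht
      have h1 : _ = _ := hpair j t ht
      rw [Finset.sum_range_succ, Finset.sum_eq_zero, zero_add, chainCoeff_diag] at h1
      · have h2 := h0 j hj t ht
        rw [Function.iterate_zero, id_eq, h2] at h1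
        simpa [H.factor_ne_zero t ht, hw0 t ht] using h1.symm
      · intro i hi
        have := Finset.mem_range.mp hi
        rw [ih i this (by omega) t ht, mul_zero]
  have K : IsGramSystem J N (deriv φ) fun i j t => b t (W i t) (W j t) :=
    hD.isGramSystem hJ hWs hDW hw0 hW0
  have hF0 : ∀ t ∈ J, b t (W 0 t) (W (2 * N) t) ≠ 0 := by
    intro t ht h1
    have h2 : _ = _ := hpair (2 * N) t ht
    rw [Finset.sum_range_succ, Finset.sum_eq_zero, h1] at h2
    · exact hE t ht (by simpa using h2)
    · intro i hi
      rw [hW0 i (Finset.mem_range.mp hi) t ht, mul_zero]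
  -- the transformed equation
  have heq : ∀ t ∈ J, ∀ j m l, 2 * N = m + j → j + 2 = l → ∑ i ∈ Finset.range l,
      monicCoeff (2 * N + 1) p (m + i) (φ t) * b t (W (m + i) t) (W j t) = 0 := by
    intro t ht j m l hm hl
    have h1 := rescaled_equation hD hJ hT hq H ht (j := j) (by omega)
    rwa [sum_range_eq_top (m := m) (l := l) (by omega)] at h1
    intro i hi
    rw [show b t (rescaledSection D (deriv φ) μ T i t) (rescaledSection D (deriv φ) μ T j t) = 0
      from K.vanish (show i + j < 2 * N by omega) ht, mul_zero]
  have hp1 : ∀ t ∈ J, p (2 * N) (φ t) = 0 :=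
    fun t ht => H.canonical_one (φ t) (Set.mem_image_of_mem _ ht)
  have hp2 : ∀ t ∈ J, p (2 * N - 1) (φ t) = 0 :=
    fun t ht => H.canonical_two (φ t) (Set.mem_image_of_mem _ ht)
  -- Pairing with `W₀`: the condition `p_{2N} = 0` is the vanishing of the antidiagonal `2N + 1`.
  have hK1 : ∀ t ∈ J, b t (W 0 t) (W (2 * N + 1) t) = 0 := by
    intro t ht
    have h1 := heq t ht 0 (2 * N) 2 (by ring) rfl
    simp only [Finset.sum_range_succ, Finset.sum_range_zero, monicCoeff] at h1
    simp only [add_zero, hp1 t ht, (Nat.lt_succ_self (2 * N)).ne, if_false, if_true] at h1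
    rw [hD.symm t ht]
    linear_combination h1
  have hF' : ∀ t ∈ J, HasDerivAt (fun t => b t (W 0 t) (W (2 * N) t)) 0 t :=
    fun t ht => K.hasDerivAt_level_zero_of_vanish hK1 ht
  -- Pairing with `W₁`: the second canonical condition `p_{2N-1} = 0` removes the analogue of `α`.
  have hK2 : ∀ t ∈ J, b t (W 0 t) (W (2 * N + 2) t) = 0 := by
    intro t ht
    have h1 := heq t ht 1 (2 * N - 1) 3 (by omega) rfl
    simp only [Finset.sum_range_succ, Finset.sum_range_zero, monicCoeff,
      show 2 * N - 1 + 1 = 2 * N by omega, show 2 * N - 1 + 2 = 2 * N + 1 by omega,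
      show 2 * N - 1 ≠ 2 * N + 1 by omega, show 2 * N ≠ 2 * N + 1 by omega, if_false, if_true,
      add_zero, hp1 t ht, hp2 t ht] at h1
    have h2 := K.level_two hF' (2 * N + 1) 1 (by ring) t ht
    rw [h2] at h1
    simpa using h1
  have hA₁ : ∀ t ∈ J, HasDerivAt (fun t => b t (W 0 t) (W (2 * N + 2) t))
      (deriv φ t * (0 : ℝ → ℝ) t) t := fun t ht => by
    simpa using (hasDerivAt_const t (0 : ℝ)).congr_of_eventuallyEq
      (Set.EqOn.eventuallyEq_isOpen hK2 hJ ht)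
  have hA₂ : ∀ t ∈ J, HasDerivAt (0 : ℝ → ℝ) (deriv φ t * (0 : ℝ → ℝ) t) t := fun t _ => by
    simp [hasDerivAt_zero]
  -- Pairing with `W₂`: the antidiagonal `2N + 3` is proportional to the derivative of the preceding
  -- even one, which is zero.
  have hp3 : ∀ t ∈ J, p (2 * N - 2) (φ t) = 0 := by
    intro t ht
    have h1 := heq t ht 2 (2 * N - 2) 4 (by omega) rfl
    simp only [Finset.sum_range_succ, Finset.sum_range_zero, monicCoeff,
      show 2 * N - 2 + 1 = 2 * N - 1 by omega, show 2 * N - 2 + 2 = 2 * N by omega,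
      show 2 * N - 2 + 3 = 2 * N + 1 by omega, show 2 * N - 2 ≠ 2 * N + 1 by omega,
      show 2 * N - 1 ≠ 2 * N + 1 by omega, show 2 * N ≠ 2 * N + 1 by omega, if_false, if_true,
      add_zero, hp1 t ht, hp2 t ht] at h1
    have h2 := K.level_three hF' hA₁ (2 * N + 1) 2 (by ring) t ht
    have h3 := K.level_zero (2 * N - 2) 2 (by omega) t ht
    rw [h2, h3] at h1
    simpa [hF0 t ht] using h1
  have hp3' : p (2 * N - 2) =ᶠ[nhds (φ t)] fun _ => 0 := by
    filter_upwards [image_mem_nhds_of_deriv_ne_zero hJ H.smooth_param hw0 ht]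
    rintro _ ⟨s, hs, rfl⟩
    exact hp3 s hs
  have hp3i : ∀ i, iteratedDeriv i (p (2 * N - 2)) (φ t) = 0 := fun i => by
    rw [hp3'.iteratedDeriv_eq]; simp
  refine ⟨?_, fun hN2 => ?_, fun hN2 => ?_⟩
  · simp only [canonicalInvariant, show 3 - 2 = 1 by norm_num, Finset.sum_range_one]
    rw [show 2 * N + 1 - (3 - 0) = 2 * N - 2 by omega, hp3i]
    simp
  all_goals
    -- Pairing with `W₃`. From here on `2 ≤ N` is needed, since otherwise the subtraction in `2 * N
    -- - 3` truncates.
    have hp4 : ∀ t ∈ J, p (2 * N - 3) (φ t)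
        = -(b t (W 0 t) (W (2 * N + 4) t) / b t (W 0 t) (W (2 * N) t)) := by
      intro t ht
      have h1 := heq t ht 3 (2 * N - 3) 5 (by omega) rfl
      simp only [Finset.sum_range_succ, Finset.sum_range_zero, monicCoeff,
        show 2 * N - 3 + 1 = 2 * N - 2 by omega, show 2 * N - 3 + 2 = 2 * N - 1 by omega,
        show 2 * N - 3 + 3 = 2 * N by omega, show 2 * N - 3 + 4 = 2 * N + 1 by omega,
        show 2 * N - 2 ≠ 2 * N + 1 by omega, show 2 * N - 3 ≠ 2 * N + 1 by omega,
        show 2 * N - 1 ≠ 2 * N + 1 by omega, show 2 * N ≠ 2 * N + 1 by omega, if_false, if_true,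
        add_zero, hp1 t ht, hp2 t ht, hp3 t ht] at h1
      have h2 := K.level_four hF' hA₁ hA₂ (2 * N + 1) 3 (by ring) t ht
      have h3 := K.level_zero (2 * N - 3) 3 (by omega) t ht
      rw [h2, h3, show 2 * N - 3 = 2 * (N - 2) + 1 by omega] at h1
      rw [show 2 * N - 3 = 2 * (N - 2) + 1 by omega]
      have h4 : p (2 * (N - 2) + 1) (φ t) * b t (W 0 t) (W (2 * N) t)
          = -b t (W 0 t) (W (2 * N + 4) t) := by
        simp only [pow_succ, (even_two_mul N).neg_one_pow, (even_two_mul (N - 2)).neg_one_pow,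
          Pi.zero_apply] at h1
        linear_combination -h1
      have := hF0 t ht
      field_simp
      linear_combination h4
  -- In the canonical frame `h_{0,2N+2}` and its derivatives are zero, so `gramTheta` reduces to
  -- `-h_{0,2N+4} / h_{0,2N} = p_{2N-3}`.
  · have h1 := gramTheta_transform hN G K hw H.smooth_factor H.factor_ne_zero hE hE' hF' hpair
      ha₁ ha₂ hA₁ hA₂ ht
    have h2 : canonicalInvariant (2 * N + 1) 4 p (φ t) = p (2 * N - 3) (φ t) := by
      have hc : ((2 * N + 1).choose 4 : ℝ) ≠ 0 := by
        have := Nat.choose_pos (show 4 ≤ 2 * N + 1 by omega)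
        positivity
      simp only [canonicalInvariant, show 4 - 2 = 2 by norm_num, Finset.sum_range_succ,
        Finset.sum_range_zero]
      rw [show 2 * N + 1 - (4 - 0) = 2 * N - 3 by omega,
        show 2 * N + 1 - (4 - 1) = 2 * N - 2 by omega, hp3i]
      norm_num [Nat.factorial]
      field_simp
    rw [h2, hp4 t ht]
    refine Eq.trans ?_ h1.symm
    simp only [hK2 t ht, gramTheta]
    simp [neg_div]
  · set Z₁ : ℝ → ℝ := fun t => b t (W 1 t) (W (2 * N + 4) t) + b t (W 0 t) (W (2 * N + 5) t)
    have hZ₁ : ∀ t ∈ J, HasDerivAt (fun t => b t (W 0 t) (W (2 * N + 4) t)) (deriv φ t * Z₁ t) t :=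
      fun t ht => K.hasDerivAt 0 (2 * N + 4) t ht
    -- Pairing with `W₄`: the factor `(2N - 3) / 2` is that of `level_five` in row `2N + 1`, and the
    -- `p_{2N-3}` term meets the vanishing antidiagonal `2N + 1`.
    have hp5 : p (2 * N - 4) (φ t) = -((2 * N - 3) / 2 * (Z₁ t / b t (W 0 t) (W (2 * N) t))) := by
      have h1 := heq t ht 4 (2 * N - 4) 6 (by omega) rfl
      simp only [Finset.sum_range_succ, Finset.sum_range_zero, monicCoeff,
        show 2 * N - 4 + 1 = 2 * N - 3 by omega,
        show 2 * N - 4 + 2 = 2 * N - 2 by omega, show 2 * N - 4 + 3 = 2 * N - 1 by omega,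
        show 2 * N - 4 + 4 = 2 * N by omega, show 2 * N - 4 + 5 = 2 * N + 1 by omega,
        show 2 * N - 2 ≠ 2 * N + 1 by omega, show 2 * N - 3 ≠ 2 * N + 1 by omega,
        show 2 * N - 4 ≠ 2 * N + 1 by omega,
        show 2 * N - 1 ≠ 2 * N + 1 by omega, show 2 * N ≠ 2 * N + 1 by omega, if_false, if_true,
        add_zero, hp1 t ht, hp2 t ht, hp3 t ht] at h1
      have h2 := K.level_five hF' hK2 hZ₁ (2 * N + 1) 4 (by ring) t ht
      have h3 := K.level_zero (2 * N - 4) 4 (by omega) t ht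
      have h4 := K.level_one hF' (2 * N - 3) 4 (by omega) t ht
      rw [h2, h3, h4, show 2 * N - 4 = 2 * (N - 2) by omega] at h1
      rw [show 2 * N - 4 = 2 * (N - 2) by omega]
      simp only [pow_succ, (even_two_mul N).neg_one_pow, (even_two_mul (N - 2)).neg_one_pow] at h1
      push_cast at h1
      have := hF0 t ht
      field_simp
      linear_combination 2 * h1
    have hp4' : deriv (p (2 * N - 3)) (φ t) = -(Z₁ t / b t (W 0 t) (W (2 * N) t)) := by
      have d1 : HasDerivAt (p (2 * N - 3)) (deriv (p (2 * N - 3)) (φ t)) (φ t) :=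
        ((H.smooth_coeff (2 * N - 3) (by omega)).differentiableAt_isOpen
          (isOpen_image_of_deriv_ne_zero hJ H.smooth_param hw0)
          (Set.mem_image_of_mem _ ht)).hasDerivAt
      have d2 := d1.comp t (H.smooth_param.differentiableAt_isOpen hJ ht).hasDerivAt
      have h1 := HasDerivAt.eq_of_eqOn hJ ht d2
        (((hZ₁ t ht).div (hF' t ht) (hF0 t ht)).neg) (fun s hs => by simpa using hp4 s hs)
      have hF := hF0 t ht
      have hw := hw0 t ht
      field_simp at h1 ⊢
      apply mul_left_cancel₀ (mul_ne_zero hw hF)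
      linear_combination h1
    have h2 : canonicalInvariant (2 * N + 1) 5 p (φ t)
        = p (2 * N - 4) (φ t) - (2 * N - 3) / 2 * deriv (p (2 * N - 3)) (φ t) := by
      have hc : ((2 * N + 1).choose 5 : ℝ) ≠ 0 := by
        have := Nat.choose_pos (show 5 ≤ 2 * N + 1 by omega)
        positivity
      have hc4 : ((2 * N + 1).choose 4 : ℝ) ≠ 0 := by
        have := Nat.choose_pos (show 4 ≤ 2 * N + 1 by omega)
        positivity
      -- This ratio of binomial coefficients turns the constant `5 / 2` of the `j = 1` term into
      -- `(2N - 3) / 2`, so that it cancels against `hp5`.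
      have hc' : ((2 * N + 1).choose 5 : ℝ) * 5 = (2 * N + 1).choose 4 * (2 * N - 3) := by
        have := Nat.choose_succ_right_eq (2 * N + 1) 4
        have h3 : ((2 * N + 1 - 4 : ℕ) : ℝ) = 2 * N - 3 := by
          rw [Nat.cast_sub (by omega)]; push_cast; ring
        rw [← h3]
        exact_mod_cast this
      simp only [canonicalInvariant, show 5 - 2 = 3 by norm_num, Finset.sum_range_succ,
        Finset.sum_range_zero]
      rw [show 2 * N + 1 - (5 - 0) = 2 * N - 4 by omega,
        show 2 * N + 1 - (5 - 1) = 2 * N - 3 by omega,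
        show 2 * N + 1 - (5 - 2) = 2 * N - 2 by omega, hp3i]
      norm_num [Nat.factorial, iteratedDeriv_one]
      field_simp
      linear_combination -deriv (p (2 * N - 3)) (φ t) * hc'
    rw [h2, hp5, hp4']
    ring

end uniqueness

/-! ### Existence of the Laguerre–Forsyth form -/

/-- Local solutions of the Riccati equation `f' = f² / 2 + S`, together with solutions of
`w' = f w` and `φ' = w`. -/
lemma exists_riccati {I : Set ℝ} (hI : IsOpen I) {S : ℝ → ℝ} (hS : ContDiffOn ℝ ∞ S I) {t₀ : ℝ}
    (ht₀ : t₀ ∈ I) : ∃ ε > 0, Set.Ioo (t₀ - ε) (t₀ + ε) ⊆ I ∧ ∃ f w φ : ℝ → ℝ,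
      ∀ t ∈ Set.Ioo (t₀ - ε) (t₀ + ε), HasDerivAt f (f t ^ 2 / 2 + S t) t ∧
        HasDerivAt w (f t * w t) t ∧ HasDerivAt φ (w t) t ∧ 0 < w t := by
  -- Time is added as a first coordinate to make the system autonomous. The remaining coordinates
  -- are `f`, `w`, `φ` with initial values `0`, `1`, `0`.
  let v : ℝ × ℝ × ℝ × ℝ → ℝ × ℝ × ℝ × ℝ :=
    fun x => (1, x.2.1 ^ 2 / 2 + S x.1, x.2.1 * x.2.2.1, x.2.2.1)
  have hv : ContDiffAt ℝ 1 v (t₀, 0, 1, 0) := by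
    have hS1 : ContDiffAt ℝ 1 (fun x : ℝ × ℝ × ℝ × ℝ => S x.1) (t₀, 0, 1, 0) :=
      ContDiffAt.comp (t₀, (0 : ℝ), (1 : ℝ), (0 : ℝ))
        ((hS.contDiffAt (hI.mem_nhds ht₀)).of_le (by simp)) contDiffAt_fst
    have h1 : ContDiffAt ℝ 1 (fun x : ℝ × ℝ × ℝ × ℝ => x.2.1) (t₀, 0, 1, 0) := by fun_prop
    have h2 : ContDiffAt ℝ 1 (fun x : ℝ × ℝ × ℝ × ℝ => x.2.2.1) (t₀, 0, 1, 0) := by fun_prop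
    exact contDiffAt_const.prodMk ((((h1.pow 2).div_const 2).add hS1).prodMk ((h1.mul h2).prodMk h2))
  obtain ⟨x, hx0, ε, hε, hx⟩ :=
    hv.exists_forall_mem_closedBall_exists_eq_forall_mem_Ioo_hasDerivAt₀ t₀
  have d1 : ∀ t ∈ Set.Ioo (t₀ - ε) (t₀ + ε), HasDerivAt (fun t => (x t).1) (v (x t)).1 t ∧
      HasDerivAt (fun t => (x t).2.1) (v (x t)).2.1 t ∧
      HasDerivAt (fun t => (x t).2.2.1) (v (x t)).2.2.1 t ∧
      HasDerivAt (fun t => (x t).2.2.2) (v (x t)).2.2.2 t := by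
    intro t ht
    let L := ContinuousLinearMap.snd ℝ ℝ (ℝ × ℝ × ℝ)
    let L' := (ContinuousLinearMap.snd ℝ ℝ (ℝ × ℝ)).comp L
    exact ⟨(ContinuousLinearMap.fst ℝ ℝ (ℝ × ℝ × ℝ)).hasFDerivAt.comp_hasDerivAt t (hx t ht),
      ((ContinuousLinearMap.fst ℝ ℝ (ℝ × ℝ)).comp L).hasFDerivAt.comp_hasDerivAt t (hx t ht),
      ((ContinuousLinearMap.fst ℝ ℝ ℝ).comp L').hasFDerivAt.comp_hasDerivAt t (hx t ht),
      ((ContinuousLinearMap.snd ℝ ℝ ℝ).comp L').hasFDerivAt.comp_hasDerivAt t (hx t ht)⟩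
  have h0 : t₀ ∈ Set.Ioo (t₀ - ε) (t₀ + ε) := by constructor <;> linarith
  have h1 : ∀ t ∈ Set.Ioo (t₀ - ε) (t₀ + ε), (x t).1 = t := by
    intro t ht
    have hd : ∀ s ∈ Set.Ioo (t₀ - ε) (t₀ + ε), HasDerivAt (fun s => (x s).1 - s) 0 s := by
      intro s hs
      exact ((d1 s hs).1.sub (hasDerivAt_id s)).congr_deriv (sub_self _)
    have hc := (convex_Ioo (t₀ - ε) (t₀ + ε)).is_const_of_fderivWithin_eq_zero (𝕜 := ℝ)
      (f := fun s => (x s).1 - s)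
      (fun s hs => (hd s hs).differentiableAt.differentiableWithinAt) (fun s hs => by
        rw [fderivWithin_of_isOpen isOpen_Ioo hs, (hd s hs).hasFDerivAt.fderiv]; ext; simp) ht h0
    simp only [hx0] at hc
    linarith
  -- The interval is shrunk so that `w` stays positive, which later makes `φ` injective.
  have hw : ContinuousAt (fun t => (x t).2.2.1) t₀ := (d1 t₀ h0).2.2.1.continuousAt
  have hw0 : 0 < (x t₀).2.2.1 := by rw [hx0]; norm_num
  obtain ⟨δ, hδ, hball⟩ := Metric.eventually_nhds_iff_ball.mp
    ((hw.eventually (lt_mem_nhds hw0)).and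
      ((hI.eventually_mem ht₀).and (isOpen_Ioo.eventually_mem h0)))
  rw [Real.ball_eq_Ioo] at hball
  refine ⟨δ, hδ, fun t ht => (hball t ht).2.1, fun t => (x t).2.1, fun t => (x t).2.2.1,
    fun t => (x t).2.2.2, fun t ht => ?_⟩
  have ht' := (hball t ht).2.2
  have h2 := d1 t ht'
  refine ⟨h2.2.1.congr_deriv ?_, h2.2.2.1, h2.2.2.2, (hball t ht).1⟩
  simp only [v, h1 t ht']

/-- Bootstrapping: if `f` is of class `Cᵐ`, the right-hand side is too, hence `f` is of class
`C^{m+1}`. -/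
lemma contDiffOn_riccati {J : Set ℝ} (hJ : IsOpen J) {S f : ℝ → ℝ} (hS : ContDiffOn ℝ ∞ S J)
    (hf : ∀ t ∈ J, HasDerivAt f (f t ^ 2 / 2 + S t) t) : ContDiffOn ℝ ∞ f J := by
  rw [contDiffOn_infty]
  intro m
  induction m with
  | zero =>
    rw [Nat.cast_zero, contDiffOn_zero]
    exact fun t ht => (hf t ht).continuousAt.continuousWithinAt
  | succ m ih =>
    rw [Nat.cast_succ, contDiffOn_succ_iff_deriv_of_isOpen hJ]
    refine ⟨fun t ht => (hf t ht).differentiableAt.differentiableWithinAt, by simp, ?_⟩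
    exact (((ih.pow 2).div_const 2).add (hS.of_le (by exact_mod_cast le_top))).congr
      fun t ht => (hf t ht).deriv

lemma contDiffOn_of_hasDerivAt {J : Set ℝ} (hJ : IsOpen J) {f f' : ℝ → ℝ}
    (hf : ∀ t ∈ J, HasDerivAt f (f' t) t) (hf' : ContDiffOn ℝ ∞ f' J) : ContDiffOn ℝ ∞ f J := by
  rw [contDiffOn_infty_iff_deriv_of_isOpen hJ]
  exact ⟨fun t ht => (hf t ht).differentiableAt.differentiableWithinAt,
    hf'.congr fun t ht => (hf t ht).deriv⟩

lemma contDiffOn_linear {J : Set ℝ} (hJ : IsOpen J) {w f : ℝ → ℝ} (hf : ContDiffOn ℝ ∞ f J)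
    (hw : ∀ t ∈ J, HasDerivAt w (f t * w t) t) : ContDiffOn ℝ ∞ w J := by
  rw [contDiffOn_infty]
  intro m
  induction m with
  | zero =>
    rw [Nat.cast_zero, contDiffOn_zero]
    exact fun t ht => (hw t ht).continuousAt.continuousWithinAt
  | succ m ih =>
    rw [Nat.cast_succ, contDiffOn_succ_iff_deriv_of_isOpen hJ]
    refine ⟨fun t ht => (hw t ht).differentiableAt.differentiableWithinAt, by simp, ?_⟩
    exact ((hf.of_le (by exact_mod_cast le_top)).mul ih).congr fun t ht => (hw t ht).deriv

/-- With `f = φ'' / φ'` and `μ = φ'⁻ᴺ`, the coefficient `p_{2N}` is a multiple of `q_{2N} = 0`, and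
`p_{2N-1} = 0` is a Riccati equation for `f`. The other `p i` are read off from the coefficients of
the transformed operator. -/
theorem exists_isLaguerreForsythForm {N : ℕ} (hN : 1 ≤ N) {I : Set ℝ} (hI : IsOpen I)
    {q : ℕ → ℝ → ℝ} (hq : ∀ i < 2 * N + 1, ContDiffOn ℝ ∞ (q i) I)
    (hq0 : ∀ t ∈ I, q (2 * N) t = 0) {t₀ : ℝ} (ht₀ : t₀ ∈ I) :
    ∃ (J : Set ℝ) (φ μ : ℝ → ℝ) (p : ℕ → ℝ → ℝ), t₀ ∈ J ∧ J ⊆ I ∧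
      IsLaguerreForsythForm (2 * N + 1) q J φ μ p := by
  -- In row `2N - 1` the second diagonal is `2N (2N + 1) (N + 1) (-f' / 6 + f² / 12)`. Setting its
  -- sum with `q_{2N-1}` to zero gives the function `S` chosen here.
  obtain ⟨ε, hε, hεI, f, w, φ, hode⟩ := exists_riccati hI
    (S := fun t => 6 / (2 * N * (2 * N + 1) * (N + 1)) * q (2 * N - 1) t)
    (contDiffOn_const.mul (hq _ (by omega))) ht₀
  set J := Set.Ioo (t₀ - ε) (t₀ + ε) with hJdef
  have hJ : IsOpen J := isOpen_Ioo
  have hqJ : ∀ i < 2 * N + 1, ContDiffOn ℝ ∞ (q i) J := fun i hi => (hq i hi).mono hεI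
  have sf : ContDiffOn ℝ ∞ f J := contDiffOn_riccati hJ
    (contDiffOn_const.mul (hqJ _ (by omega))) fun t ht => (hode t ht).1
  have sw : ContDiffOn ℝ ∞ w J := contDiffOn_linear hJ sf fun t ht => (hode t ht).2.1
  have sφ : ContDiffOn ℝ ∞ φ J := contDiffOn_of_hasDerivAt hJ (fun t ht => (hode t ht).2.2.1) sw
  have hw0 : ∀ t ∈ J, w t ≠ 0 := fun t ht => (hode t ht).2.2.2.ne'
  have hφ : ∀ t ∈ J, deriv φ t = w t := fun t ht => (hode t ht).2.2.1.deriv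
  have hφ0 : ∀ t ∈ J, deriv φ t ≠ 0 := fun t ht => by rw [hφ t ht]; exact hw0 t ht
  have hinj : Set.InjOn φ J := by
    refine StrictMonoOn.injOn (strictMonoOn_of_deriv_pos (convex_Ioo _ _) sφ.continuousOn ?_)
    intro t ht
    rw [interior_Ioo] at ht
    rw [hφ t ht]
    exact (hode t ht).2.2.2
  have hdw : ∀ t ∈ J, HasDerivAt (deriv φ) (f t * deriv φ t) t := fun t ht => by
    rw [hφ t ht]
    exact (hode t ht).2.1.congr_of_eventuallyEq (Set.EqOn.eventuallyEq_isOpen hφ hJ ht)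
  -- With exponent `N` the first diagonal contains the factor `i - 2N` and therefore vanishes in row
  -- `2N`.
  let μ : ℝ → ℝ := fun t => (w t ^ N)⁻¹
  have hμ0 : ∀ t ∈ J, μ t ≠ 0 := fun t ht => inv_ne_zero (pow_ne_zero _ (hw0 t ht))
  have sμ : ContDiffOn ℝ ∞ μ J := (sw.pow N).inv fun t ht => pow_ne_zero _ (hw0 t ht)
  have hdμ : ∀ t ∈ J, HasDerivAt μ (-(N : ℝ) * f t * μ t) t := fun t ht => by
    refine (((hode t ht).2.1.pow N).inv (pow_ne_zero _ (hw0 t ht))).congr_deriv ?_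
    have := hw0 t ht
    obtain ⟨m, rfl⟩ : ∃ m, N = m + 1 := ⟨N - 1, by omega⟩
    simp only [μ, Pi.pow_apply, Nat.add_sub_cancel]
    field_simp
    ring
  have sB := chainCoeff_smooth hJ (sφ.deriv_isOpen hJ) sμ
  let c : ℕ → ℝ → ℝ := fun i t => ∑ j ∈ Finset.range (2 * N + 1 + 1),
    monicCoeff (2 * N + 1) q j t * chainCoeff (deriv φ) μ j i t
  have sc : ∀ i, ContDiffOn ℝ ∞ (fun t => c i t / (μ t * deriv φ t ^ (2 * N + 1))) J := by
    intro i
    refine ContDiffOn.div (ContDiffOn.sum fun j hj => ContDiffOn.mul ?_ (sB j i))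
      (sμ.mul ((sφ.deriv_isOpen hJ).pow _)) fun t ht =>
        mul_ne_zero (hμ0 t ht) (pow_ne_zero _ (hφ0 t ht))
    by_cases hj' : j = 2 * N + 1
    · exact contDiffOn_const.congr fun t _ => by rw [monicCoeff, if_pos hj']
    · refine (hqJ j ?_).congr fun t _ => by rw [monicCoeff, if_neg hj']
      have := Finset.mem_range.mp hj
      omega
  let p : ℕ → ℝ → ℝ := fun i s => (fun t => c i t / (μ t * deriv φ t ^ (2 * N + 1)))
    (Function.invFunOn φ J s)
  have hp : ∀ i, ∀ t ∈ J, p i (φ t) = c i t / (μ t * deriv φ t ^ (2 * N + 1)) := by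
    intro i t ht
    simp only [p]
    rw [hinj.leftInvOn_invFunOn ht]
  have hdf : ∀ t ∈ J, HasDerivAt f (deriv f t) t :=
    fun t ht => (sf.differentiableAt_isOpen hJ ht).hasDerivAt
  have sf₁ := sf.deriv_isOpen hJ
  have sf₂ := sf₁.deriv_isOpen hJ
  have hB : ∀ s ≤ 4, ∀ i : ℕ, ∀ t ∈ J, chainCoeff (deriv φ) μ (i + s) i t
      = μ t * deriv φ t ^ i
        * diagPoly N f (deriv f) (deriv (deriv f)) (deriv (deriv (deriv f))) s i t :=
    fun s hs i t ht => chainCoeff_eq_diagPoly hJ hdw hdμ hdf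
      (fun t ht => (sf₁.differentiableAt_isOpen hJ ht).hasDerivAt)
      (fun t ht => (sf₂.differentiableAt_isOpen hJ ht).hasDerivAt) hs i ht
  have hN0 : (N : ℝ) ≠ 0 := by positivity
  refine ⟨J, φ, μ, p, by constructor <;> linarith, hεI, ⟨hJ, sφ, hφ0, hinj, sμ, hμ0,
    fun i _ => ?_, fun z hz t ht => ?_, ?_, ?_⟩⟩
  · exact (sc i).comp (contDiffOn_invFunOn hJ sφ hφ0 hinj)
      fun s hs => Function.invFunOn_mem hs
  · refine (sum_monicCoeff_mul_chainCoeff hJ sφ sμ ht).mpr (fun i hi => ?_) z hz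
    have h1 : μ t * deriv φ t ^ (2 * N + 1) ≠ 0 :=
      mul_ne_zero (hμ0 t ht) (pow_ne_zero _ (hφ0 t ht))
    rcases hi.eq_or_lt with rfl | hi
    · rw [Finset.sum_range_succ, Finset.sum_eq_zero, chainCoeff_diag]
      · simp [monicCoeff]
      · intro j hj
        rw [chainCoeff_of_lt (Finset.mem_range.mp hj)]; simp
    · rw [monicCoeff, if_neg hi.ne, hp i t ht, mul_div_cancel₀ _ h1]
  · rintro _ ⟨t, ht, rfl⟩
    rw [show 2 * N + 1 - 1 = 2 * N by omega, hp _ t ht]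
    simp only [c]
    rw [sum_range_eq_top (m := 2 * N) (l := 2) (by ring)]
    · simp only [Finset.sum_range_succ, Finset.sum_range_zero, monicCoeff]
      rw [hB 1 (by norm_num) _ t ht]
      simp [diagPoly, hq0 t (hεI ht)]
    · intro i hi
      rw [chainCoeff_of_lt hi]; simp
  · rintro _ ⟨t, ht, rfl⟩
    rw [show 2 * N + 1 - 2 = 2 * N - 1 by omega, hp _ t ht]
    simp only [c]
    rw [sum_range_eq_top (m := 2 * N - 1) (l := 3) (by omega)]
    · simp only [Finset.sum_range_succ, Finset.sum_range_zero, monicCoeff]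
      rw [hB 1 (by norm_num) _ t ht, hB 2 (by norm_num) _ t ht, add_zero, chainCoeff_diag]
      simp only [show 2 * N - 1 + 1 = 2 * N by omega, show 2 * N - 1 + 2 = 2 * N + 1 by omega,
        show 2 * N - 1 ≠ 2 * N + 1 by omega, show 2 * N ≠ 2 * N + 1 by omega, if_false, if_true,
        hq0 t (hεI ht), (hode t ht).1.deriv, diagPoly]
      rw [Nat.cast_sub (by omega)]
      push_cast
      have h1 := hφ0 t ht
      have h2 := hμ0 t ht
      field_simp
      ring
    · intro i hi
      rw [chainCoeff_of_lt hi]; simp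

/-! ### Linear systems with a Gram matrix -/

lemma contDiffOn_det {k : ℕ} {I : Set ℝ} {M : ℝ → Matrix (Fin k) (Fin k) ℝ}
    (hM : ∀ i j, ContDiffOn ℝ ∞ (fun t => M t i j) I) : ContDiffOn ℝ ∞ (fun t => (M t).det) I := by
  simp only [Matrix.det_apply]
  exact ContDiffOn.sum fun σ _ => (contDiffOn_prod fun i _ => hM _ _).const_smul _

/-- A linear system with smooth coefficients and nonvanishing determinant has a unique solution,
and this solution is smooth. -/
theorem exists_smooth_solution {k : ℕ} {I : Set ℝ} {h : ℕ → ℕ → ℝ → ℝ}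
    (hs : ∀ i j, ContDiffOn ℝ ∞ (h i j) I)
    (hdet : ∀ t ∈ I, (Matrix.of fun j i : Fin k => h i j t).det ≠ 0) :
    ∃ q : ℕ → ℝ → ℝ, (∀ i < k, ContDiffOn ℝ ∞ (q i) I) ∧ ∀ t ∈ I, ∀ c : ℕ → ℝ,
      (∀ j < k, h k j t + ∑ i ∈ Finset.range k, c i * h i j t = 0) ↔ ∀ i < k, c i = q i t := by
  let M : ℝ → Matrix (Fin k) (Fin k) ℝ := fun t => Matrix.of fun j i : Fin k => h i j t
  let v : ℝ → Fin k → ℝ := fun t j => -h k j t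
  -- Cramer's rule: the solution is a quotient of determinants of smooth entries, hence smooth.
  let q : ℕ → ℝ → ℝ := fun i t => if hi : i < k then (M t).cramer (v t) ⟨i, hi⟩ / (M t).det else 0
  have hsM : ∀ j i, ContDiffOn ℝ ∞ (fun t => M t j i) I := fun j i => hs i j
  refine ⟨q, fun i hi => ?_, fun t ht c => ?_⟩
  · simp only [q, dif_pos hi, Matrix.cramer_apply]
    refine (contDiffOn_det fun j l => ?_).div (contDiffOn_det hsM) hdet
    simp only [Matrix.updateCol_apply]
    split_ifs
    · exact (hs k j).neg
    · exact hsM j l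
  · have hsys : (∀ j < k, h k j t + ∑ i ∈ Finset.range k, c i * h i j t = 0) ↔
        (M t).mulVec (fun i : Fin k => c i) = v t := by
      constructor
      · intro H
        funext j
        have := H j j.2
        rw [Finset.sum_range] at this
        simp only [M, v, Matrix.mulVec, dotProduct, Matrix.of_apply]
        simp only [mul_comm (c _)] at this
        linarith
      · intro H j hj
        have := congrFun H ⟨j, hj⟩
        simp only [M, v, Matrix.mulVec, dotProduct, Matrix.of_apply] at this
        rw [Finset.sum_range]
        simp only [mul_comm (c _)]
        linarith
    have hd := hdet t ht
    have hq : (M t).mulVec (fun i : Fin k => q i t) = v t := by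
      have h1 : (fun i : Fin k => q i t) = (M t).det⁻¹ • (M t).cramer (v t) := by
        funext i
        simp only [q, dif_pos i.2, Pi.smul_apply, smul_eq_mul, Fin.eta]
        rw [div_eq_inv_mul]
      rw [h1, Matrix.mulVec_smul, Matrix.mulVec_cramer, smul_smul, inv_mul_cancel₀ hd, one_smul]
    rw [hsys, ← hq]
    constructor
    · intro H i hi
      have h1 : (M t).mulVec ((fun i : Fin k => c i) - fun i : Fin k => q i t) = 0 := by
        rw [Matrix.mulVec_sub, H, sub_self]
      have h2 := congrFun (Matrix.eq_zero_of_mulVec_eq_zero hd h1) ⟨i, hi⟩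
      simpa [sub_eq_zero] using h2
    · intro H
      congr 1
      funext i
      exact H i i.2

namespace IsGramSystem

variable {J : Set ℝ} {N : ℕ} {h : ℕ → ℕ → ℝ → ℝ}

/-- With its rows reversed the matrix is upper triangular by `vanish`, and its diagonal entries are
`±h_{0,2N}`. -/
lemma det_ne_zero {w : ℝ → ℝ} (H : IsGramSystem J N w h) {t : ℝ} (ht : t ∈ J)
    (hE : h 0 (2 * N) t ≠ 0) : (Matrix.of fun j i : Fin (2 * N + 1) => h i j t).det ≠ 0 := by
  set M := Matrix.of fun j i : Fin (2 * N + 1) => h i j t with hM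
  have h1 : (M.submatrix Fin.revPerm id).BlockTriangular id := by
    intro i j hij
    simp only [hM, Matrix.submatrix_apply, Matrix.of_apply, id, Fin.revPerm_apply] at hij ⊢
    apply H.vanish _ ht
    have : (j : ℕ) < i := hij
    simp only [Fin.val_rev]
    omega
  have h2 := Matrix.det_of_isUpperTriangular h1
  rw [Matrix.det_permute] at h2
  intro h0
  rw [h0, mul_zero, eq_comm, Finset.prod_eq_zero_iff] at h2
  obtain ⟨i, _, hi⟩ := h2
  simp only [hM, Matrix.submatrix_apply, Matrix.of_apply, id, Fin.revPerm_apply] at hi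
  rw [H.level_zero _ _ (by simp only [Fin.val_rev]; omega) t ht] at hi
  simp [hE] at hi

/-- The expression of `Θ₄` in terms of `ε`, `α` and `β`. -/
lemma theta_eq {r : ℕ} (H : IsGramSystem J (r + 1) 1 h)
    (h0 : ∀ t ∈ J, HasDerivAt (h 0 (2 * (r + 1))) 0 t)
    (hε : ∀ t ∈ J, h (r + 1) (r + 1) t ^ 2 = 1)
    {a₁ a₂ : ℝ → ℝ} (ha₁ : ∀ t ∈ J, HasDerivAt (h 0 (2 * (r + 1) + 2)) (a₁ t) t)
    (ha₂ : ∀ t ∈ J, HasDerivAt a₁ (a₂ t) t) {t : ℝ} (ht : t ∈ J) :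
    -(h (r + 1) (r + 1) t * h (r + 3) (r + 3) t)
      - (r : ℝ) * (r + 3) / 10 * h (r + 1) (r + 1) t
        * iteratedDeriv 2 (fun s => h (r + 2) (r + 2) s) t
      + ((r : ℝ) + 3) * (2 * r + 5) * (5 * r + 4) / (10 * (r + 1) * (r + 2) * (2 * r + 3))
        * h (r + 2) (r + 2) t ^ 2
    = gramTheta (r + 1) (h 0 (2 * (r + 1)) t) (h 0 (2 * (r + 1) + 2) t) (a₂ t)
        (h 0 (2 * (r + 1) + 4) t) := by
  have hα : ∀ t ∈ J, h (r + 2) (r + 2) t = (-1) ^ (r + 2) * h 0 (2 * (r + 1) + 2) t :=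
    fun t ht => H.level_two h0 (r + 2) (r + 2) (by ring) t ht
  have hα₁ : ∀ t ∈ J, deriv (fun s => h (r + 2) (r + 2) s) t = (-1) ^ (r + 2) * a₁ t :=
    fun t ht => (((ha₁ t ht).const_mul _).congr_of_eventuallyEq
      (Set.EqOn.eventuallyEq_isOpen hα H.isOpen ht)).deriv
  have hα₂ : iteratedDeriv 2 (fun s => h (r + 2) (r + 2) s) t = (-1) ^ (r + 2) * a₂ t := by
    rw [iteratedDeriv_succ, iteratedDeriv_one]
    exact (((ha₂ t ht).const_mul _).congr_of_eventuallyEq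
      (Set.EqOn.eventuallyEq_isOpen hα₁ H.isOpen ht)).deriv
  -- For `i = r + 3 = N + 2` the coefficient `i (2N + 4 - i) / 2` is `(N + 2)² / 2`, as in the first
  -- term of `gramTheta`.
  have hβ := H.level_four h0 (A₁ := a₁) (A₂ := a₂) (fun t ht => by simpa using ha₁ t ht)
    (fun t ht => by simpa using ha₂ t ht) (r + 3) (r + 3) (by ring) t ht
  have hE := H.level_zero (r + 1) (r + 1) (by ring) t ht
  have hε := hε t ht
  set e := h 0 (2 * (r + 1)) t
  have hs : ((-1 : ℝ) ^ r) ^ 2 = 1 := by rw [← pow_mul, mul_comm, (even_two_mul r).neg_one_pow]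
  have he : e ^ 2 = 1 := by
    rw [hE] at hε
    rw [← hε]
    simp only [pow_succ]
    linear_combination -e ^ 2 * hs
  have he0 : e ≠ 0 := by
    intro h1; rw [h1] at he; norm_num at he
  -- Since `e² = 1`, dividing by `h_{0,2N}` is the same as multiplying by it; this replaces
  -- quotients by products with `ε`, up to signs.
  have hdiv : ∀ x : ℝ, x / e = x * e := fun x => by
    rw [div_eq_iff he0]; linear_combination -x * he
  rw [hα t ht, hα₂, hβ, hE]
  simp only [gramTheta, hdiv]
  push_cast
  set σ := (-1 : ℝ) ^ r with hσ
  have e1 : (-1 : ℝ) ^ (r + 1) = -σ := by rw [pow_succ]; ring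
  have e2 : (-1 : ℝ) ^ (r + 2) = σ := by rw [pow_succ, e1]; ring
  have e3 : (-1 : ℝ) ^ (r + 3) = -σ := by rw [pow_succ, e2]; ring
  rw [e1, e2, e3]
  generalize h 0 (2 * (r + 1) + 4) t = Z
  generalize h 0 (2 * (r + 1) + 2) t = A
  generalize a₂ t = A₂
  have c : ((r : ℝ) + 3) * (2 * r + 5) * (5 * r + 4) / (10 * (r + 1) * (r + 2) * (2 * r + 3))
      = ((r : ℝ) + 1 + 2) * (2 * (r + 1) + 3) * (5 * (r + 1) - 1)
        / (10 * (r + 1) * (r + 1 + 1) * (2 * (r + 1) + 1)) := by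
    congr 1 <;> ring
  rw [c]
  generalize ((r : ℝ) + 1 + 2) * (2 * (r + 1) + 3) * (5 * (r + 1) - 1)
        / (10 * (r + 1) * (r + 1 + 1) * (2 * (r + 1) + 1)) = C
  have hse : (A * e) ^ 2 = A ^ 2 := by rw [mul_pow, he, mul_one]
  rw [hse, mul_pow, hs]
  linear_combination (-(e * (Z - (r + 3) ^ 2 / 2 * A₂)) + (r : ℝ) * (r + 3) / 10 * e * A₂) * hs

end IsGramSystem

set_option maxSynthPendingDepth 4

/-! ### Metrics on domains of `ℝⁿ` -/

/-- Fields of bilinear forms on `ℝⁿ`. -/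
abbrev FormField (n : ℕ) : Type := Model n → Model n →L[ℝ] Model n →L[ℝ] ℝ

/-- `G` is a smooth pseudo-Riemannian metric on the open set `Ω`. -/
structure IsMetricOn {n : ℕ} (G : FormField n) (Ω : Set (Model n)) : Prop where
  isOpen : IsOpen Ω
  smooth : ContDiffOn ℝ ∞ G Ω
  symm : ∀ y ∈ Ω, ∀ u v, G y u v = G y v u
  nondegenerate : ∀ y ∈ Ω, ∀ v, (∀ w, G y v w = 0) → v = 0

section

variable {n : ℕ}

/-- The trilinear form `(u, v, w) ↦ ½ (∂ᵤ G(v, w) + ∂ᵥ G(u, w) - ∂_w G(u, v))`. -/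
noncomputable def koszulForm (G : FormField n) (y : Model n) :
    Model n →L[ℝ] Model n →L[ℝ] Model n →L[ℝ] ℝ :=
  (1 / 2 : ℝ) • (fderiv ℝ G y + (fderiv ℝ G y).flip -
    ((ContinuousLinearMap.flipₗᵢ ℝ (Model n) (Model n) ℝ).toContinuousLinearEquiv :
      (Model n →L[ℝ] Model n →L[ℝ] ℝ) →L[ℝ] (Model n →L[ℝ] Model n →L[ℝ] ℝ)).comp
        (fderiv ℝ G y).flip)

/-- The Christoffel symbols as a bilinear map. -/
noncomputable def christoffelMap (G : FormField n) (y : Model n) :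
    Model n →L[ℝ] Model n →L[ℝ] Model n :=
  (ContinuousLinearMap.compL ℝ (Model n) (Model n →L[ℝ] ℝ) (Model n) (G y).inverse).comp
    (koszulForm G y)

lemma koszulForm_apply (G : FormField n) (y u v w : Model n) : koszulForm G y u v w
    = 1 / 2 * (fderiv ℝ G y u v w + fderiv ℝ G y v u w - fderiv ℝ G y w u v) := rfl

lemma christoffelMap_apply (G : FormField n) (y u v : Model n) :
    christoffelMap G y u v = christoffel G y u v := rfl

end

namespace IsMetricOn

variable {n : ℕ} {G : FormField n} {Ω : Set (Model n)} {y : Model n}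

lemma mono (hG : IsMetricOn G Ω) {Ω' : Set (Model n)} (h : IsOpen Ω') (h' : Ω' ⊆ Ω) :
    IsMetricOn G Ω' where
  isOpen := h
  smooth := hG.smooth.mono h'
  symm y hy := hG.symm y (h' hy)
  nondegenerate y hy := hG.nondegenerate y (h' hy)

lemma exists_equiv (hG : IsMetricOn G Ω) (hy : y ∈ Ω) :
    ∃ e : Model n ≃L[ℝ] (Model n →L[ℝ] ℝ), (e : Model n →L[ℝ] (Model n →L[ℝ] ℝ)) = G y := by
  have hinj : Function.Injective (G y).toLinearMap := by
    rw [← LinearMap.ker_eq_bot, LinearMap.ker_eq_bot']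
    intro v hv
    exact hG.nondegenerate y hy v fun w => by
      have : G y v = 0 := hv
      rw [this]; rfl
  have hdim : Module.finrank ℝ (Model n) = Module.finrank ℝ (Model n →L[ℝ] ℝ) := by
    rw [← (LinearMap.toContinuousLinearMap (𝕜 := ℝ) (E := Model n) (F' := ℝ)).finrank_eq]
    exact Subspace.dual_finrank_eq.symm
  refine ⟨(LinearEquiv.ofInjectiveOfFinrankEq _ hinj hdim).toContinuousLinearEquiv, ?_⟩
  ext v w
  rfl

lemma apply_sharp (hG : IsMetricOn G Ω) (hy : y ∈ Ω) (ξ : Model n →L[ℝ] ℝ) :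
    G y (sharp G y ξ) = ξ := by
  obtain ⟨e, he⟩ := hG.exists_equiv hy
  rw [sharp, ← he, ContinuousLinearMap.inverse_equiv]
  exact e.apply_symm_apply ξ

lemma apply_right_sharp (hG : IsMetricOn G Ω) (hy : y ∈ Ω) (ξ : Model n →L[ℝ] ℝ) (v : Model n) :
    G y v (sharp G y ξ) = ξ v := by
  rw [hG.symm y hy, hG.apply_sharp hy]

lemma ext (hG : IsMetricOn G Ω) (hy : y ∈ Ω) {u v : Model n} (h : ∀ w, G y u w = G y v w) :
    u = v := by
  rw [← sub_eq_zero]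
  exact hG.nondegenerate y hy _ fun w => by simp [h w]

lemma sharp_eq (hG : IsMetricOn G Ω) (hy : y ∈ Ω) {ξ : Model n →L[ℝ] ℝ} {v : Model n}
    (h : ∀ w, G y v w = ξ w) : sharp G y ξ = v :=
  hG.ext hy fun w => by rw [hG.apply_sharp hy, h]

lemma apply_christoffel (hG : IsMetricOn G Ω) (hy : y ∈ Ω) (u v w : Model n) :
    G y (christoffel G y u v) w
      = 1 / 2 * (fderiv ℝ G y u v w + fderiv ℝ G y v u w - fderiv ℝ G y w u v) := by
  rw [christoffel, hG.apply_sharp hy]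
  rfl

lemma differentiableAt (hG : IsMetricOn G Ω) (hy : y ∈ Ω) : DifferentiableAt ℝ G y :=
  (hG.smooth.contDiffAt (hG.isOpen.mem_nhds hy)).differentiableAt (by simp)

lemma fderiv_symm (hG : IsMetricOn G Ω) (hy : y ∈ Ω) (u v w : Model n) :
    fderiv ℝ G y u v w = fderiv ℝ G y u w v := by
  have h1 : ∀ v w, fderiv ℝ (fun z => G z v w) y u = fderiv ℝ G y u v w := by
    intro v w
    have := ((hG.differentiableAt hy).hasFDerivAt.clm_apply (hasFDerivAt_const v y)).clm_apply
      (hasFDerivAt_const w y)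
    rw [this.fderiv]
    simp
  rw [← h1, ← h1]
  have h2 : (fun z => G z v w) =ᶠ[nhds y] fun z => G z w v :=
    Set.EqOn.eventuallyEq_isOpen (fun z hz => hG.symm z hz v w) hG.isOpen hy
  rw [h2.fderiv_eq]

lemma christoffel_symm (hG : IsMetricOn G Ω) (hy : y ∈ Ω) (u v : Model n) :
    christoffel G y u v = christoffel G y v u :=
  hG.ext hy fun w => by
    rw [hG.apply_christoffel hy, hG.apply_christoffel hy, hG.fderiv_symm hy w u v]; ring

/-- The Levi-Civita connection is a metric connection. -/
lemma fderiv_eq (hG : IsMetricOn G Ω) (hy : y ∈ Ω) (u v w : Model n) :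
    fderiv ℝ G y u v w = G y (christoffel G y u v) w + G y v (christoffel G y u w) := by
  rw [hG.symm y hy v, hG.apply_christoffel hy, hG.apply_christoffel hy, hG.fderiv_symm hy u w v,
    hG.fderiv_symm hy v u w, hG.fderiv_symm hy w u v]
  ring

lemma fderiv_smooth (hG : IsMetricOn G Ω) : ContDiffOn ℝ ∞ (fderiv ℝ G) Ω :=
  hG.smooth.fderiv_of_isOpen hG.isOpen (by simp)

lemma inverse_smooth (hG : IsMetricOn G Ω) : ContDiffOn ℝ ∞ (fun y => (G y).inverse) Ω := by
  intro y hy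
  obtain ⟨e, he⟩ := hG.exists_equiv hy
  have h1 : ContDiffAt ℝ ∞ ContinuousLinearMap.inverse (G y) := by
    rw [← he]; exact contDiffAt_map_inverse e
  exact (h1.comp y (hG.smooth.contDiffAt (hG.isOpen.mem_nhds hy))).contDiffWithinAt

lemma koszulForm_smooth (hG : IsMetricOn G Ω) : ContDiffOn ℝ ∞ (koszulForm G) Ω := by
  rw [contDiffOn_clm_apply]
  intro u
  rw [contDiffOn_clm_apply]
  intro v
  rw [contDiffOn_clm_apply]
  intro w
  simp only [koszulForm_apply]
  have h : ∀ u v w : Model n, ContDiffOn ℝ ∞ (fun y => fderiv ℝ G y u v w) Ω := fun u v w =>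
    ((hG.fderiv_smooth.clm_apply contDiffOn_const).clm_apply contDiffOn_const).clm_apply
      contDiffOn_const
  exact contDiffOn_const.mul (((h u v w).add (h v u w)).sub (h w u v))

lemma christoffelMap_smooth (hG : IsMetricOn G Ω) : ContDiffOn ℝ ∞ (christoffelMap G) Ω := by
  rw [contDiffOn_clm_apply]
  intro u
  rw [contDiffOn_clm_apply]
  intro v
  exact hG.inverse_smooth.clm_apply
    ((hG.koszulForm_smooth.clm_apply contDiffOn_const).clm_apply contDiffOn_const)

lemma christoffelMap_differentiableAt (hG : IsMetricOn G Ω) (hy : y ∈ Ω) :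
    DifferentiableAt ℝ (christoffelMap G) y :=
  (hG.christoffelMap_smooth.contDiffAt (hG.isOpen.mem_nhds hy)).differentiableAt (by simp)

/-- The curvature as a trilinear map. -/
lemma curvature_eq (hG : IsMetricOn G Ω) (hy : y ∈ Ω) (u v w : Model n) :
    curvature G y u v w = fderiv ℝ (christoffelMap G) y u v w - fderiv ℝ (christoffelMap G) y v u w
      + christoffelMap G y u (christoffelMap G y v w)
      - christoffelMap G y v (christoffelMap G y u w) := by
  have h1 : ∀ u v w : Model n,
      fderiv ℝ (fun z => christoffel G z v w) y u = fderiv ℝ (christoffelMap G) y u v w := by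
    intro u v w
    have := ((hG.christoffelMap_differentiableAt hy).hasFDerivAt.clm_apply
      (hasFDerivAt_const v y)).clm_apply (hasFDerivAt_const w y)
    simp only [christoffelMap_apply] at this
    rw [this.fderiv]
    simp
  rw [curvature, h1, h1]
  rfl

/-- The curvature as an endomorphism in its first argument. -/
lemma exists_curvatureEnd (hG : IsMetricOn G Ω) (hy : y ∈ Ω) (v w : Model n) :
    ∃ L : Model n →ₗ[ℝ] Model n, ∀ u, L u = curvature G y u v w :=
  ⟨{ toFun := fun u => curvature G y u v w
     map_add' := fun a b => by simp only [hG.curvature_eq hy, map_add, add_apply]; abel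
     map_smul' := fun a b => by
      simp only [hG.curvature_eq hy, map_smul, smul_apply, RingHom.id_apply,
        smul_add, smul_sub] }, fun _ => rfl⟩

end IsMetricOn

/-- The trace of an endomorphism of `ℝⁿ` in coordinates. -/
lemma trace_eq_sum_coord {n : ℕ} (L : Model n →ₗ[ℝ] Model n) :
    LinearMap.trace ℝ (Model n) L = ∑ i, L (coordVec i) i := by
  rw [LinearMap.trace_eq_sum_inner L (EuclideanSpace.basisFun (Fin n) ℝ)]
  refine Finset.sum_congr rfl fun i _ => ?_
  simp [coordVec, EuclideanSpace.basisFun_apply, EuclideanSpace.inner_single_left]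

lemma sum_coord_smul {n : ℕ} (v : Model n) : ∑ i, v i • coordVec i = v := by
  have := (EuclideanSpace.basisFun (Fin n) ℝ).sum_repr v
  simpa [coordVec, EuclideanSpace.basisFun_apply] using this

namespace IsMetricOn

variable {n : ℕ} {G : FormField n} {Ω : Set (Model n)} {y : Model n}

/-- A trace does not depend on the basis. This replaces the coordinate sum in proofs of naturality.
-/
lemma ricci_eq_trace {v w : Model n} {L : Model n →ₗ[ℝ] Model n}
    (hL : ∀ u, L u = curvature G y u v w) : ricci G y v w = LinearMap.trace ℝ (Model n) L := by
  rw [trace_eq_sum_coord, ricci]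
  simp [hL]

/-- The Ricci tensor as a bilinear form. -/
lemma exists_ricciForm (hG : IsMetricOn G Ω) (hy : y ∈ Ω) :
    ∃ B : Model n →L[ℝ] Model n →L[ℝ] ℝ, ∀ v w, B v w = ricci G y v w :=
  ⟨LinearMap.toContinuousLinearMap ((LinearMap.toContinuousLinearMap :
      (Model n →ₗ[ℝ] ℝ) ≃ₗ[ℝ] (Model n →L[ℝ] ℝ)).toLinearMap ∘ₗ LinearMap.mk₂ ℝ (ricci G y)
      (fun a b c => by simp only [ricci, hG.curvature_eq hy, map_add, add_apply,
        PiLp.add_apply, PiLp.sub_apply, ← Finset.sum_add_distrib]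
                       exact Finset.sum_congr rfl fun i _ => by ring)
      (fun a b c => by simp only [ricci, hG.curvature_eq hy, map_smul,
        smul_apply, PiLp.add_apply, PiLp.sub_apply, PiLp.smul_apply,
        smul_eq_mul, Finset.mul_sum]
                       exact Finset.sum_congr rfl fun i _ => by ring)
      (fun a b c => by simp only [ricci, hG.curvature_eq hy, map_add, 
        PiLp.add_apply, PiLp.sub_apply, ← Finset.sum_add_distrib]
                       exact Finset.sum_congr rfl fun i _ => by ring)
      (fun a b c => by simp only [ricci, hG.curvature_eq hy, map_smul,
        PiLp.add_apply, PiLp.sub_apply, PiLp.smul_apply,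
        smul_eq_mul, Finset.mul_sum]
                       exact Finset.sum_congr rfl fun i _ => by ring)), fun _ _ => rfl⟩

/-- The scalar curvature is the trace of the Ricci endomorphism. -/
lemma scalarCurvature_eq_trace {L : Model n →ₗ[ℝ] Model n} {B : Model n →L[ℝ] Model n →L[ℝ] ℝ}
    (hB : ∀ v w, B v w = ricci G y v w) (hL : ∀ v, L v = sharp G y (B.flip v)) :
    scalarCurvature G y = LinearMap.trace ℝ (Model n) L := by
  rw [trace_eq_sum_coord, scalarCurvature, Finset.sum_comm]
  refine Finset.sum_congr rfl fun j _ => ?_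
  have h1 : B.flip (coordVec j) = ∑ i, ricci G y (coordVec i) (coordVec j) •
      (EuclideanSpace.proj i : Model n →L[ℝ] ℝ) := by
    ext v
    conv_lhs => rw [← sum_coord_smul v]
    simp [hB, mul_comm]
  rw [hL, h1, sharp, map_sum]
  simp [sharp, mul_comm]

/-- The Schouten tensor as a bilinear form. -/
lemma exists_schoutenForm (hG : IsMetricOn G Ω) (hy : y ∈ Ω) :
    ∃ B : Model n →L[ℝ] Model n →L[ℝ] ℝ, ∀ v w, B v w = schouten G y v w := by
  obtain ⟨B, hB⟩ := hG.exists_ricciForm hy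
  refine ⟨((n : ℝ) - 2)⁻¹ • (B - (scalarCurvature G y / (2 * ((n : ℝ) - 1))) • G y),
    fun v w => ?_⟩
  simp [schouten, hB, div_eq_inv_mul]

lemma apply_schoutenVec (hG : IsMetricOn G Ω) (hy : y ∈ Ω) (v w : Model n) :
    G y (schoutenVec G y v) w = schouten G y v w := by
  obtain ⟨B, hB⟩ := hG.exists_schoutenForm hy
  rw [schoutenVec, map_sum]
  simp only [map_smul, hG.apply_sharp hy, ← hB]
  conv_rhs => rw [← sum_coord_smul w]
  simp [mul_comm]

end IsMetricOn

/-! ### Smoothness along curves -/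

/-- A smooth curve in the domain of a metric. -/
structure IsCurveIn {n : ℕ} (G : FormField n) (Ω : Set (Model n)) (c : ℝ → Model n) (J : Set ℝ) :
    Prop where
  metric : IsMetricOn G Ω
  isOpen : IsOpen J
  smooth : ContDiffOn ℝ ∞ c J
  mapsTo : Set.MapsTo c J Ω

lemma EuclideanSpace.contDiffOn_coord {n : ℕ} {J : Set ℝ} {X : ℝ → Model n}
    (hX : ContDiffOn ℝ ∞ X J) (i : Fin n) : ContDiffOn ℝ ∞ (fun t => X t i) J :=
  (EuclideanSpace.proj i : Model n →L[ℝ] ℝ).contDiff.comp_contDiffOn hX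

namespace IsCurveIn

variable {n : ℕ} {G : FormField n} {Ω : Set (Model n)} {c : ℝ → Model n} {J : Set ℝ}
  {u v w : ℝ → Model n}

lemma mono (h : IsCurveIn G Ω c J) {J' : Set ℝ} (h' : IsOpen J') (hJ : J' ⊆ J) :
    IsCurveIn G Ω c J' :=
  ⟨h.metric, h', h.smooth.mono hJ, h.mapsTo.mono_left hJ⟩

lemma form_smooth (h : IsCurveIn G Ω c J) (hu : ContDiffOn ℝ ∞ u J) (hv : ContDiffOn ℝ ∞ v J) :
    ContDiffOn ℝ ∞ (fun t => G (c t) (u t) (v t)) J :=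
  ((h.metric.smooth.comp h.smooth h.mapsTo).clm_apply hu).clm_apply hv

lemma sharp_smooth (h : IsCurveIn G Ω c J) (ξ : Model n →L[ℝ] ℝ) :
    ContDiffOn ℝ ∞ (fun t => sharp G (c t) ξ) J :=
  (h.metric.inverse_smooth.comp h.smooth h.mapsTo).clm_apply contDiffOn_const

lemma christoffel_smooth (h : IsCurveIn G Ω c J) (hu : ContDiffOn ℝ ∞ u J)
    (hv : ContDiffOn ℝ ∞ v J) : ContDiffOn ℝ ∞ (fun t => christoffel G (c t) (u t) (v t)) J :=
  ((h.metric.christoffelMap_smooth.comp h.smooth h.mapsTo).clm_apply hu).clm_apply hv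

lemma curvature_smooth (h : IsCurveIn G Ω c J) (hu : ContDiffOn ℝ ∞ u J)
    (hv : ContDiffOn ℝ ∞ v J) (hw : ContDiffOn ℝ ∞ w J) :
    ContDiffOn ℝ ∞ (fun t => curvature G (c t) (u t) (v t) (w t)) J := by
  have hd : ∀ {u v w : ℝ → Model n}, ContDiffOn ℝ ∞ u J → ContDiffOn ℝ ∞ v J →
      ContDiffOn ℝ ∞ w J →
      ContDiffOn ℝ ∞ (fun t => fderiv ℝ (christoffelMap G) (c t) (u t) (v t) (w t)) J :=
    fun hu hv hw => ((((h.metric.christoffelMap_smooth.fderiv_of_isOpen h.metric.isOpen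
      (by simp)).comp h.smooth h.mapsTo).clm_apply hu).clm_apply hv).clm_apply hw
  have hc : ∀ {u v w : ℝ → Model n}, ContDiffOn ℝ ∞ u J → ContDiffOn ℝ ∞ v J →
      ContDiffOn ℝ ∞ w J → ContDiffOn ℝ ∞
        (fun t => christoffelMap G (c t) (u t) (christoffelMap G (c t) (v t) (w t))) J :=
    fun hu hv hw => h.christoffel_smooth hu (h.christoffel_smooth hv hw)
  exact ((((hd hu hv hw).sub (hd hv hu hw)).add (hc hu hv hw)).sub (hc hv hu hw)).congr
    fun t ht => h.metric.curvature_eq (h.mapsTo ht) _ _ _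

lemma ricci_smooth (h : IsCurveIn G Ω c J) (hv : ContDiffOn ℝ ∞ v J) (hw : ContDiffOn ℝ ∞ w J) :
    ContDiffOn ℝ ∞ (fun t => ricci G (c t) (v t) (w t)) J :=
  ContDiffOn.sum fun i _ =>
    EuclideanSpace.contDiffOn_coord (h.curvature_smooth contDiffOn_const hv hw) i

lemma scalarCurvature_smooth (h : IsCurveIn G Ω c J) :
    ContDiffOn ℝ ∞ (fun t => scalarCurvature G (c t)) J :=
  ContDiffOn.sum fun _ _ => ContDiffOn.sum fun j _ =>
    (EuclideanSpace.contDiffOn_coord (h.sharp_smooth _) j).mul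
      (h.ricci_smooth contDiffOn_const contDiffOn_const)

lemma schouten_smooth (h : IsCurveIn G Ω c J) (hv : ContDiffOn ℝ ∞ v J)
    (hw : ContDiffOn ℝ ∞ w J) : ContDiffOn ℝ ∞ (fun t => schouten G (c t) (v t) (w t)) J :=
  ((h.ricci_smooth hv hw).sub ((h.scalarCurvature_smooth.div_const _).mul
    (h.form_smooth hv hw))).div_const _

lemma schoutenVec_smooth (h : IsCurveIn G Ω c J) (hv : ContDiffOn ℝ ∞ v J) :
    ContDiffOn ℝ ∞ (fun t => schoutenVec G (c t) (v t)) J :=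
  ContDiffOn.sum fun _ _ => (h.schouten_smooth hv contDiffOn_const).smul (h.sharp_smooth _)

lemma velocity_smooth (h : IsCurveIn G Ω c J) : ContDiffOn ℝ ∞ (deriv c) J :=
  h.smooth.deriv_isOpen h.isOpen

/-- The covariant derivative along a curve. -/
lemma isConnectionOn_covDeriv (h : IsCurveIn G Ω c J) : IsConnectionOn J (covDeriv G c) where
  congr X Y hXY t ht := by
    rw [covDeriv, covDeriv, hXY ht, (hXY.eventuallyEq_isOpen h.isOpen ht).deriv_eq]
  smooth X hX := (hX.deriv_isOpen h.isOpen).add (h.christoffel_smooth h.velocity_smooth hX)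
  add X Y hX hY t ht := by
    simp only [covDeriv]
    rw [deriv_fun_add (hX.differentiableAt_isOpen h.isOpen ht)
      (hY.differentiableAt_isOpen h.isOpen ht)]
    simp only [← christoffelMap_apply, map_add]
    abel
  smul a X ha hX t ht := by
    simp only [covDeriv]
    rw [deriv_fun_smul (ha.differentiableAt_isOpen h.isOpen ht)
      (hX.differentiableAt_isOpen h.isOpen ht)]
    simp only [← christoffelMap_apply, map_smul, smul_add]
    abel

lemma derivedVector_smooth (h : IsCurveIn G Ω c J) (i : ℕ) :
    ContDiffOn ℝ ∞ (derivedVector G c i) J :=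
  h.isConnectionOn_covDeriv.iterate_smooth h.velocity_smooth i

lemma hasDerivAt_form (h : IsCurveIn G Ω c J) {X Y : ℝ → Model n} (hX : ContDiffOn ℝ ∞ X J)
    (hY : ContDiffOn ℝ ∞ Y J) {t : ℝ} (ht : t ∈ J) :
    HasDerivAt (fun s => G (c s) (X s) (Y s))
      (G (c t) (covDeriv G c X t) (Y t) + G (c t) (X t) (covDeriv G c Y t)) t := by
  have dc := (h.smooth.differentiableAt_isOpen h.isOpen ht).hasDerivAt
  have dX := (hX.differentiableAt_isOpen h.isOpen ht).hasDerivAt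
  have dY := (hY.differentiableAt_isOpen h.isOpen ht).hasDerivAt
  have dG := (h.metric.differentiableAt (h.mapsTo ht)).hasFDerivAt.comp_hasDerivAt t dc
  refine ((dG.clm_apply dX).clm_apply dY).congr_deriv ?_
  simp only [covDeriv, Function.comp_apply, map_add, add_apply,
    h.metric.fderiv_eq (h.mapsTo ht)]
  ring

end IsCurveIn

/-! ### The tractor connection along a curve -/

/-- The tractor metric as a bilinear form. -/
noncomputable def tractorForm {n : ℕ} (G : FormField n) (y : Model n) :
    LinearMap.BilinForm ℝ (Tractor n) :=
  LinearMap.mk₂ ℝ (tractorMetric G y)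
    (fun a b c => by simp [tractorMetric]; ring)
    (fun a b c => by simp [tractorMetric]; ring)
    (fun a b c => by simp [tractorMetric]; ring)
    (fun a b c => by simp [tractorMetric]; ring)

lemma tractorForm_apply {n : ℕ} (G : FormField n) (y : Model n) (X Y : Tractor n) :
    tractorForm G y X Y = tractorMetric G y X Y := rfl

namespace IsCurveIn

variable {n : ℕ} {G : FormField n} {Ω : Set (Model n)} {c : ℝ → Model n} {J : Set ℝ}

lemma isConnectionOn_tractorDeriv (h : IsCurveIn G Ω c J) :
    IsConnectionOn J (tractorDeriv G c) where
  congr X Y hXY t ht := by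
    have h1 : Set.EqOn (fun s => (X s).1) (fun s => (Y s).1) J := fun s hs => by
      simp only [hXY hs]
    have h2 : Set.EqOn (fun s => (X s).2.1) (fun s => (Y s).2.1) J := fun s hs => by
      simp only [hXY hs]
    have h3 : Set.EqOn (fun s => (X s).2.2) (fun s => (Y s).2.2) J := fun s hs => by
      simp only [hXY hs]
    simp only [tractorDeriv]
    rw [(h1.eventuallyEq_isOpen h.isOpen ht).deriv_eq,
      (h3.eventuallyEq_isOpen h.isOpen ht).deriv_eq,
      h.isConnectionOn_covDeriv.congr _ _ h2 ht, hXY ht]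
  smooth X hX := by
    have h1 : ContDiffOn ℝ ∞ (fun s => (X s).1) J := hX.fst
    have h2 : ContDiffOn ℝ ∞ (fun s => (X s).2.1) J := hX.snd.fst
    have h3 : ContDiffOn ℝ ∞ (fun s => (X s).2.2) J := hX.snd.snd
    have hU := h.velocity_smooth
    exact ((h1.deriv_isOpen h.isOpen).sub (h.form_smooth hU h2)).prodMk
      ((((h.isConnectionOn_covDeriv.smooth _ h2).add (h3.smul hU)).add
        (h1.smul (h.schoutenVec_smooth hU))).prodMk
          ((h3.deriv_isOpen h.isOpen).sub (h.schouten_smooth hU h2)))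
  add X Y hX hY t ht := by
    obtain ⟨B, hB⟩ := h.metric.exists_schoutenForm (h.mapsTo ht)
    have h2 := h.isConnectionOn_covDeriv.add _ _ hX.snd.fst hY.snd.fst t ht
    simp only [tractorDeriv, Prod.fst_add, Prod.snd_add, ← hB]
    rw [deriv_fun_add (hX.fst.differentiableAt_isOpen h.isOpen ht)
      (hY.fst.differentiableAt_isOpen h.isOpen ht),
      deriv_fun_add (hX.snd.snd.differentiableAt_isOpen h.isOpen ht)
      (hY.snd.snd.differentiableAt_isOpen h.isOpen ht), h2]
    simp only [map_add, add_smul, Prod.mk_add_mk]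
    congr 1
    · ring
    · congr 1
      · abel
      · ring
  smul a X ha hX t ht := by
    obtain ⟨B, hB⟩ := h.metric.exists_schoutenForm (h.mapsTo ht)
    have h2 := h.isConnectionOn_covDeriv.smul a _ ha hX.snd.fst t ht
    simp only [tractorDeriv, Prod.smul_fst, Prod.smul_snd, ← hB, smul_eq_mul]
    rw [deriv_fun_mul (ha.differentiableAt_isOpen h.isOpen ht)
      (hX.fst.differentiableAt_isOpen h.isOpen ht),
      deriv_fun_mul (ha.differentiableAt_isOpen h.isOpen ht)
      (hX.snd.snd.differentiableAt_isOpen h.isOpen ht), h2]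
    rw [← Prod.mk.eta (p := X t), ← Prod.mk.eta (p := (X t).2)]
    simp only [map_smul, smul_eq_mul, Prod.smul_mk, Prod.mk_add_mk, smul_add, smul_smul]
    congr 1
    · ring
    · congr 1
      · abel
      · ring

/-- The tractor connection preserves the tractor metric. -/
theorem isMetricConnectionOn_tractorDeriv (h : IsCurveIn G Ω c J) :
    IsMetricConnectionOn J (tractorDeriv G c) (fun t => tractorForm G (c t)) where
  toIsConnectionOn := h.isConnectionOn_tractorDeriv
  symm t ht X Y := by
    simp only [tractorForm_apply, tractorMetric]
    rw [h.metric.symm _ (h.mapsTo ht)]; ring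
  hasDerivAt X Y hX hY t ht := by
    have d1 := h.hasDerivAt_form hX.snd.fst hY.snd.fst ht
    have d2 := (hX.fst.differentiableAt_isOpen h.isOpen ht).hasDerivAt.mul
      (hY.snd.snd.differentiableAt_isOpen h.isOpen ht).hasDerivAt
    have d3 := (hX.snd.snd.differentiableAt_isOpen h.isOpen ht).hasDerivAt.mul
      (hY.fst.differentiableAt_isOpen h.isOpen ht).hasDerivAt
    refine ((d1.add d2).add d3).congr_deriv ?_
    have hy := h.mapsTo ht
    simp only [tractorForm_apply, tractorMetric, tractorDeriv, map_add, map_smul, add_apply,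
      smul_apply, smul_eq_mul, h.metric.apply_schoutenVec hy,
      h.metric.symm _ hy _ (schoutenVec G (c t) (deriv c t)),
      h.metric.symm _ hy _ (deriv c t)]
    ring

end IsCurveIn

/-! ### Null curves -/

namespace IsGramSystem

variable {J : Set ℝ} {w : ℝ → ℝ} {h : ℕ → ℕ → ℝ → ℝ}

/-- The entry `h_{m,m}` determines the whole antidiagonal `2m` up to sign. If it vanishes, that
antidiagonal is constant, so the odd one after it vanishes as well; one null vector thus gains two
levels. -/
lemma succ {m : ℕ} (H : IsGramSystem J m w h) (hm : ∀ t ∈ J, h m m t = 0) :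
    IsGramSystem J (m + 1) w h := by
  have h0 : ∀ t ∈ J, h 0 (2 * m) t = 0 := by
    intro t ht
    have h1 := H.level_zero m m (by ring) t ht
    rw [hm t ht] at h1
    simpa using h1.symm
  have h1 := H.level_one fun t ht => (hasDerivAt_const t (0 : ℝ)).congr_of_eventuallyEq
    (Set.EqOn.eventuallyEq_isOpen h0 H.isOpen ht)
  refine ⟨H.isOpen, H.symm, H.hasDerivAt, H.ne_zero, fun j hj t ht => ?_⟩
  rcases Nat.lt_or_ge j (2 * m) with h2 | h2
  · exact H.vanish_zero j h2 t ht
  · obtain rfl | rfl : j = 2 * m ∨ j = 2 * m + 1 := by omega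
    · exact h0 t ht
    · exact h1 0 _ (by ring) t ht

lemma of_diag (H : IsGramSystem J 0 w h) {m : ℕ} (hm : ∀ i < m, ∀ t ∈ J, h i i t = 0) :
    IsGramSystem J m w h := by
  induction m with
  | zero => exact H
  | succ m ih => exact (ih fun i hi => hm i (by omega)).succ (hm m (by omega))

end IsGramSystem

section

variable {n : ℕ}

/-- The derived tractors of the canonical tractor `(0, 0, 1)` along a curve. -/
noncomputable def canonicalTractor (G : FormField n) (c : ℝ → Model n) (i : ℕ) : ℝ → Tractor n :=
  (tractorDeriv G c)^[i] fun _ => (0, 0, 1)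

lemma canonicalTractor_succ (G : FormField n) (c : ℝ → Model n) (i : ℕ) :
    canonicalTractor G c (i + 1) = tractorDeriv G c (canonicalTractor G c i) :=
  Function.iterate_succ_apply' _ _ _

lemma derivedVector_succ (G : FormField n) (c : ℝ → Model n) (i : ℕ) :
    derivedVector G c (i + 1) = covDeriv G c (derivedVector G c i) :=
  Function.iterate_succ_apply' _ _ _

lemma derivedTractor_succ (r : ℕ) (G : FormField n) (c : ℝ → Model n) (i : ℕ) :
    derivedTractor r G c (i + 1) = tractorDeriv G c (derivedTractor r G c i) :=
  Function.iterate_succ_apply' _ _ _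

/-- Pairing with `(0, 0, 1)` reads off the top slot, so row `0` of the Gram matrix consists of top
slots of derived tractors. -/
lemma tractorForm_canonicalTractor (G : FormField n) (c : ℝ → Model n) (X : Tractor n) (t : ℝ) :
    tractorForm G (c t) (canonicalTractor G c 0 t) X = X.1 := by
  simp [tractorForm_apply, tractorMetric, canonicalTractor]

end

namespace IsCurveIn

variable {n : ℕ} {G : FormField n} {Ω : Set (Model n)} {c : ℝ → Model n} {J : Set ℝ}

lemma canonicalTractor_smooth (h : IsCurveIn G Ω c J) (i : ℕ) :
    ContDiffOn ℝ ∞ (canonicalTractor G c i) J :=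
  h.isConnectionOn_tractorDeriv.iterate_smooth contDiffOn_const i

/-- The Gram matrix of the derived vectors. -/
lemma isGramSystem_derivedVector (h : IsCurveIn G Ω c J) :
    IsGramSystem J 0 1 fun i j t => G (c t) (derivedVector G c i t) (derivedVector G c j t) where
  isOpen := h.isOpen
  symm i j t ht := h.metric.symm _ (h.mapsTo ht) _ _
  hasDerivAt i j t ht := by
    simpa only [derivedVector_succ, Pi.one_apply, one_mul] using
      h.hasDerivAt_form (h.derivedVector_smooth i) (h.derivedVector_smooth j) ht
  ne_zero := by simp
  vanish_zero j hj := by omega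

/-- The top slots of the derived canonical tractors. -/
theorem canonicalTractor_top (h : IsCurveIn G Ω c J) {m : ℕ}
    (hm : ∀ i < m, ∀ t ∈ J, G (c t) (derivedVector G c i t) (derivedVector G c i t) = 0) :
    (∀ j < 2 * m + 2, ∀ t ∈ J, (canonicalTractor G c j t).1 = 0) ∧
    ∀ t ∈ J, (canonicalTractor G c (2 * m + 2) t).1
      = (-1) ^ (m + 1) * G (c t) (derivedVector G c m t) (derivedVector G c m t) := by
  have H := h.isGramSystem_derivedVector.of_diag hm
  have hs := h.canonicalTractor_smooth
  -- The first derived tractor is `(0, U, 0)`. As long as the pairings `⟨U, U⁽ʲ⁾⟩` vanish,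
  -- differentiating the zero pairing of the middle slot with `U⁽ˡ⁾` shifts the derivative to the
  -- other factor with a sign; the terms with `ρ U` and `P(U)` contribute nothing.
  have key : ∀ i ≤ 2 * m, ∀ t ∈ J, (canonicalTractor G c (i + 1) t).1 = 0 ∧
      ∀ l, i + l ≤ 2 * m → G (c t) (canonicalTractor G c (i + 1) t).2.1 (derivedVector G c l t)
        = (-1) ^ i * G (c t) (derivedVector G c 0 t) (derivedVector G c (i + l) t) := by
    intro i
    induction i with
    | zero =>
      intro _ t ht
      have h1 : covDeriv G c (fun _ => (0 : Model n)) t = 0 := h.isConnectionOn_covDeriv.zero ht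
      simp [canonicalTractor, tractorDeriv, h1, derivedVector]
    | succ i ih =>
      intro hi t ht
      have h1 : Set.EqOn (fun s => (canonicalTractor G c (i + 1) s).1) 0 J :=
        fun s hs => (ih (by omega) s hs).1
      have h2 : deriv (fun s => (canonicalTractor G c (i + 1) s).1) t = 0 := by
        rw [(h1.eventuallyEq_isOpen h.isOpen ht).deriv_eq]; simp
      have h3 : ∀ l, i + l < 2 * m → ∀ s ∈ J,
          G (c s) (canonicalTractor G c (i + 1) s).2.1 (derivedVector G c l s) = 0 := by
        intro l hl s hs
        rw [(ih (by omega) s hs).2 l hl.le, H.vanish_zero _ hl s hs, mul_zero]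
      rw [canonicalTractor_succ]
      simp only [tractorDeriv]
      refine ⟨?_, fun l hl => ?_⟩
      · rw [h2, h.metric.symm _ (h.mapsTo ht)]
        have := h3 0 (by omega) t ht
        rw [derivedVector, Function.iterate_zero, id_eq] at this
        rw [this, sub_zero]
      · have h4 := HasDerivAt.eq_of_eqOn h.isOpen ht
          (h.hasDerivAt_form (hs (i + 1)).snd.fst (h.derivedVector_smooth l) ht)
          (hasDerivAt_const t (0 : ℝ)) (h3 l (by omega))
        have h5 := (ih (by omega) t ht).2 (l + 1) (by omega)
        rw [derivedVector_succ] at h5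
        have h6 : G (c t) (deriv c t) (derivedVector G c l t) = 0 :=
          H.vanish_zero l (by omega) t ht
        simp only [map_add, map_smul, add_apply, smul_apply, smul_eq_mul, h6, mul_zero, add_zero,
          show (canonicalTractor G c (i + 1) t).1 = 0 from h1 ht, zero_mul]
        rw [h5] at h4
        rw [show i + 1 + l = i + (l + 1) by ring, pow_succ]
        linear_combination h4
  refine ⟨fun j hj t ht => ?_, fun t ht => ?_⟩
  · rcases j with _ | j
    · rfl
    · exact (key j (by omega) t ht).1
  · have h1 : Set.EqOn (fun s => (canonicalTractor G c (2 * m + 1) s).1) 0 J :=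
      fun s hs => (key (2 * m) le_rfl s hs).1
    have h2 : deriv (fun s => (canonicalTractor G c (2 * m + 1) s).1) t = 0 := by
      rw [(h1.eventuallyEq_isOpen h.isOpen ht).deriv_eq]; simp
    have h3 := (key (2 * m) le_rfl t ht).2 0 (by omega)
    have h4 := H.level_zero m m (by ring) t ht
    rw [canonicalTractor_succ]
    simp only [tractorDeriv]
    rw [h2, h.metric.symm _ (h.mapsTo ht), show deriv c t = derivedVector G c 0 t from rfl, h3, h4,
      (even_two_mul m).neg_one_pow, ← mul_assoc, ← pow_add, show m + 1 + m = 2 * m + 1 by ring,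
      pow_succ, (even_two_mul m).neg_one_pow]
    simp

end IsCurveIn

/-- An `r`-null curve in the domain of a metric. -/
structure IsNullCurveIn {n : ℕ} (r : ℕ) (G : FormField n) (Ω : Set (Model n)) (c : ℝ → Model n)
    (J : Set ℝ) : Prop extends IsCurveIn G Ω c J where
  null : ∀ i < r, ∀ t ∈ J, G (c t) (derivedVector G c i t) (derivedVector G c i t) = 0
  not_null : ∀ t ∈ J, G (c t) (derivedVector G c r t) (derivedVector G c r t) ≠ 0

namespace IsCurveIn

variable {n r : ℕ} {G : FormField n} {Ω : Set (Model n)} {c : ℝ → Model n} {J : Set ℝ}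

/-- Null curves are characterized by the derived canonical tractors. -/
lemma isNullCurveIn (h : IsCurveIn G Ω c J)
    (h0 : ∀ j < 2 * (r + 1), ∀ t ∈ J, (canonicalTractor G c j t).1 = 0)
    (h1 : ∀ t ∈ J, (canonicalTractor G c (2 * (r + 1)) t).1 ≠ 0) : IsNullCurveIn r G Ω c J := by
  have h2 : ∀ i < r, ∀ t ∈ J, G (c t) (derivedVector G c i t) (derivedVector G c i t) = 0 := by
    intro i
    induction i using Nat.strong_induction_on with
    | _ i ih =>
      intro hi t ht
      -- Once the earlier vectors are null, the top slot of order `2i + 2` is `±⟨U⁽ⁱ⁾, U⁽ⁱ⁾⟩`.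
      have h3 := (h.canonicalTractor_top (m := i) fun l hl => ih l hl (by omega)).2 t ht
      rw [h0 (2 * i + 2) (by omega) t ht] at h3
      simpa using h3.symm
  refine ⟨h, h2, fun t ht h3 => h1 t ht ?_⟩
  rw [show 2 * (r + 1) = 2 * r + 2 by ring, (h.canonicalTractor_top h2).2 t ht, h3, mul_zero]

end IsCurveIn

namespace IsNullCurveIn

variable {n r : ℕ} {G : FormField n} {Ω : Set (Model n)} {c : ℝ → Model n} {J : Set ℝ}

lemma mono' (h : IsNullCurveIn r G Ω c J) {J' : Set ℝ} (h' : IsOpen J') (hJ : J' ⊆ J) :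
    IsNullCurveIn r G Ω c J' :=
  ⟨h.toIsCurveIn.mono h' hJ, fun i hi t ht => h.null i hi t (hJ ht),
    fun t ht => h.not_null t (hJ ht)⟩

lemma canonicalTractor_vanish (h : IsNullCurveIn r G Ω c J) {j : ℕ} (hj : j < 2 * (r + 1)) {t : ℝ}
    (ht : t ∈ J) : (canonicalTractor G c j t).1 = 0 :=
  (h.canonicalTractor_top h.null).1 j (by omega) t ht

lemma canonicalTractor_eq (h : IsNullCurveIn r G Ω c J) {t : ℝ} (ht : t ∈ J) :
    (canonicalTractor G c (2 * (r + 1)) t).1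
      = (-1) ^ (r + 1) * G (c t) (derivedVector G c r t) (derivedVector G c r t) :=
  (h.canonicalTractor_top h.null).2 t ht

/-- The weight `u⁻¹` of the tractor lift. -/
noncomputable def weight (r : ℕ) (G : FormField n) (c : ℝ → Model n) (t : ℝ) : ℝ :=
  (Real.sqrt |G (c t) (derivedVector G c r t) (derivedVector G c r t)|)⁻¹

lemma tractorLift_eq (r : ℕ) (G : FormField n) (c : ℝ → Model n) (t : ℝ) :
    tractorLift r G c t = weight r G c t • canonicalTractor G c 0 t := by
  simp [tractorLift, weight, canonicalTractor]

lemma weight_smooth (h : IsNullCurveIn r G Ω c J) : ContDiffOn ℝ ∞ (weight r G c) J := by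
  have h1 := h.form_smooth (h.derivedVector_smooth r) (h.derivedVector_smooth r)
  have h2 : ContDiffOn ℝ ∞ (fun t => |G (c t) (derivedVector G c r t) (derivedVector G c r t)|) J :=
    h1.abs h.not_null
  refine (h2.sqrt fun t ht => ?_).inv fun t ht => ?_
  · exact abs_ne_zero.mpr (h.not_null t ht)
  · exact (Real.sqrt_pos.mpr (abs_pos.mpr (h.not_null t ht))).ne'

lemma tractorLift_smooth (h : IsNullCurveIn r G Ω c J) : ContDiffOn ℝ ∞ (tractorLift r G c) J :=
  contDiffOn_const.prodMk (contDiffOn_const.prodMk h.weight_smooth)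

lemma derivedTractor_smooth (h : IsNullCurveIn r G Ω c J) (i : ℕ) :
    ContDiffOn ℝ ∞ (derivedTractor r G c i) J :=
  h.isConnectionOn_tractorDeriv.iterate_smooth h.tractorLift_smooth i

lemma pairing_derivedTractor (h : IsNullCurveIn r G Ω c J) (j : ℕ) {t : ℝ} (ht : t ∈ J) :
    tractorForm G (c t) (derivedTractor r G c 0 t) (derivedTractor r G c j t)
      = weight r G c t * ∑ i ∈ Finset.range (j + 1),
        chainCoeff 1 (weight r G c) j i t * (canonicalTractor G c i t).1 := by
  rw [h.isMetricConnectionOn_tractorDeriv.pairing_eq_sum h.isOpen (w := 1) contDiffOn_const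
    h.weight_smooth (Z := derivedTractor r G c) (W := canonicalTractor G c)
    (fun j t _ => by rw [derivedTractor_succ]) h.canonicalTractor_smooth
    (fun i t _ => by rw [canonicalTractor_succ]; simp) (fun t _ => tractorLift_eq r G c t) j ht]
  simp only [tractorForm_canonicalTractor]

/-- The Gram matrix of the derived tractors of a null curve. -/
theorem isGramSystem (h : IsNullCurveIn r G Ω c J) : IsGramSystem J (r + 1) 1 fun i j t =>
    tractorForm G (c t) (derivedTractor r G c i t) (derivedTractor r G c j t) := by
  refine h.isMetricConnectionOn_tractorDeriv.isGramSystem h.isOpen h.derivedTractor_smooth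
    (fun i t _ => by rw [derivedTractor_succ]; simp) (by simp) fun j hj t ht => ?_
  rw [h.pairing_derivedTractor j ht, Finset.sum_eq_zero, mul_zero]
  intro i hi
  rw [h.canonicalTractor_vanish (by have := Finset.mem_range.mp hi; omega) ht, mul_zero]

/-- Only the diagonal coefficient survives, so the pairing is `±⟨U⁽ʳ⁾, U⁽ʳ⁾⟩ / u²`. The
normalisation of `T` makes it a sign. -/
lemma gram_sq (h : IsNullCurveIn r G Ω c J) {t : ℝ} (ht : t ∈ J) :
    tractorForm G (c t) (derivedTractor r G c 0 t) (derivedTractor r G c (2 * (r + 1)) t) ^ 2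
      = 1 := by
  rw [h.pairing_derivedTractor _ ht, Finset.sum_range_succ, Finset.sum_eq_zero, chainCoeff_diag,
    h.canonicalTractor_eq ht]
  · have h1 : weight r G c t ^ 2 * |G (c t) (derivedVector G c r t) (derivedVector G c r t)|
        = 1 := by
      rw [weight, inv_pow, Real.sq_sqrt (abs_nonneg _)]
      exact inv_mul_cancel₀ (abs_ne_zero.mpr (h.not_null t ht))
    have h2 : ((-1 : ℝ) ^ (r + 1)) ^ 2 = 1 := by
      rw [← pow_mul, mul_comm, (even_two_mul _).neg_one_pow]
    have h3 := sq_abs (G (c t) (derivedVector G c r t) (derivedVector G c r t))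
    set W := weight r G c t
    set g := G (c t) (derivedVector G c r t) (derivedVector G c r t)
    calc (W * (0 + W * (1 : ℝ → ℝ) t ^ (2 * (r + 1)) * ((-1) ^ (r + 1) * g))) ^ 2
        = (W ^ 2) ^ 2 * g ^ 2 * ((-1) ^ (r + 1)) ^ 2 := by simp only [Pi.one_apply, one_pow]; ring
      _ = (W ^ 2 * |g|) ^ 2 := by rw [h2, ← h3]; ring
      _ = 1 := by rw [h1, one_pow]
  · intro i hi
    rw [h.canonicalTractor_vanish (Finset.mem_range.mp hi) ht, mul_zero]

lemma gram_ne_zero (h : IsNullCurveIn r G Ω c J) {t : ℝ} (ht : t ∈ J) :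
    tractorForm G (c t) (derivedTractor r G c 0 t) (derivedTractor r G c (2 * (r + 1)) t) ≠ 0 := by
  intro h1
  have := h.gram_sq ht
  rw [h1] at this
  norm_num at this

lemma hasDerivAt_of_sq_eq_one {J : Set ℝ} (hJ : IsOpen J) {f : ℝ → ℝ}
    (hf : ∀ t ∈ J, DifferentiableAt ℝ f t) (h1 : ∀ t ∈ J, f t ^ 2 = 1) {t : ℝ} (ht : t ∈ J) :
    HasDerivAt f 0 t := by
  have d := (hf t ht).hasDerivAt
  have h2 := HasDerivAt.eq_of_eqOn hJ ht (d.pow 2) (hasDerivAt_const t (1 : ℝ)) h1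
  refine d.congr_deriv ?_
  have h3 : f t ≠ 0 := fun h => by have := h1 t ht; rw [h] at this; norm_num at this
  simpa [h3] using h2

lemma hasDerivAt_gram (h : IsNullCurveIn r G Ω c J) {t : ℝ} (ht : t ∈ J) :
    HasDerivAt (fun t => tractorForm G (c t) (derivedTractor r G c 0 t)
      (derivedTractor r G c (2 * (r + 1)) t)) 0 t :=
  hasDerivAt_of_sq_eq_one h.isOpen
    (fun t ht => (h.isGramSystem.hasDerivAt 0 (2 * (r + 1)) t ht).differentiableAt)
    (fun _ ht => h.gram_sq ht) ht

lemma epsilon_sq (h : IsNullCurveIn r G Ω c J) {t : ℝ} (ht : t ∈ J) :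
    tractorForm G (c t) (derivedTractor r G c (r + 1) t) (derivedTractor r G c (r + 1) t) ^ 2
      = 1 := by
  have h1 := h.isGramSystem.level_zero (r + 1) (r + 1) (by ring) t ht
  rw [h1, mul_pow, h.gram_sq ht, ← pow_mul, mul_comm (r + 1) 2, (even_two_mul _).neg_one_pow,
    one_mul]

end IsNullCurveIn

/-! ### Reparametrizations -/

section

variable {n : ℕ}

/-- The squared norms `⟨T⁽ⁱ⁾, T⁽ⁱ⁾⟩` of the derived tractors. -/
noncomputable def tractorNorm (r : ℕ) (G : FormField n) (c : ℝ → Model n) (i : ℕ) (t : ℝ) : ℝ :=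
  tractorForm G (c t) (derivedTractor r G c i t) (derivedTractor r G c i t)

/-- `Θ₄` of a curve in the domain of a metric. -/
noncomputable def localTheta (r : ℕ) (G : FormField n) (c : ℝ → Model n) (t : ℝ) : ℝ :=
  -(tractorNorm r G c (r + 1) t * tractorNorm r G c (r + 3) t)
    - (r : ℝ) * (r + 3) / 10 * tractorNorm r G c (r + 1) t
      * iteratedDeriv 2 (tractorNorm r G c (r + 2)) t
    + ((r : ℝ) + 3) * (2 * r + 5) * (5 * r + 4) / (10 * (r + 1) * (r + 2) * (2 * r + 3))
      * tractorNorm r G c (r + 2) t ^ 2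

end

namespace IsNullCurveIn

variable {n r : ℕ} {G : FormField n} {Ω : Set (Model n)} {c : ℝ → Model n} {J : Set ℝ}

lemma gram_smooth (h : IsNullCurveIn r G Ω c J) (i j : ℕ) : ContDiffOn ℝ ∞
    (fun t => tractorForm G (c t) (derivedTractor r G c i t) (derivedTractor r G c j t)) J :=
  h.isMetricConnectionOn_tractorDeriv.contDiffOn_pairing h.isOpen (h.derivedTractor_smooth i)
    (h.derivedTractor_smooth j)

lemma localTheta_eq (h : IsNullCurveIn r G Ω c J) {a₁ a₂ : ℝ → ℝ}
    (ha₁ : ∀ t ∈ J, HasDerivAt (fun t => tractorForm G (c t) (derivedTractor r G c 0 t)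
      (derivedTractor r G c (2 * (r + 1) + 2) t)) (a₁ t) t)
    (ha₂ : ∀ t ∈ J, HasDerivAt a₁ (a₂ t) t) {t : ℝ} (ht : t ∈ J) :
    localTheta r G c t = gramTheta (r + 1)
      (tractorForm G (c t) (derivedTractor r G c 0 t) (derivedTractor r G c (2 * (r + 1)) t))
      (tractorForm G (c t) (derivedTractor r G c 0 t) (derivedTractor r G c (2 * (r + 1) + 2) t))
      (a₂ t)
      (tractorForm G (c t) (derivedTractor r G c 0 t)
        (derivedTractor r G c (2 * (r + 1) + 4) t)) :=
  h.isGramSystem.theta_eq (fun _ ht => h.hasDerivAt_gram ht) (fun _ ht => h.epsilon_sq ht) ha₁ ha₂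
    ht

end IsNullCurveIn

/-- `c = ĉ ∘ ψ` on `J`, where `ψ` is a change of parameter. -/
structure IsReparametrizationOn {n : ℕ} (ψ : ℝ → ℝ) (c c' : ℝ → Model n) (J : Set ℝ) : Prop where
  smooth : ContDiffOn ℝ ∞ ψ J
  deriv_ne_zero : ∀ t ∈ J, deriv ψ t ≠ 0
  injOn : Set.InjOn ψ J
  eq : ∀ t ∈ J, c' (ψ t) = c t

namespace IsReparametrizationOn

variable {n r : ℕ} {G : FormField n} {Ω : Set (Model n)} {c c' : ℝ → Model n} {J : Set ℝ}
  {ψ : ℝ → ℝ}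

lemma isCurveIn (hψ : IsReparametrizationOn ψ c c' J) (h : IsCurveIn G Ω c J) :
    IsCurveIn G Ω c' (ψ '' J) where
  metric := h.metric
  isOpen := isOpen_image_of_deriv_ne_zero h.isOpen hψ.smooth hψ.deriv_ne_zero
  smooth := by
    refine (h.smooth.comp (contDiffOn_invFunOn h.isOpen hψ.smooth hψ.deriv_ne_zero hψ.injOn)
      fun s hs => Function.invFunOn_mem hs).congr ?_
    rintro _ ⟨t, ht, rfl⟩
    rw [Function.comp_apply, hψ.injOn.leftInvOn_invFunOn ht, hψ.eq t ht]
  mapsTo := by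
    rintro _ ⟨t, ht, rfl⟩
    rw [hψ.eq t ht]
    exact h.mapsTo ht

lemma deriv_comp (hψ : IsReparametrizationOn ψ c c' J) (h : IsCurveIn G Ω c J) {E : Type*}
    [NormedAddCommGroup E] [NormedSpace ℝ E] {X : ℝ → E} (hX : ContDiffOn ℝ ∞ X (ψ '' J)) {t : ℝ}
    (ht : t ∈ J) : deriv (fun s => X (ψ s)) t = deriv ψ t • deriv X (ψ t) :=
  ((hX.differentiableAt_isOpen (hψ.isCurveIn h).isOpen
    (Set.mem_image_of_mem _ ht)).hasDerivAt.scomp t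
      (hψ.smooth.differentiableAt_isOpen h.isOpen ht).hasDerivAt).deriv

/-- The tractor connection is linear in the velocity, so the chain rule contributes one factor `ψ'`
in every slot. -/
lemma tractorDeriv_comp (hψ : IsReparametrizationOn ψ c c' J) (h : IsCurveIn G Ω c J)
    {X : ℝ → Tractor n} (hX : ContDiffOn ℝ ∞ X (ψ '' J)) {t : ℝ} (ht : t ∈ J) :
    tractorDeriv G c (fun s => X (ψ s)) t = deriv ψ t • tractorDeriv G c' X (ψ t) := by
  have hc : deriv c t = deriv ψ t • deriv c' (ψ t) := by
    rw [← hψ.deriv_comp h (hψ.isCurveIn h).smooth ht]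
    have h1 : Set.EqOn c (fun s => c' (ψ s)) J := fun s hs => (hψ.eq s hs).symm
    exact (h1.eventuallyEq_isOpen h.isOpen ht).deriv_eq
  obtain ⟨B, hB⟩ := h.metric.exists_schoutenForm (h.mapsTo ht)
  simp only [tractorDeriv, covDeriv, schoutenVec, ← hB, ← christoffelMap_apply]
  rw [hψ.deriv_comp h hX.fst ht, hψ.deriv_comp h hX.snd.fst ht, hψ.deriv_comp h hX.snd.snd ht, hc,
    hψ.eq t ht]
  simp only [map_smul, smul_apply, smul_eq_mul, ← hB, Prod.smul_mk, smul_add, Finset.smul_sum,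
    smul_smul]
  congr 1
  · ring
  · congr 1
    · simp only [mul_comm, mul_left_comm]
    · ring

lemma canonicalTractor_comp (hψ : IsReparametrizationOn ψ c c' J) (h : IsCurveIn G Ω c J) (j : ℕ)
    {t : ℝ} (ht : t ∈ J) : (canonicalTractor G c j t).1 = ∑ i ∈ Finset.range (j + 1),
      chainCoeff (deriv ψ) 1 j i t * (canonicalTractor G c' i (ψ t)).1 := by
  have h' := hψ.isCurveIn h
  have h1 := h.isConnectionOn_tractorDeriv.eq_sum_chainCoeff h.isOpen (w := deriv ψ) (μ := 1)
    (hψ.smooth.deriv_isOpen h.isOpen) contDiffOn_const (Z := canonicalTractor G c)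
    (W := fun i s => canonicalTractor G c' i (ψ s)) (fun j t _ => by rw [canonicalTractor_succ])
    (fun i => (h'.canonicalTractor_smooth i).comp hψ.smooth (Set.mapsTo_image _ _))
    (fun i t ht => by
      rw [hψ.tractorDeriv_comp h (h'.canonicalTractor_smooth i) ht, canonicalTractor_succ])
    (fun t _ => by simp [canonicalTractor]) j ht
  rw [h1, Prod.fst_sum]
  simp

lemma canonicalTractor_vanish (hψ : IsReparametrizationOn ψ c c' J) (h : IsNullCurveIn r G Ω c J)
    {j : ℕ} (hj : j < 2 * (r + 1)) {t : ℝ} (ht : t ∈ J) :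
    (canonicalTractor G c' j (ψ t)).1 = 0 := by
  induction j using Nat.strong_induction_on with
  | _ j ih =>
    have h1 := hψ.canonicalTractor_comp h.toIsCurveIn j ht
    rw [h.canonicalTractor_vanish hj ht, Finset.sum_range_succ, Finset.sum_eq_zero,
      chainCoeff_diag] at h1
    · simpa [hψ.deriv_ne_zero t ht] using h1.symm
    · intro i hi
      have := Finset.mem_range.mp hi
      rw [ih i this (by omega), mul_zero]

lemma canonicalTractor_eq (hψ : IsReparametrizationOn ψ c c' J) (h : IsNullCurveIn r G Ω c J)
    {t : ℝ} (ht : t ∈ J) : (canonicalTractor G c (2 * (r + 1)) t).1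
      = deriv ψ t ^ (2 * (r + 1)) * (canonicalTractor G c' (2 * (r + 1)) (ψ t)).1 := by
  rw [hψ.canonicalTractor_comp h.toIsCurveIn _ ht, Finset.sum_range_succ, Finset.sum_eq_zero,
    chainCoeff_diag]
  · simp
  · intro i hi
    rw [hψ.canonicalTractor_vanish h (Finset.mem_range.mp hi) ht, mul_zero]

/-- Nullity is compared through top slots of canonical tractors, whose transformation under `ψ` is
triangular, rather than through the derived vectors. -/
lemma isNullCurveIn (hψ : IsReparametrizationOn ψ c c' J) (h : IsNullCurveIn r G Ω c J) :
    IsNullCurveIn r G Ω c' (ψ '' J) := by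
  refine (hψ.isCurveIn h.toIsCurveIn).isNullCurveIn ?_ ?_
  · rintro j hj _ ⟨t, ht, rfl⟩
    exact hψ.canonicalTractor_vanish h hj ht
  · rintro _ ⟨t, ht, rfl⟩ h0
    have h1 := hψ.canonicalTractor_eq h ht
    rw [h0, mul_zero, h.canonicalTractor_eq ht] at h1
    simp [h.not_null t ht] at h1

/-- `⟨U⁽ʳ⁾, U⁽ʳ⁾⟩` scales by `ψ'` to the power `2 (r + 1)`. The absolute value comes from the square
root, as `ψ` may reverse orientation. -/
lemma weight_eq (hψ : IsReparametrizationOn ψ c c' J) (h : IsNullCurveIn r G Ω c J) {t : ℝ}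
    (ht : t ∈ J) : IsNullCurveIn.weight r G c t
      = (|deriv ψ t| ^ (r + 1))⁻¹ * IsNullCurveIn.weight r G c' (ψ t) := by
  have h1 := hψ.canonicalTractor_eq h ht
  rw [h.canonicalTractor_eq ht,
    (hψ.isNullCurveIn h).canonicalTractor_eq (Set.mem_image_of_mem _ ht)] at h1
  have h2 : G (c t) (derivedVector G c r t) (derivedVector G c r t) = deriv ψ t ^ (2 * (r + 1))
      * G (c' (ψ t)) (derivedVector G c' r (ψ t)) (derivedVector G c' r (ψ t)) := by
    apply mul_left_cancel₀ (show (-1 : ℝ) ^ (r + 1) ≠ 0 by simp)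
    rw [h1]; ring
  rw [IsNullCurveIn.weight, IsNullCurveIn.weight, h2, abs_mul, abs_pow, mul_comm 2 (r + 1), pow_mul,
    Real.sqrt_mul (by positivity), Real.sqrt_sq (by positivity), mul_inv]

/-- The transformation law of `Θ₄` under a change of parameter. -/
theorem localTheta_eq (hψ : IsReparametrizationOn ψ c c' J) (h : IsNullCurveIn r G Ω c J) {t : ℝ}
    (ht : t ∈ J) : localTheta r G c t = deriv ψ t ^ 4 * localTheta r G c' (ψ t) := by
  have h' := hψ.isNullCurveIn h
  have hm : ∀ t ∈ J, ψ t ∈ ψ '' J := fun t ht => Set.mem_image_of_mem _ ht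
  have sw := hψ.smooth.deriv_isOpen h.isOpen
  let μ : ℝ → ℝ := fun t => (|deriv ψ t| ^ (r + 1))⁻¹
  have hμ0 : ∀ t ∈ J, μ t ≠ 0 := fun t ht =>
    inv_ne_zero (pow_ne_zero _ (abs_ne_zero.mpr (hψ.deriv_ne_zero t ht)))
  have sμ : ContDiffOn ℝ ∞ μ J := ((sw.abs hψ.deriv_ne_zero).pow _).inv fun t ht =>
    pow_ne_zero _ (abs_ne_zero.mpr (hψ.deriv_ne_zero t ht))
  -- The tractors of the second curve are pulled back by `ψ`, so both families are sections along
  -- the first curve and the transformation law of `gramTheta` applies with `w = ψ'`.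
  set W : ℕ → ℝ → Tractor n := fun i s => derivedTractor r G c' i (ψ s) with hW
  have sW : ∀ i, ContDiffOn ℝ ∞ (W i) J := fun i =>
    (h'.derivedTractor_smooth i).comp hψ.smooth (Set.mapsTo_image _ _)
  have dW : ∀ i, ∀ t ∈ J, tractorDeriv G c (W i) t = deriv ψ t • W (i + 1) t := fun i t ht => by
    rw [hW, hψ.tractorDeriv_comp h.toIsCurveIn (h'.derivedTractor_smooth i) ht]
    simp only [derivedTractor_succ]
  have hT0 : ∀ t ∈ J, derivedTractor r G c 0 t = μ t • W 0 t := fun t ht => by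
    simp only [hW, μ, derivedTractor, Function.iterate_zero, id_eq,
      IsNullCurveIn.tractorLift_eq, hψ.weight_eq h ht, mul_smul]
    rfl
  have hD := h.isMetricConnectionOn_tractorDeriv
  have hform : ∀ t ∈ J, ∀ X Y, tractorForm G (c t) X Y = tractorForm G (c' (ψ t)) X Y :=
    fun t ht X Y => by rw [hψ.eq t ht]
  have K : IsGramSystem J (r + 1) (deriv ψ) fun i j t => tractorForm G (c t) (W i t) (W j t) :=
    hD.isGramSystem h.isOpen sW dW hψ.deriv_ne_zero fun j hj t ht => by
      rw [hform t ht]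
      exact h'.isGramSystem.vanish_zero j hj _ (hm t ht)
  have dcomp : ∀ {f : ℝ → ℝ} {f' t : ℝ}, t ∈ J → HasDerivAt f f' (ψ t) →
      HasDerivAt (fun t => f (ψ t)) (deriv ψ t * f') t := fun ht hf => by
    rw [mul_comm]
    exact hf.comp _ (hψ.smooth.differentiableAt_isOpen h.isOpen ht).hasDerivAt
  have hK : ∀ j, ∀ t ∈ J, ∀ f', HasDerivAt (fun s => tractorForm G (c' s)
      (derivedTractor r G c' 0 s) (derivedTractor r G c' j s)) f' (ψ t) →
      HasDerivAt (fun t => tractorForm G (c t) (W 0 t) (W j t)) (deriv ψ t * f') t :=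
    fun j t ht f' hf => (dcomp ht hf).congr_of_eventuallyEq
      (Set.EqOn.eventuallyEq_isOpen (fun s hs => hform s hs _ _) h.isOpen ht)
  have sA := h.gram_smooth 0 (2 * (r + 1) + 2)
  have sA' := h'.gram_smooth 0 (2 * (r + 1) + 2)
  have ha₁ := fun (t : ℝ) (ht : t ∈ J) => (sA.differentiableAt_isOpen h.isOpen ht).hasDerivAt
  have ha₂ := fun (t : ℝ) (ht : t ∈ J) =>
    ((sA.deriv_isOpen h.isOpen).differentiableAt_isOpen h.isOpen ht).hasDerivAt
  have hb₁ := fun (s : ℝ) (hs : s ∈ ψ '' J) =>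
    (sA'.differentiableAt_isOpen h'.isOpen hs).hasDerivAt
  have hb₂ := fun (s : ℝ) (hs : s ∈ ψ '' J) =>
    ((sA'.deriv_isOpen h'.isOpen).differentiableAt_isOpen h'.isOpen hs).hasDerivAt
  have key := gramTheta_transform (by omega) h.isGramSystem K sw sμ hμ0
    (fun _ ht => h.gram_ne_zero ht) (fun _ ht => h.hasDerivAt_gram ht)
    (fun t ht => by simpa using hK _ t ht 0 (h'.hasDerivAt_gram (hm t ht)))
    (fun j t ht => hD.pairing_eq_sum h.isOpen sw sμ (Z := derivedTractor r G c)
      (fun j t _ => by rw [derivedTractor_succ]) sW dW hT0 j ht) ha₁ ha₂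
    (fun t ht => hK _ t ht _ (hb₁ _ (hm t ht))) (fun t ht => dcomp ht (hb₂ _ (hm t ht))) ht
  rw [h.localTheta_eq ha₁ ha₂ ht, h'.localTheta_eq hb₁ hb₂ (hm t ht)]
  simp only [hform t ht] at key
  rw [← key, hform t ht, hform t ht, hform t ht]

end IsReparametrizationOn

/-- Used for changes of charts and for conformal changes: it is enough to check that `Φ` commutes
with one derivative and matches the initial sections. -/
lemma IsConnectionOn.iterate_intertwine {V V' : Type*} [NormedAddCommGroup V] [NormedSpace ℝ V]
    [NormedAddCommGroup V'] [NormedSpace ℝ V'] {J : Set ℝ} {D : (ℝ → V) → ℝ → V}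
    {D' : (ℝ → V') → ℝ → V'} (hD : IsConnectionOn J D) (hD' : IsConnectionOn J D')
    {Φ : ℝ → V → V'} (hΦ : ∀ X, ContDiffOn ℝ ∞ X J → ∀ t ∈ J,
      D' (fun s => Φ s (X s)) t = Φ t (D X t)) {X : ℝ → V} {X' : ℝ → V'}
    (hX : ContDiffOn ℝ ∞ X J) (h : ∀ t ∈ J, X' t = Φ t (X t)) (i : ℕ) {t : ℝ} (ht : t ∈ J) :
    D'^[i] X' t = Φ t (D^[i] X t) := by
  induction i generalizing t with
  | zero => exact h t ht
  | succ i ih =>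
    rw [Function.iterate_succ_apply', Function.iterate_succ_apply',
      hD'.congr _ _ (fun t ht => ih ht) ht, hΦ _ (hD.iterate_smooth hX i) t ht]

/-! ### Naturality under isometries -/

/-- `φ` is a local isometry from `(Ω, G)` to `(Ω', G')`. -/
structure IsLocalIsometryOn {n : ℕ} (φ : Model n → Model n) (G : FormField n) (Ω : Set (Model n))
    (G' : FormField n) (Ω' : Set (Model n)) : Prop where
  metric : IsMetricOn G Ω
  metric' : IsMetricOn G' Ω'
  smooth : ContDiffOn ℝ ∞ φ Ω
  mapsTo : Set.MapsTo φ Ω Ω'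
  form_eq : ∀ y ∈ Ω, ∀ u v, G y u v = G' (φ y) (fderiv ℝ φ y u) (fderiv ℝ φ y v)

namespace IsLocalIsometryOn

variable {n : ℕ} {φ : Model n → Model n} {G G' : FormField n} {Ω Ω' : Set (Model n)} {y : Model n}

/-- Nondegeneracy of `G` makes the differential injective, hence bijective in equal finite
dimensions. -/
lemma exists_equiv (h : IsLocalIsometryOn φ G Ω G' Ω') (hy : y ∈ Ω) :
    ∃ e : Model n ≃ₗ[ℝ] Model n, ∀ v, e v = fderiv ℝ φ y v := by
  have hinj : Function.Injective (fderiv ℝ φ y).toLinearMap := by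
    rw [← LinearMap.ker_eq_bot, LinearMap.ker_eq_bot']
    intro v hv
    refine h.metric.nondegenerate y hy v fun w => ?_
    have hv' : fderiv ℝ φ y v = 0 := hv
    rw [h.form_eq y hy, hv', map_zero]
    rfl
  exact ⟨LinearEquiv.ofInjectiveEndo _ hinj, fun v => rfl⟩

lemma contDiffAt (h : IsLocalIsometryOn φ G Ω G' Ω') (hy : y ∈ Ω) : ContDiffAt ℝ ∞ φ y :=
  h.smooth.contDiffAt (h.metric.isOpen.mem_nhds hy)

lemma fderiv_smooth (h : IsLocalIsometryOn φ G Ω G' Ω') : ContDiffOn ℝ ∞ (fderiv ℝ φ) Ω :=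
  h.smooth.fderiv_of_isOpen h.metric.isOpen (by simp)

lemma fderiv_contDiffAt (h : IsLocalIsometryOn φ G Ω G' Ω') (hy : y ∈ Ω) :
    ContDiffAt ℝ ∞ (fderiv ℝ φ) y :=
  h.fderiv_smooth.contDiffAt (h.metric.isOpen.mem_nhds hy)

lemma hasFDerivAt (h : IsLocalIsometryOn φ G Ω G' Ω') (hy : y ∈ Ω) :
    HasFDerivAt φ (fderiv ℝ φ y) y :=
  ((h.contDiffAt hy).differentiableAt (by simp)).hasFDerivAt

lemma hasFDerivAt_fderiv (h : IsLocalIsometryOn φ G Ω G' Ω') (hy : y ∈ Ω) :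
    HasFDerivAt (fderiv ℝ φ) (fderiv ℝ (fderiv ℝ φ) y) y :=
  ((h.fderiv_contDiffAt hy).differentiableAt (by simp)).hasFDerivAt

lemma hasFDerivAt_fderiv_fderiv (h : IsLocalIsometryOn φ G Ω G' Ω') (hy : y ∈ Ω) :
    HasFDerivAt (fderiv ℝ (fderiv ℝ φ)) (fderiv ℝ (fderiv ℝ (fderiv ℝ φ)) y) y :=
  (((h.fderiv_smooth.fderiv_of_isOpen h.metric.isOpen (by simp) :
    ContDiffOn ℝ ∞ _ Ω).contDiffAt (h.metric.isOpen.mem_nhds hy)).differentiableAt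
      (by simp)).hasFDerivAt

lemma second_symm (h : IsLocalIsometryOn φ G Ω G' Ω') (hy : y ∈ Ω) (u v : Model n) :
    fderiv ℝ (fderiv ℝ φ) y u v = fderiv ℝ (fderiv ℝ φ) y v u :=
  (h.contDiffAt hy).isSymmSndFDerivAt (by simp; exact WithTop.coe_le_coe.mpr le_top) u v

lemma third_symm (h : IsLocalIsometryOn φ G Ω G' Ω') (hy : y ∈ Ω) (u v w : Model n) :
    fderiv ℝ (fderiv ℝ (fderiv ℝ φ)) y u v w = fderiv ℝ (fderiv ℝ (fderiv ℝ φ)) y v u w := by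
  have := (h.fderiv_contDiffAt hy).isSymmSndFDerivAt (by simp; exact WithTop.coe_le_coe.mpr le_top) u v
  rw [this]

lemma fderiv_form (h : IsLocalIsometryOn φ G Ω G' Ω') (hy : y ∈ Ω) (w u v : Model n) :
    fderiv ℝ G y w u v = fderiv ℝ G' (φ y) (fderiv ℝ φ y w) (fderiv ℝ φ y u) (fderiv ℝ φ y v)
      + G' (φ y) (fderiv ℝ (fderiv ℝ φ) y w u) (fderiv ℝ φ y v)
      + G' (φ y) (fderiv ℝ φ y u) (fderiv ℝ (fderiv ℝ φ) y w v) := by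
  have d1 := ((h.metric.differentiableAt hy).hasFDerivAt.clm_apply
    (hasFDerivAt_const u y)).clm_apply (hasFDerivAt_const v y)
  have d2 := (((h.metric'.differentiableAt (h.mapsTo hy)).hasFDerivAt.comp y
    (h.hasFDerivAt hy)).clm_apply ((h.hasFDerivAt_fderiv hy).clm_apply
      (hasFDerivAt_const u y))).clm_apply ((h.hasFDerivAt_fderiv hy).clm_apply
        (hasFDerivAt_const v y))
  have h1 : (fun z => G z u v) =ᶠ[nhds y] fun z =>
      (G' ∘ φ) z (fderiv ℝ φ z u) (fderiv ℝ φ z v) :=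
    Set.EqOn.eventuallyEq_isOpen (fun z hz => h.form_eq z hz u v) h.metric.isOpen hy
  have h2 := congrArg (fun L => L w) (d1.unique (d2.congr_of_eventuallyEq h1))
  simp at h2
  rw [h2]
  ring

/-- Koszul's formula for the pulled-back metric produces six terms with second derivatives of `φ`;
by symmetry four cancel and the other two agree. -/
lemma christoffel_eq (h : IsLocalIsometryOn φ G Ω G' Ω') (hy : y ∈ Ω) (u v : Model n) :
    fderiv ℝ φ y (christoffel G y u v)
      = christoffel G' (φ y) (fderiv ℝ φ y u) (fderiv ℝ φ y v)
        + fderiv ℝ (fderiv ℝ φ) y u v := by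
  obtain ⟨e, he⟩ := h.exists_equiv hy
  refine h.metric'.ext (h.mapsTo hy) fun w' => ?_
  obtain ⟨w, rfl⟩ := e.surjective w'
  rw [he, ← h.form_eq y hy, h.metric.apply_christoffel hy, map_add, add_apply,
    h.metric'.apply_christoffel (h.mapsTo hy), h.fderiv_form hy, h.fderiv_form hy,
    h.fderiv_form hy, h.second_symm hy v u, h.second_symm hy w u, h.second_symm hy w v,
    h.metric'.symm _ (h.mapsTo hy) (fderiv ℝ φ y v),
    h.metric'.symm _ (h.mapsTo hy) (fderiv ℝ φ y u)]
  ring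

lemma fderiv_christoffel (h : IsLocalIsometryOn φ G Ω G' Ω') (hy : y ∈ Ω) (u v w : Model n) :
    fderiv ℝ (fderiv ℝ φ) y u (christoffel G y v w)
        + fderiv ℝ φ y (fderiv ℝ (christoffelMap G) y u v w)
      = fderiv ℝ (christoffelMap G') (φ y) (fderiv ℝ φ y u) (fderiv ℝ φ y v) (fderiv ℝ φ y w)
        + christoffel G' (φ y) (fderiv ℝ (fderiv ℝ φ) y u v) (fderiv ℝ φ y w)
        + christoffel G' (φ y) (fderiv ℝ φ y v) (fderiv ℝ (fderiv ℝ φ) y u w)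
        + fderiv ℝ (fderiv ℝ (fderiv ℝ φ)) y u v w := by
  have d1 := (h.hasFDerivAt_fderiv hy).clm_apply
    (((h.metric.christoffelMap_differentiableAt hy).hasFDerivAt.clm_apply
      (hasFDerivAt_const v y)).clm_apply (hasFDerivAt_const w y))
  have d2 := ((((h.metric'.christoffelMap_differentiableAt (h.mapsTo hy)).hasFDerivAt.comp y
    (h.hasFDerivAt hy)).clm_apply ((h.hasFDerivAt_fderiv hy).clm_apply
      (hasFDerivAt_const v y))).clm_apply ((h.hasFDerivAt_fderiv hy).clm_apply
        (hasFDerivAt_const w y))).add (((h.hasFDerivAt_fderiv_fderiv hy).clm_apply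
          (hasFDerivAt_const v y)).clm_apply (hasFDerivAt_const w y))
  have h1 := Set.EqOn.eventuallyEq_isOpen
    (fun z (hz : z ∈ Ω) => h.christoffel_eq hz v w) h.metric.isOpen hy
  have h2 := congrArg (fun L => L u) (d1.unique (d2.congr_of_eventuallyEq h1))
  simp [christoffelMap_apply] at h2
  rw [add_comm (fderiv ℝ (fderiv ℝ φ) y u (christoffel G y v w)), h2]
  abel

/-- Antisymmetrizing the differentiated transformation law of the Christoffel symbols removes the
third derivatives of `φ`. The second derivatives cancel against those from the quadratic terms. -/
lemma curvature_eq (h : IsLocalIsometryOn φ G Ω G' Ω') (hy : y ∈ Ω) (u v w : Model n) :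
    fderiv ℝ φ y (curvature G y u v w)
      = curvature G' (φ y) (fderiv ℝ φ y u) (fderiv ℝ φ y v) (fderiv ℝ φ y w) := by
  have h1 := h.fderiv_christoffel hy u v w
  have h2 := h.fderiv_christoffel hy v u w
  have h3 := h.christoffel_eq hy u (christoffel G y v w)
  have h4 := h.christoffel_eq hy v (christoffel G y u w)
  have h7 (a b d : Model n) : christoffel G' (φ y) a (b + d)
      = christoffel G' (φ y) a b + christoffel G' (φ y) a d :=
    map_add (christoffelMap G' (φ y) a) b d
  rw [h.christoffel_eq hy v w, h7] at h3
  rw [h.christoffel_eq hy u w, h7] at h4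
  rw [h.second_symm hy v u, h.third_symm hy v u] at h2
  rw [h.metric.curvature_eq hy, h.metric'.curvature_eq (h.mapsTo hy)]
  simp only [map_add, map_sub, christoffelMap_apply]
  rw [h3, h4]
  have h5 := eq_sub_of_add_eq' h1
  have h6 := eq_sub_of_add_eq' h2
  rw [h5, h6]
  abel

lemma ricci_eq (h : IsLocalIsometryOn φ G Ω G' Ω') (hy : y ∈ Ω) (v w : Model n) :
    ricci G y v w = ricci G' (φ y) (fderiv ℝ φ y v) (fderiv ℝ φ y w) := by
  obtain ⟨e, he⟩ := h.exists_equiv hy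
  obtain ⟨L, hL⟩ := h.metric.exists_curvatureEnd hy v w
  obtain ⟨L', hL'⟩ := h.metric'.exists_curvatureEnd (h.mapsTo hy) (fderiv ℝ φ y v)
    (fderiv ℝ φ y w)
  rw [IsMetricOn.ricci_eq_trace hL, IsMetricOn.ricci_eq_trace hL', ← LinearMap.trace_conj' L e]
  congr 1
  ext1 u'
  obtain ⟨u, rfl⟩ := e.surjective u'
  rw [LinearEquiv.conj_apply_apply, e.symm_apply_apply, hL, he, h.curvature_eq hy, hL', he]

lemma sharp_eq (h : IsLocalIsometryOn φ G Ω G' Ω') (hy : y ∈ Ω) {ξ ξ' : Model n →L[ℝ] ℝ}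
    (hξ : ∀ w, ξ w = ξ' (fderiv ℝ φ y w)) : fderiv ℝ φ y (sharp G y ξ) = sharp G' (φ y) ξ' := by
  obtain ⟨e, he⟩ := h.exists_equiv hy
  refine (h.metric'.sharp_eq (h.mapsTo hy) fun w' => ?_).symm
  obtain ⟨w, rfl⟩ := e.surjective w'
  rw [he, ← h.form_eq y hy, h.metric.apply_sharp hy, hξ]

lemma scalarCurvature_eq (h : IsLocalIsometryOn φ G Ω G' Ω') (hy : y ∈ Ω) :
    scalarCurvature G y = scalarCurvature G' (φ y) := by
  obtain ⟨e, he⟩ := h.exists_equiv hy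
  obtain ⟨B, hB⟩ := h.metric.exists_ricciForm hy
  obtain ⟨B', hB'⟩ := h.metric'.exists_ricciForm (h.mapsTo hy)
  let L : Model n →ₗ[ℝ] Model n := ((G y).inverse.comp B.flip).toLinearMap
  let L' : Model n →ₗ[ℝ] Model n := ((G' (φ y)).inverse.comp B'.flip).toLinearMap
  rw [IsMetricOn.scalarCurvature_eq_trace hB (L := L) fun v => rfl,
    IsMetricOn.scalarCurvature_eq_trace hB' (L := L') fun v => rfl, ← LinearMap.trace_conj' L e]
  congr 1
  ext1 u'
  obtain ⟨u, rfl⟩ := e.surjective u'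
  rw [LinearEquiv.conj_apply_apply, e.symm_apply_apply, he, he]
  exact h.sharp_eq hy fun w => by simp [hB, hB', h.ricci_eq hy]

lemma schouten_eq (h : IsLocalIsometryOn φ G Ω G' Ω') (hy : y ∈ Ω) (v w : Model n) :
    schouten G y v w = schouten G' (φ y) (fderiv ℝ φ y v) (fderiv ℝ φ y w) := by
  rw [schouten, schouten, h.ricci_eq hy, h.scalarCurvature_eq hy, h.form_eq y hy]

lemma schoutenVec_eq (h : IsLocalIsometryOn φ G Ω G' Ω') (hy : y ∈ Ω) (v : Model n) :
    fderiv ℝ φ y (schoutenVec G y v) = schoutenVec G' (φ y) (fderiv ℝ φ y v) := by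
  obtain ⟨e, he⟩ := h.exists_equiv hy
  refine h.metric'.ext (h.mapsTo hy) fun w' => ?_
  obtain ⟨w, rfl⟩ := e.surjective w'
  rw [he, ← h.form_eq y hy, h.metric.apply_schoutenVec hy,
    h.metric'.apply_schoutenVec (h.mapsTo hy), h.schouten_eq hy]

/-- The action of a local isometry on tractors. -/
noncomputable def tractorMap (φ : Model n → Model n) (y : Model n) (X : Tractor n) : Tractor n :=
  (X.1, fderiv ℝ φ y X.2.1, X.2.2)

lemma tractorForm_map (h : IsLocalIsometryOn φ G Ω G' Ω') (hy : y ∈ Ω) (X Y : Tractor n) :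
    tractorForm G' (φ y) (tractorMap φ y X) (tractorMap φ y Y) = tractorForm G y X Y := by
  simp only [tractorForm_apply, tractorMetric, tractorMap, h.form_eq y hy]

section curve

variable {c : ℝ → Model n} {J : Set ℝ} {r : ℕ}

lemma isCurveIn (h : IsLocalIsometryOn φ G Ω G' Ω') (hc : IsCurveIn G Ω c J) :
    IsCurveIn G' Ω' (fun t => φ (c t)) J :=
  ⟨h.metric', hc.isOpen, h.smooth.comp hc.smooth hc.mapsTo, fun _ ht => h.mapsTo (hc.mapsTo ht)⟩

lemma deriv_curve (h : IsLocalIsometryOn φ G Ω G' Ω') (hc : IsCurveIn G Ω c J) {t : ℝ}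
    (ht : t ∈ J) : deriv (fun t => φ (c t)) t = fderiv ℝ φ (c t) (deriv c t) :=
  ((h.hasFDerivAt (hc.mapsTo ht)).comp_hasDerivAt t
    (hc.smooth.differentiableAt_isOpen hc.isOpen ht).hasDerivAt).deriv

lemma covDeriv_eq (h : IsLocalIsometryOn φ G Ω G' Ω') (hc : IsCurveIn G Ω c J) {V : ℝ → Model n}
    (hV : ContDiffOn ℝ ∞ V J) {t : ℝ} (ht : t ∈ J) :
    covDeriv G' (fun t => φ (c t)) (fun t => fderiv ℝ φ (c t) (V t)) t
      = fderiv ℝ φ (c t) (covDeriv G c V t) := by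
  have hy := hc.mapsTo ht
  have d := ((h.hasFDerivAt_fderiv hy).comp_hasDerivAt t
    (hc.smooth.differentiableAt_isOpen hc.isOpen ht).hasDerivAt).clm_apply
      (hV.differentiableAt_isOpen hc.isOpen ht).hasDerivAt
  have d' : deriv (fun t => fderiv ℝ φ (c t) (V t)) t = _ := d.deriv
  simp only [covDeriv]
  rw [d', h.deriv_curve hc ht, map_add, h.christoffel_eq hy]
  simp only [Function.comp_apply]
  abel

lemma tractorDeriv_eq (h : IsLocalIsometryOn φ G Ω G' Ω') (hc : IsCurveIn G Ω c J)
    {X : ℝ → Tractor n} (hX : ContDiffOn ℝ ∞ X J) {t : ℝ} (ht : t ∈ J) :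
    tractorDeriv G' (fun t => φ (c t)) (fun t => tractorMap φ (c t) (X t)) t
      = tractorMap φ (c t) (tractorDeriv G c X t) := by
  have hy := hc.mapsTo ht
  simp only [tractorDeriv, tractorMap]
  rw [h.covDeriv_eq hc hX.snd.fst ht, h.deriv_curve hc ht, ← h.form_eq _ hy, ← h.schouten_eq hy,
    ← h.schoutenVec_eq hy]
  simp only [map_add, map_smul]

lemma derivedVector_eq (h : IsLocalIsometryOn φ G Ω G' Ω') (hc : IsCurveIn G Ω c J) (i : ℕ) {t : ℝ}
    (ht : t ∈ J) : derivedVector G' (fun t => φ (c t)) i t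
      = fderiv ℝ φ (c t) (derivedVector G c i t) :=
  hc.isConnectionOn_covDeriv.iterate_intertwine (h.isCurveIn hc).isConnectionOn_covDeriv
    (Φ := fun s v => fderiv ℝ φ (c s) v) (fun _ hX _ ht => h.covDeriv_eq hc hX ht)
    hc.velocity_smooth (fun _ ht => h.deriv_curve hc ht) i ht

lemma form_derivedVector (h : IsLocalIsometryOn φ G Ω G' Ω') (hc : IsCurveIn G Ω c J) (i j : ℕ)
    {t : ℝ} (ht : t ∈ J) : G' (φ (c t)) (derivedVector G' (fun t => φ (c t)) i t)
      (derivedVector G' (fun t => φ (c t)) j t)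
        = G (c t) (derivedVector G c i t) (derivedVector G c j t) := by
  rw [h.derivedVector_eq hc i ht, h.derivedVector_eq hc j ht, ← h.form_eq _ (hc.mapsTo ht)]

lemma derivedTractor_eq (h : IsLocalIsometryOn φ G Ω G' Ω') (hc : IsNullCurveIn r G Ω c J) (i : ℕ)
    {t : ℝ} (ht : t ∈ J) : derivedTractor r G' (fun t => φ (c t)) i t
      = tractorMap φ (c t) (derivedTractor r G c i t) :=
  hc.isConnectionOn_tractorDeriv.iterate_intertwine
    (h.isCurveIn hc.toIsCurveIn).isConnectionOn_tractorDeriv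
    (Φ := fun s X => tractorMap φ (c s) X)
    (fun _ hX _ ht => h.tractorDeriv_eq hc.toIsCurveIn hX ht) hc.tractorLift_smooth
    (fun t ht => by simp [tractorLift, tractorMap, h.form_derivedVector hc.toIsCurveIn r r ht]) i ht

end curve

end IsLocalIsometryOn

/-! ### Conformal changes of the metric -/

section

variable {n : ℕ}

/-- The gradient of a function. -/
noncomputable def gradVec (G : FormField n) (υ : Model n → ℝ) (y : Model n) : Model n :=
  sharp G y (fderiv ℝ υ y)

/-- The Hessian of a function. -/
noncomputable def hessForm (G : FormField n) (υ : Model n → ℝ) : FormField n := fun y =>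
  fderiv ℝ (fderiv ℝ υ) y -
    ((ContinuousLinearMap.compL ℝ (Model n) (Model n) ℝ) (fderiv ℝ υ y)).comp (christoffelMap G y)

/-- The change of the Schouten tensor under a conformal change of the metric. -/
noncomputable def schoutenChange (G : FormField n) (υ : Model n → ℝ) : FormField n := fun y =>
  hessForm G υ y - (fderiv ℝ υ y).smulRight (fderiv ℝ υ y)
    + (1 / 2 * fderiv ℝ υ y (gradVec G υ y)) • G y

lemma hessForm_apply (G : FormField n) (υ : Model n → ℝ) (y u v : Model n) : hessForm G υ y u v
    = fderiv ℝ (fderiv ℝ υ) y u v - fderiv ℝ υ y (christoffel G y u v) := rfl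

lemma schoutenChange_apply (G : FormField n) (υ : Model n → ℝ) (y u v : Model n) :
    schoutenChange G υ y u v = hessForm G υ y u v - fderiv ℝ υ y u * fderiv ℝ υ y v
      + 1 / 2 * fderiv ℝ υ y (gradVec G υ y) * G y u v := rfl

/-- The change of the splitting of the tractor bundle under a conformal change of the metric. -/
noncomputable def tractorChange (G : FormField n) (υ : Model n → ℝ) (y : Model n) (X : Tractor n) :
    Tractor n :=
  (Real.exp (υ y) * X.1, (Real.exp (υ y))⁻¹ • (X.2.1 + X.1 • gradVec G υ y),
    (Real.exp (υ y))⁻¹ * (X.2.2 - fderiv ℝ υ y X.2.1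
      - 1 / 2 * fderiv ℝ υ y (gradVec G υ y) * X.1))

end

/-- `G' = e^{2υ} G` on `Ω`. -/
structure IsConformalChangeOn {n : ℕ} (υ : Model n → ℝ) (G G' : FormField n)
    (Ω : Set (Model n)) : Prop where
  metric : IsMetricOn G Ω
  metric' : IsMetricOn G' Ω
  smooth : ContDiffOn ℝ ∞ υ Ω
  form_eq : ∀ y ∈ Ω, ∀ u v, G' y u v = Real.exp (υ y) ^ 2 * G y u v

namespace IsConformalChangeOn

variable {n : ℕ} {υ : Model n → ℝ} {G G' : FormField n} {Ω : Set (Model n)} {y : Model n}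

lemma contDiffAt (h : IsConformalChangeOn υ G G' Ω) (hy : y ∈ Ω) : ContDiffAt ℝ ∞ υ y :=
  h.smooth.contDiffAt (h.metric.isOpen.mem_nhds hy)

lemma hasFDerivAt (h : IsConformalChangeOn υ G G' Ω) (hy : y ∈ Ω) :
    HasFDerivAt υ (fderiv ℝ υ y) y :=
  ((h.contDiffAt hy).differentiableAt (by simp)).hasFDerivAt

lemma fderiv_smooth (h : IsConformalChangeOn υ G G' Ω) : ContDiffOn ℝ ∞ (fderiv ℝ υ) Ω :=
  h.smooth.fderiv_of_isOpen h.metric.isOpen (by simp)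

lemma hasFDerivAt_fderiv (h : IsConformalChangeOn υ G G' Ω) (hy : y ∈ Ω) :
    HasFDerivAt (fderiv ℝ υ) (fderiv ℝ (fderiv ℝ υ) y) y :=
  ((h.fderiv_smooth.contDiffAt (h.metric.isOpen.mem_nhds hy)).differentiableAt
    (by simp)).hasFDerivAt

lemma gradVec_smooth (h : IsConformalChangeOn υ G G' Ω) : ContDiffOn ℝ ∞ (gradVec G υ) Ω :=
  h.metric.inverse_smooth.clm_apply h.fderiv_smooth

lemma hasFDerivAt_gradVec (h : IsConformalChangeOn υ G G' Ω) (hy : y ∈ Ω) :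
    HasFDerivAt (gradVec G υ) (fderiv ℝ (gradVec G υ) y) y :=
  ((h.gradVec_smooth.contDiffAt (h.metric.isOpen.mem_nhds hy)).differentiableAt
    (by simp)).hasFDerivAt

lemma apply_gradVec (h : IsConformalChangeOn υ G G' Ω) (hy : y ∈ Ω) (v : Model n) :
    G y (gradVec G υ y) v = fderiv ℝ υ y v := by
  rw [gradVec, h.metric.apply_sharp hy]

lemma second_symm (h : IsConformalChangeOn υ G G' Ω) (hy : y ∈ Ω) (u v : Model n) :
    fderiv ℝ (fderiv ℝ υ) y u v = fderiv ℝ (fderiv ℝ υ) y v u :=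
  (h.contDiffAt hy).isSymmSndFDerivAt (by simp; exact WithTop.coe_le_coe.mpr le_top) u v

/-- Obtained by differentiating `⟨grad υ, w⟩ = dυ(w)` and using that the Levi-Civita connection is
metric. -/
lemma fderiv_gradVec (h : IsConformalChangeOn υ G G' Ω) (hy : y ∈ Ω) (u : Model n) :
    fderiv ℝ (gradVec G υ) y u
      = sharp G y (hessForm G υ y u) - christoffel G y u (gradVec G υ y) := by
  refine h.metric.ext hy fun w => ?_
  have d1 := ((h.metric.differentiableAt hy).hasFDerivAt.clm_apply
    (h.hasFDerivAt_gradVec hy)).clm_apply (hasFDerivAt_const w y)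
  have d2 := (h.hasFDerivAt_fderiv hy).clm_apply (hasFDerivAt_const w y)
  have h1 := congrArg (fun L => L u) ((d1.congr_of_eventuallyEq (Set.EqOn.eventuallyEq_isOpen
    (fun z hz => (h.apply_gradVec hz w).symm) h.metric.isOpen hy)).unique d2)
  simp at h1
  rw [h.metric.fderiv_eq hy, h.apply_gradVec hy] at h1
  rw [map_sub, sub_apply, h.metric.apply_sharp hy, hessForm_apply]
  linarith

lemma fderiv_form (h : IsConformalChangeOn υ G G' Ω) (hy : y ∈ Ω) (w u v : Model n) :
    fderiv ℝ G' y w u v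
      = Real.exp (υ y) ^ 2 * (2 * fderiv ℝ υ y w * G y u v + fderiv ℝ G y w u v) := by
  have d1 := ((h.metric'.differentiableAt hy).hasFDerivAt.clm_apply
    (hasFDerivAt_const u y)).clm_apply (hasFDerivAt_const v y)
  have d2 := ((h.hasFDerivAt hy).exp.pow 2).mul
    (((h.metric.differentiableAt hy).hasFDerivAt.clm_apply
      (hasFDerivAt_const u y)).clm_apply (hasFDerivAt_const v y))
  have h1 := congrArg (fun L => L w) (d1.unique (d2.congr_of_eventuallyEq
    (Set.EqOn.eventuallyEq_isOpen (fun z hz => h.form_eq z hz u v) h.metric.isOpen hy)))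
  simp at h1
  rw [h1]
  ring

lemma christoffel_eq (h : IsConformalChangeOn υ G G' Ω) (hy : y ∈ Ω) (u v : Model n) :
    christoffel G' y u v = christoffel G y u v + fderiv ℝ υ y u • v + fderiv ℝ υ y v • u
      - G y u v • gradVec G υ y := by
  refine h.metric'.ext hy fun w => ?_
  rw [h.metric'.apply_christoffel hy, h.form_eq y hy, h.fderiv_form hy, h.fderiv_form hy,
    h.fderiv_form hy]
  simp only [map_add, map_sub, map_smul, add_apply, sub_apply, smul_apply, smul_eq_mul,
    h.metric.apply_christoffel hy, h.apply_gradVec hy]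
  rw [h.metric.symm y hy u v]
  ring

lemma fderiv_christoffelMap (h : IsConformalChangeOn υ G G' Ω) (hy : y ∈ Ω) (u v w : Model n) :
    fderiv ℝ (christoffelMap G') y u v w = fderiv ℝ (christoffelMap G) y u v w
      + fderiv ℝ (fderiv ℝ υ) y u v • w + fderiv ℝ (fderiv ℝ υ) y u w • v
      - (G y (christoffel G y u v) w + G y v (christoffel G y u w)) • gradVec G υ y
      - G y v w • (sharp G y (hessForm G υ y u) - christoffel G y u (gradVec G υ y)) := by
  have cv := hasFDerivAt_const (𝕜 := ℝ) v y
  have cw := hasFDerivAt_const (𝕜 := ℝ) w y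
  have d1 := ((h.metric'.christoffelMap_differentiableAt hy).hasFDerivAt.clm_apply cv).clm_apply cw
  have d2 := ((((h.metric.christoffelMap_differentiableAt hy).hasFDerivAt.clm_apply cv).clm_apply
    cw).add (((h.hasFDerivAt_fderiv hy).clm_apply cv).smul cw)).add
      (((h.hasFDerivAt_fderiv hy).clm_apply cw).smul cv) |>.sub
        ((((h.metric.differentiableAt hy).hasFDerivAt.clm_apply cv).clm_apply cw).smul
          (h.hasFDerivAt_gradVec hy))
  have h1 := congrArg (fun L => L u) (d1.unique (d2.congr_of_eventuallyEq
    (Set.EqOn.eventuallyEq_isOpen (fun z hz => h.christoffel_eq hz v w) h.metric.isOpen hy)))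
  simp [-one_div] at h1
  rw [h1, h.fderiv_gradVec hy, h.metric.fderiv_eq hy]
  abel

/-- After pairing with an arbitrary vector, the second-order terms are Hessians of `υ` and the
quadratic ones complete them to `schoutenChange`; the remaining terms cancel by symmetry. -/
lemma curvature_eq (h : IsConformalChangeOn υ G G' Ω) (hy : y ∈ Ω) (u v w : Model n) :
    curvature G' y u v w = curvature G y u v w + schoutenChange G υ y u w • v
      - schoutenChange G υ y v w • u - G y v w • sharp G y (schoutenChange G υ y u)
      + G y u w • sharp G y (schoutenChange G υ y v) := by
  refine h.metric.ext hy fun x => ?_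
  have hchr := h.christoffel_eq hy
  rw [h.metric.curvature_eq hy, h.metric'.curvature_eq hy, h.fderiv_christoffelMap hy,
    h.fderiv_christoffelMap hy]
  simp only [christoffelMap_apply, hchr]
  simp only [← christoffelMap_apply, map_add, map_sub, map_smul, add_apply, sub_apply, smul_apply,
    smul_eq_mul, smul_add, smul_sub, h.metric.apply_sharp hy, h.apply_gradVec hy,
    schoutenChange_apply, h.metric.symm y hy _ (gradVec G υ y)]
  simp only [hessForm_apply, christoffelMap_apply]
  rw [h.metric.christoffel_symm hy v u, h.second_symm hy v u, h.metric.symm y hy v u]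
  ring

end IsConformalChangeOn

lemma sum_clm_coord {n : ℕ} (B : Model n →L[ℝ] Model n →L[ℝ] ℝ) (v w : Model n) :
    ∑ i, B (coordVec i) w * v i = B v w := by
  conv_rhs => rw [← sum_coord_smul v]
  simp [mul_comm]

namespace IsConformalChangeOn

variable {n : ℕ} {υ : Model n → ℝ} {G G' : FormField n} {Ω : Set (Model n)} {y : Model n}

/-- The trace of the change of the Schouten tensor. -/
noncomputable def schoutenChangeTrace (G : FormField n) (υ : Model n → ℝ) (y : Model n) : ℝ :=
  ∑ i : Fin n, sharp G y (schoutenChange G υ y (coordVec i)) i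

/-- In the trace over `u` the four correction terms contribute `1`, `-n` and `1` times the value of
`schoutenChange`, and minus its trace times the metric, hence the factor `n - 2`. -/
lemma ricci_eq (h : IsConformalChangeOn υ G G' Ω) (hy : y ∈ Ω) (v w : Model n) :
    ricci G' y v w = ricci G y v w - ((n : ℝ) - 2) * schoutenChange G υ y v w
      - schoutenChangeTrace G υ y * G y v w := by
  have h1 : G y (sharp G y (schoutenChange G υ y v)) w = schoutenChange G υ y v w := by
    rw [h.metric.apply_sharp hy]
  have h2 := sum_clm_coord (schoutenChange G υ y) v w
  have h3 := sum_clm_coord (G y) (sharp G y (schoutenChange G υ y v)) w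
  have h4 : ∑ i : Fin n, (coordVec i : Model n) i = n := by simp [coordVec]
  simp only [ricci, h.curvature_eq hy, PiLp.add_apply, PiLp.sub_apply, PiLp.smul_apply,
    smul_eq_mul, Finset.sum_add_distrib, Finset.sum_sub_distrib, ← Finset.mul_sum, h2, h3, h4, h1]
  rw [schoutenChangeTrace]
  ring

lemma sharp_eq (h : IsConformalChangeOn υ G G' Ω) (hy : y ∈ Ω) (ξ : Model n →L[ℝ] ℝ) :
    sharp G' y ξ = (Real.exp (υ y) ^ 2)⁻¹ • sharp G y ξ :=
  h.metric'.sharp_eq hy fun w => by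
    rw [h.form_eq y hy, map_smul, smul_apply, h.metric.apply_sharp hy, smul_eq_mul,
      mul_inv_cancel_left₀ (pow_ne_zero 2 (Real.exp_ne_zero _))]

lemma scalarCurvature_eq (h : IsConformalChangeOn υ G G' Ω) (hy : y ∈ Ω) :
    scalarCurvature G' y = (Real.exp (υ y) ^ 2)⁻¹ *
      (scalarCurvature G y - 2 * ((n : ℝ) - 1) * schoutenChangeTrace G υ y) := by
  have h1 : ∀ (B : Model n →L[ℝ] Model n →L[ℝ] ℝ), ∑ i : Fin n, ∑ j : Fin n,
      sharp G y (EuclideanSpace.proj i) j * B (coordVec i) (coordVec j)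
        = ∑ i, B (coordVec i) (sharp G y (EuclideanSpace.proj i)) := fun B =>
    Finset.sum_congr rfl fun i _ => by
      conv_rhs => rw [← sum_coord_smul (sharp G y (EuclideanSpace.proj i))]
      simp
  have h2 := h1 (G y)
  have h3 := h1 (schoutenChange G υ y)
  have h4 : ∀ i, schoutenChange G υ y (coordVec i) (sharp G y (EuclideanSpace.proj i))
      = sharp G y (schoutenChange G υ y (coordVec i)) i := fun i => by
    rw [← h.metric.apply_sharp hy (schoutenChange G υ y (coordVec i)),
      h.metric.apply_right_sharp hy, h.metric.apply_sharp hy]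
    rfl
  have h5 : ∀ i : Fin n, G y (coordVec i) (sharp G y (EuclideanSpace.proj i)) = 1 := fun i => by
    rw [h.metric.apply_right_sharp hy]; simp [coordVec]
  simp only [h5, Finset.sum_const, Finset.card_univ, Fintype.card_fin, nsmul_eq_mul, mul_one] at h2
  simp only [h4] at h3
  rw [← schoutenChangeTrace] at h3
  simp only [scalarCurvature, h.sharp_eq hy, h.ricci_eq hy, PiLp.smul_apply, smul_eq_mul, mul_sub,
    mul_assoc, Finset.sum_sub_distrib, ← Finset.mul_sum]
  have h6 : ∀ a : ℝ, ∀ B : Model n →L[ℝ] Model n →L[ℝ] ℝ, ∑ i : Fin n, ∑ j : Fin n,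
      sharp G y (EuclideanSpace.proj i) j * (a * B (coordVec i) (coordVec j))
        = a * ∑ i : Fin n, ∑ j : Fin n,
          sharp G y (EuclideanSpace.proj i) j * B (coordVec i) (coordVec j) := fun a B => by
    simp only [Finset.mul_sum]
    exact Finset.sum_congr rfl fun i _ => Finset.sum_congr rfl fun j _ => by ring
  rw [h6, h6, h2, h3]
  ring

/-- The scalar curvature term is chosen so that the trace part cancels. The assumption on `n` makes
both denominators nonzero. -/
lemma schouten_eq (hn : 3 ≤ n) (h : IsConformalChangeOn υ G G' Ω) (hy : y ∈ Ω) (v w : Model n) :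
    schouten G' y v w = schouten G y v w - schoutenChange G υ y v w := by
  have hn' : (3 : ℝ) ≤ n := by exact_mod_cast hn
  have h1 : (n : ℝ) - 2 ≠ 0 := by linarith
  have h2 : (n : ℝ) - 1 ≠ 0 := by linarith
  have h3 := Real.exp_ne_zero (υ y)
  rw [schouten, schouten, h.ricci_eq hy, h.scalarCurvature_eq hy, h.form_eq y hy]
  field_simp
  ring

lemma schoutenVec_eq (hn : 3 ≤ n) (h : IsConformalChangeOn υ G G' Ω) (hy : y ∈ Ω) (v : Model n) :
    schoutenVec G' y v = (Real.exp (υ y) ^ 2)⁻¹ •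
      (schoutenVec G y v - sharp G y (schoutenChange G υ y v)) := by
  refine h.metric'.ext hy fun w => ?_
  rw [h.metric'.apply_schoutenVec hy, h.schouten_eq hn hy, h.form_eq y hy, map_smul, smul_apply,
    map_sub, sub_apply, h.metric.apply_schoutenVec hy, h.metric.apply_sharp hy, smul_eq_mul,
    mul_inv_cancel_left₀ (pow_ne_zero 2 (Real.exp_ne_zero _))]

lemma tractorForm_change (h : IsConformalChangeOn υ G G' Ω) (hy : y ∈ Ω) (X Y : Tractor n) :
    tractorForm G' y (tractorChange G υ y X) (tractorChange G υ y Y) = tractorForm G y X Y := by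
  simp only [tractorForm_apply, tractorMetric, tractorChange, h.form_eq y hy, map_add, map_smul,
    add_apply, smul_apply, smul_eq_mul, h.apply_gradVec hy,
    h.metric.symm y hy _ (gradVec G υ y)]
  have h3 := Real.exp_ne_zero (υ y)
  field_simp
  ring

/-! ### Tractors and null curves under a conformal change -/

section curve

variable {c : ℝ → Model n} {J : Set ℝ} {r : ℕ}

lemma isCurveIn (h : IsConformalChangeOn υ G G' Ω) (hc : IsCurveIn G Ω c J) :
    IsCurveIn G' Ω c J :=
  ⟨h.metric', hc.isOpen, hc.smooth, hc.mapsTo⟩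

/-- This is the conformal invariance of the tractor connection. Derivatives of `grad υ` and `dυ` in
`tractorChange` produce the Hessian, which the changes of the Christoffel symbols and of the
Schouten tensor compensate slot by slot. -/
lemma tractorDeriv_eq (hn : 3 ≤ n) (h : IsConformalChangeOn υ G G' Ω) (hc : IsCurveIn G Ω c J)
    {X : ℝ → Tractor n} (hX : ContDiffOn ℝ ∞ X J) {t : ℝ} (ht : t ∈ J) :
    tractorDeriv G' c (fun t => tractorChange G υ (c t) (X t)) t
      = tractorChange G υ (c t) (tractorDeriv G c X t) := by
  have hy := hc.mapsTo ht
  have hexp := Real.exp_ne_zero (υ (c t))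
  have dc := (hc.smooth.differentiableAt_isOpen hc.isOpen ht).hasDerivAt
  have dσ := (hX.fst.differentiableAt_isOpen hc.isOpen ht).hasDerivAt
  have dμ := (hX.snd.fst.differentiableAt_isOpen hc.isOpen ht).hasDerivAt
  have dρ := (hX.snd.snd.differentiableAt_isOpen hc.isOpen ht).hasDerivAt
  have de := ((h.hasFDerivAt hy).comp_hasDerivAt t dc).exp
  have dei := de.inv hexp
  have dK := (h.hasFDerivAt_gradVec hy).comp_hasDerivAt t dc
  have dΥ := (h.hasFDerivAt_fderiv hy).comp_hasDerivAt t dc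
  have d1 := de.mul dσ
  have d2 := dei.smul (dμ.add (dσ.smul dK))
  have d3 := dei.mul ((dρ.sub (dΥ.clm_apply dμ)).sub (((dΥ.clm_apply dK).const_mul (1 / 2)).mul dσ))
  simp only [tractorDeriv, tractorChange, covDeriv]
  have e1 : deriv (fun t => Real.exp (υ (c t)) * (X t).1) t = _ := d1.deriv
  have e2 : deriv (fun t => (Real.exp (υ (c t)))⁻¹ • ((X t).2.1 + (X t).1 • gradVec G υ (c t))) t
    = _ := d2.deriv
  have e3 : deriv (fun t => (Real.exp (υ (c t)))⁻¹ * ((X t).2.2 - fderiv ℝ υ (c t) (X t).2.1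
    - 1 / 2 * fderiv ℝ υ (c t) (gradVec G υ (c t)) * (X t).1)) t = _ := d3.deriv
  rw [e1, e2, e3]
  simp only [Function.comp_apply, Pi.inv_apply, Pi.add_apply, Pi.sub_apply, Pi.mul_apply,
    Pi.smul_apply']
  clear e1 e2 e3 d1 d2 d3 dΥ dK dei de dρ dμ dσ
  generalize deriv (fun s => (X s).1) t = σ'
  generalize deriv (fun s => (X s).2.1) t = μ'
  generalize deriv (fun s => (X s).2.2) t = ρ'
  generalize deriv c t = U at *
  generalize X t = X at *
  obtain ⟨σ, μ, ρ⟩ := X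
  simp only
  rw [Prod.mk.injEq, Prod.mk.injEq]
  refine ⟨?_, ?_, ?_⟩
  · rw [h.form_eq _ hy]
    simp only [map_add, map_smul, smul_eq_mul, h.apply_gradVec hy,
      h.metric.symm _ hy U (gradVec G υ (c t))]
    field_simp
    ring
  · refine h.metric.ext hy fun w => ?_
    rw [h.christoffel_eq hy, h.schoutenVec_eq hn hy]
    simp only [← christoffelMap_apply, map_add, map_sub, map_smul, add_apply, sub_apply,
      smul_apply, smul_eq_mul, smul_add, smul_sub, h.metric.apply_sharp hy, h.apply_gradVec hy,
      schoutenChange_apply, h.fderiv_gradVec hy, h.metric.symm _ hy U (gradVec G υ (c t))]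
    field_simp
    ring
  · obtain ⟨P, hP⟩ := h.metric.exists_schoutenForm hy
    have h1 : fderiv ℝ υ (c t) (schoutenVec G (c t) U) = P U (gradVec G υ (c t)) := by
      rw [← h.apply_gradVec hy, h.metric.symm _ hy, h.metric.apply_schoutenVec hy, hP]
    have h2 : fderiv ℝ υ (c t) (sharp G (c t) (hessForm G υ (c t) U))
        = hessForm G υ (c t) U (gradVec G υ (c t)) := by
      rw [← h.apply_gradVec hy, h.metric.apply_right_sharp hy]
    rw [h.schouten_eq hn hy]
    simp only [← christoffelMap_apply, ← hP, map_add, map_sub, map_smul, smul_eq_mul, h1, h2,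
      schoutenChange_apply, h.fderiv_gradVec hy, h.metric.symm _ hy U (gradVec G υ (c t)),
      h.apply_gradVec hy]
    simp only [hessForm_apply, christoffelMap_apply]
    field_simp
    ring

lemma canonicalTractor_top (hn : 3 ≤ n) (h : IsConformalChangeOn υ G G' Ω)
    (hc : IsCurveIn G Ω c J) (j : ℕ) {t : ℝ} (ht : t ∈ J) :
    (canonicalTractor G' c j t).1 = Real.exp (υ (c t)) * ∑ i ∈ Finset.range (j + 1),
      chainCoeff 1 (fun t => Real.exp (υ (c t))) j i t * (canonicalTractor G c i t).1 := by
  have hD := hc.isConnectionOn_tractorDeriv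
  have hs : ContDiffOn ℝ ∞ (fun t => Real.exp (υ (c t))) J :=
    (h.smooth.comp hc.smooth hc.mapsTo).exp
  have h0 : ContDiffOn ℝ ∞ (fun t => Real.exp (υ (c t)) • canonicalTractor G c 0 t) J :=
    hs.smul (hc.canonicalTractor_smooth 0)
  have h1 := hD.iterate_intertwine (h.isCurveIn hc).isConnectionOn_tractorDeriv
    -- In the scale of `G'` the tractor `(0, 0, 1)` is the image of `e^υ (0, 0, 1)`, since the
    -- bottom slot is divided by `e^υ`.
    (Φ := fun s X => tractorChange G υ (c s) X) (fun _ hX _ ht => h.tractorDeriv_eq hn hc hX ht)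
    h0 (X' := fun _ => (0, 0, 1))
    (fun t _ => by simp [tractorChange, canonicalTractor, Real.exp_ne_zero]) j ht
  rw [canonicalTractor, h1, tractorChange, hD.eq_sum_chainCoeff hc.isOpen (w := 1) contDiffOn_const
    hs (Z := fun j => (tractorDeriv G c)^[j] _) (W := canonicalTractor G c)
    (fun j t _ => by rw [Function.iterate_succ_apply']) hc.canonicalTractor_smooth
    (fun i t _ => by rw [canonicalTractor_succ]; simp) (fun t _ => rfl) j ht]
  simp [Prod.fst_sum]

lemma canonicalTractor_vanish (hn : 3 ≤ n) (h : IsConformalChangeOn υ G G' Ω)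
    (hc : IsNullCurveIn r G Ω c J) {j : ℕ} (hj : j < 2 * (r + 1)) {t : ℝ} (ht : t ∈ J) :
    (canonicalTractor G' c j t).1 = 0 := by
  rw [h.canonicalTractor_top hn hc.toIsCurveIn j ht, Finset.sum_eq_zero, mul_zero]
  intro i hi
  rw [hc.canonicalTractor_vanish (by have := Finset.mem_range.mp hi; omega) ht, mul_zero]

lemma canonicalTractor_eq (hn : 3 ≤ n) (h : IsConformalChangeOn υ G G' Ω)
    (hc : IsNullCurveIn r G Ω c J) {t : ℝ} (ht : t ∈ J) :
    (canonicalTractor G' c (2 * (r + 1)) t).1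
      = Real.exp (υ (c t)) ^ 2 * (canonicalTractor G c (2 * (r + 1)) t).1 := by
  rw [h.canonicalTractor_top hn hc.toIsCurveIn _ ht, Finset.sum_range_succ, Finset.sum_eq_zero,
    chainCoeff_diag]
  · simp only [Pi.one_apply, one_pow]; ring
  · intro i hi
    rw [hc.canonicalTractor_vanish (Finset.mem_range.mp hi) ht, mul_zero]

/-- Null curves are conformally invariant. -/
theorem isNullCurveIn (hn : 3 ≤ n) (h : IsConformalChangeOn υ G G' Ω)
    (hc : IsNullCurveIn r G Ω c J) : IsNullCurveIn r G' Ω c J := by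
  refine (h.isCurveIn hc.toIsCurveIn).isNullCurveIn
    (fun j hj t ht => h.canonicalTractor_vanish hn hc hj ht) fun t ht => ?_
  rw [h.canonicalTractor_eq hn hc ht, hc.canonicalTractor_eq ht]
  exact mul_ne_zero (pow_ne_zero 2 (Real.exp_ne_zero _))
    (mul_ne_zero (pow_ne_zero _ (by norm_num)) (hc.not_null t ht))

/-- The norm of `U⁽ʳ⁾` is multiplied by `e^{2υ}`, so `u⁻¹` acquires exactly the factor `e^{-υ}` of
the bottom slot. -/
lemma tractorLift_eq (hn : 3 ≤ n) (h : IsConformalChangeOn υ G G' Ω)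
    (hc : IsNullCurveIn r G Ω c J) {t : ℝ} (ht : t ∈ J) :
    tractorLift r G' c t = tractorChange G υ (c t) (tractorLift r G c t) := by
  have h1 := h.canonicalTractor_eq hn hc ht
  rw [hc.canonicalTractor_eq ht, (h.isNullCurveIn hn hc).canonicalTractor_eq ht, mul_left_comm,
    mul_right_inj' (pow_ne_zero _ (by norm_num))] at h1
  simp only [tractorLift, tractorChange, h1, abs_mul, abs_pow, Real.abs_exp]
  rw [Real.sqrt_mul (by positivity), Real.sqrt_sq (Real.exp_pos _).le, mul_inv]
  simp

lemma tractorNorm_eq (hn : 3 ≤ n) (h : IsConformalChangeOn υ G G' Ω)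
    (hc : IsNullCurveIn r G Ω c J) (i : ℕ) {t : ℝ} (ht : t ∈ J) :
    tractorNorm r G' c i t = tractorNorm r G c i t := by
  have h1 := hc.isConnectionOn_tractorDeriv.iterate_intertwine
    (h.isCurveIn hc.toIsCurveIn).isConnectionOn_tractorDeriv
    (Φ := fun s X => tractorChange G υ (c s) X)
    (fun _ hX _ ht => h.tractorDeriv_eq hn hc.toIsCurveIn hX ht) hc.tractorLift_smooth
    (fun t ht => h.tractorLift_eq hn hc ht) i ht
  rw [tractorNorm, derivedTractor, h1, h.tractorForm_change (hc.mapsTo ht)]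
  rfl

/-- The invariant `Θ₄` does not depend on the metric in the conformal class. -/
theorem localTheta_eq (hn : 3 ≤ n) (h : IsConformalChangeOn υ G G' Ω)
    (hc : IsNullCurveIn r G Ω c J) {t : ℝ} (ht : t ∈ J) :
    localTheta r G' c t = localTheta r G c t := by
  have h1 : iteratedDeriv 2 (tractorNorm r G' c (r + 2)) t
      = iteratedDeriv 2 (tractorNorm r G c (r + 2)) t :=
    Filter.EventuallyEq.iteratedDeriv_eq 2 (Set.EqOn.eventuallyEq_isOpen
      (fun s hs => h.tractorNorm_eq hn hc _ hs) hc.isOpen ht)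
  simp only [localTheta, h1, h.tractorNorm_eq hn hc _ ht]

end curve

end IsConformalChangeOn

/-! ### Congruence in the curve -/

section

variable {n : ℕ} {G : FormField n} {c c' : ℝ → Model n} {J : Set ℝ}

/-- The curve in the preferred chart at `γ t` and its transport from another chart agree only near
`t`, so locality in the curve is needed. -/
lemma covDeriv_congr (hJ : IsOpen J) (hc : Set.EqOn c c' J) {V V' : ℝ → Model n}
    (hV : Set.EqOn V V' J) : Set.EqOn (covDeriv G c V) (covDeriv G c' V') J := fun t ht => by
  rw [covDeriv, covDeriv, (hV.eventuallyEq_isOpen hJ ht).deriv_eq,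
    (hc.eventuallyEq_isOpen hJ ht).deriv_eq, hc ht, hV ht]

lemma derivedVector_congr (hJ : IsOpen J) (hc : Set.EqOn c c' J) (i : ℕ) :
    Set.EqOn (derivedVector G c i) (derivedVector G c' i) J := by
  induction i with
  | zero => exact fun t ht => (hc.eventuallyEq_isOpen hJ ht).deriv_eq
  | succ i ih =>
    rw [derivedVector_succ, derivedVector_succ]
    exact covDeriv_congr hJ hc ih

lemma tractorDeriv_congr (hJ : IsOpen J) (hc : Set.EqOn c c' J) {X X' : ℝ → Tractor n}
    (hX : Set.EqOn X X' J) : Set.EqOn (tractorDeriv G c X) (tractorDeriv G c' X') J :=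
  fun t ht => by
    have h1 : Set.EqOn (fun s => (X s).1) (fun s => (X' s).1) J := fun s hs => by
      simp only [hX hs]
    have h2 : Set.EqOn (fun s => (X s).2.1) (fun s => (X' s).2.1) J := fun s hs => by
      simp only [hX hs]
    have h3 : Set.EqOn (fun s => (X s).2.2) (fun s => (X' s).2.2) J := fun s hs => by
      simp only [hX hs]
    simp only [tractorDeriv]
    rw [(h1.eventuallyEq_isOpen hJ ht).deriv_eq, (h3.eventuallyEq_isOpen hJ ht).deriv_eq,
      covDeriv_congr hJ hc h2 ht, (hc.eventuallyEq_isOpen hJ ht).deriv_eq, hX ht, hc ht]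

lemma derivedTractor_congr {r : ℕ} (hJ : IsOpen J) (hc : Set.EqOn c c' J) (i : ℕ) :
    Set.EqOn (derivedTractor r G c i) (derivedTractor r G c' i) J := by
  induction i with
  | zero =>
    intro t ht
    simp only [derivedTractor, Function.iterate_zero, id_eq, tractorLift,
      derivedVector_congr (G := G) hJ hc r ht, hc ht]
  | succ i ih =>
    rw [derivedTractor_succ, derivedTractor_succ]
    exact tractorDeriv_congr hJ hc ih

end

/-! ### Charts -/

section

variable {n : ℕ} {M : Type*} [TopologicalSpace M] [ChartedSpace (Model n) M]

lemma inChart_apply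
    (val : ∀ x : M, TangentSpace (𝓡 n) x →L[ℝ] TangentSpace (𝓡 n) x →L[ℝ] ℝ) (x : M)
    (y u v : Model n) : inChart val x y u v = val ((chartAt (Model n) x).symm y)
      (mfderiv (𝓡 n) (𝓡 n) (chartAt (Model n) x).symm y u)
      (mfderiv (𝓡 n) (𝓡 n) (chartAt (Model n) x).symm y v) := rfl

variable [IsManifold (𝓡 n) ∞ M]

lemma PseudoRiemannianMetric.isMetricOn (g : PseudoRiemannianMetric n M) (x : M) :
    IsMetricOn (inChart g.val x) (chartAt (Model n) x).target where
  isOpen := (chartAt (Model n) x).open_target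
  smooth := g.smooth x
  symm y _ u v := g.symm _ _ _
  nondegenerate y hy v hv := by
    have hd := mdifferentiable_chart (I := 𝓡 n) x
    have h1 := g.nondegenerate _ (mfderiv (𝓡 n) (𝓡 n) (chartAt (Model n) x).symm y v) fun w => by
      obtain ⟨u, rfl⟩ := hd.symm.mfderiv_surjective hy w
      exact hv u
    exact hd.symm.mfderiv_injective hy (h1.trans (map_zero _).symm)

/-- The change of charts. -/
noncomputable def chartTransition (n : ℕ) {M : Type*} [TopologicalSpace M]
    [ChartedSpace (Model n) M] (x x' : M) (y : Model n) : Model n :=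
  chartAt (Model n) x' ((chartAt (Model n) x).symm y)

/-- Both coordinate expressions are pullbacks of the same metric on `M`, and the differential of the
transition is the composite of the differentials of the charts. -/
lemma PseudoRiemannianMetric.isLocalIsometryOn (g : PseudoRiemannianMetric n M) (x x' : M) :
    IsLocalIsometryOn (chartTransition n x x') (inChart g.val x)
      ((chartAt (Model n) x).symm.trans (chartAt (Model n) x')).source (inChart g.val x')
      (chartAt (Model n) x').target := by
  set e := chartAt (Model n) x
  set e' := chartAt (Model n) x'
  have hsub : (e.symm.trans e').source ⊆ e.target := fun y hy => by
    simp at hy; exact hy.1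
  have hsrc : ∀ y ∈ (e.symm.trans e').source, e.symm y ∈ e'.source := fun y hy => by
    simp at hy; exact hy.2
  refine ⟨(g.isMetricOn x).mono (e.symm.trans e').open_source hsub, g.isMetricOn x', ?_,
    fun y hy => e'.map_source (hsrc y hy), fun y hy u v => ?_⟩
  · rw [← contMDiffOn_iff_contDiffOn]
    exact (contMDiffOn_chart (I := 𝓡 n) (n := ∞) (x := x')).comp
      ((contMDiffOn_chart_symm (I := 𝓡 n) (n := ∞) (x := x)).mono hsub) hsrc
  · have hd := mdifferentiable_chart (I := 𝓡 n) x
    have hd' := mdifferentiable_chart (I := 𝓡 n) x'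
    have h1 : fderiv ℝ (chartTransition n x x') y = (mfderiv (𝓡 n) (𝓡 n) e' (e.symm y)).comp
        (mfderiv (𝓡 n) (𝓡 n) e.symm y) := by
      rw [← mfderiv_eq_fderiv]
      exact mfderiv_comp y (hd'.mdifferentiableAt (hsrc y hy))
        (hd.mdifferentiableAt_symm (hsub hy))
    have h2 : ∀ w : Model n, mfderiv (𝓡 n) (𝓡 n) e'.symm (chartTransition n x x' y)
        (fderiv ℝ (chartTransition n x x') y w) = mfderiv (𝓡 n) (𝓡 n) e.symm y w := fun w => by
      rw [h1]
      exact congrArg (fun L => L (mfderiv (𝓡 n) (𝓡 n) e.symm y w))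
        (hd'.symm_comp_deriv (hsrc y hy))
    have h3 : e'.symm (chartTransition n x x' y) = e.symm y := e'.left_inv (hsrc y hy)
    rw [inChart_apply, inChart_apply]
    -- The tangent spaces depend on the base point, so the equality of base points is eliminated
    -- before the vectors are compared.
    have h4 : ∀ p q : M, p = q → ∀ a b : Model n, g.val p a b = g.val q a b := by
      rintro p _ rfl a b; rfl
    exact (h4 _ _ h3.symm _ _).trans (by rw [← h2 u, ← h2 v])

end

/-! ### Curves in a chart -/

section

variable {n r : ℕ} {M : Type*} [TopologicalSpace M] [ChartedSpace (Model n) M]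

/-- The curve `γ` lies, for parameters in `J`, in the domain of the preferred chart at `x`. -/
structure IsCurveInChart (g : PseudoRiemannianMetric n M) (x : M) (γ : ℝ → M) (J : Set ℝ) :
    Prop where
  curve : IsCurveIn (inChart g.val x) (chartAt (Model n) x).target
    (fun s => chartAt (Model n) x (γ s)) J
  mapsTo : Set.MapsTo γ J (chartAt (Model n) x).source

/-- The pairing `⟨T⁽ⁱ⁾, T⁽ʲ⁾⟩` of the derived tractors. -/
noncomputable def gramAt (r : ℕ) (g : PseudoRiemannianMetric n M) (γ : ℝ → M) (i j : ℕ) (t : ℝ) :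
    ℝ :=
  tractorMetricAt g γ t (tractorAt r g γ i t) (tractorAt r g γ j t)

namespace IsCurveInChart

variable {g : PseudoRiemannianMetric n M} {x : M} {γ : ℝ → M} {J : Set ℝ}

lemma continuousOn (h : IsCurveInChart g x γ J) : ContinuousOn γ J :=
  ((chartAt (Model n) x).continuousOn_symm.comp h.curve.smooth.continuousOn h.curve.mapsTo).congr
    fun _ ht => ((chartAt (Model n) x).left_inv (h.mapsTo ht)).symm

variable [IsManifold (𝓡 n) ∞ M]

/-- The parameters near `t` for which the curve lies also in the preferred chart at `γ t`. -/
lemma exists_transition (h : IsCurveInChart g x γ J) {t : ℝ} (ht : t ∈ J) : ∃ J' ⊆ J, t ∈ J' ∧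
    IsCurveIn (inChart g.val x)
      ((chartAt (Model n) x).symm.trans (chartAt (Model n) (γ t))).source
      (fun s => chartAt (Model n) x (γ s)) J' ∧
    Set.EqOn (curveInChart γ t)
      (fun s => chartTransition n x (γ t) (chartAt (Model n) x (γ s))) J' := by
  have hleft : ∀ s ∈ J, (chartAt (Model n) x).symm (chartAt (Model n) x (γ s)) = γ s :=
    fun s hs => (chartAt (Model n) x).left_inv (h.mapsTo hs)
  refine ⟨J ∩ γ ⁻¹' (chartAt (Model n) (γ t)).source, Set.inter_subset_left,
    ⟨ht, mem_chart_source _ _⟩, ⟨(g.isLocalIsometryOn x (γ t)).metric,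
      h.continuousOn.isOpen_inter_preimage h.curve.isOpen (chartAt (Model n) (γ t)).open_source,
      h.curve.smooth.mono Set.inter_subset_left, fun s hs => ?_⟩, fun s hs => ?_⟩
  · simp only [OpenPartialHomeomorph.trans_source, OpenPartialHomeomorph.symm_source]
    refine ⟨h.curve.mapsTo hs.1, ?_⟩
    rw [Set.mem_preimage, hleft s hs.1]
    exact hs.2
  · simp only [chartTransition, hleft s hs.1, curveInChart]

lemma metricAt_eq (h : IsCurveInChart g x γ J) (i j : ℕ) {t : ℝ} (ht : t ∈ J) :
    metricAt g γ t (derivedVectorAt g γ i t) (derivedVectorAt g γ j t)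
      = inChart g.val x (chartAt (Model n) x (γ t))
        (derivedVector (inChart g.val x) (fun s => chartAt (Model n) x (γ s)) i t)
        (derivedVector (inChart g.val x) (fun s => chartAt (Model n) x (γ s)) j t) := by
  obtain ⟨J', -, ht', hc, hγ⟩ := h.exists_transition ht
  rw [metricAt, derivedVectorAt, derivedVectorAt, derivedVector_congr hc.isOpen hγ i ht',
    derivedVector_congr hc.isOpen hγ j ht', hγ ht']
  exact (g.isLocalIsometryOn x (γ t)).form_derivedVector hc i j ht'

/-- The left-hand side uses a chart that varies with `t`, the right-hand side a fixed one. Only the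
latter expression can be differentiated directly. -/
lemma gramAt_eq (h : IsCurveInChart g x γ J)
    (hc : IsNullCurveIn r (inChart g.val x) (chartAt (Model n) x).target
      (fun s => chartAt (Model n) x (γ s)) J) (i j : ℕ) {t : ℝ} (ht : t ∈ J) :
    gramAt r g γ i j t = tractorForm (inChart g.val x) (chartAt (Model n) x (γ t))
        (derivedTractor r (inChart g.val x) (fun s => chartAt (Model n) x (γ s)) i t)
        (derivedTractor r (inChart g.val x) (fun s => chartAt (Model n) x (γ s)) j t) := by
  obtain ⟨J', hJ', ht', hc', hγ⟩ := h.exists_transition ht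
  have hc'' : IsNullCurveIn r (inChart g.val x) _ (fun s => chartAt (Model n) x (γ s)) J' :=
    ⟨hc', fun i hi t ht => hc.null i hi t (hJ' ht), fun t ht => hc.not_null t (hJ' ht)⟩
  have hφ := g.isLocalIsometryOn x (γ t)
  rw [gramAt, tractorMetricAt, tractorAt, tractorAt, derivedTractor_congr hc'.isOpen hγ i ht',
    derivedTractor_congr hc'.isOpen hγ j ht', hγ ht', hφ.derivedTractor_eq hc'' i ht',
    hφ.derivedTractor_eq hc'' j ht', ← tractorForm_apply]
  exact hφ.tractorForm_map (hc'.mapsTo ht') _ _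

lemma thetaFour_eq (h : IsCurveInChart g x γ J)
    (hc : IsNullCurveIn r (inChart g.val x) (chartAt (Model n) x).target
      (fun s => chartAt (Model n) x (γ s)) J) {t : ℝ} (ht : t ∈ J) :
    thetaFour r g γ t
      = localTheta r (inChart g.val x) (fun s => chartAt (Model n) x (γ s)) t := by
  have h1 : ∀ i, ∀ s ∈ J, tractorMetricAt g γ s (tractorAt r g γ i s) (tractorAt r g γ i s)
      = tractorNorm r (inChart g.val x) (fun s => chartAt (Model n) x (γ s)) i s :=
    fun i s hs => h.gramAt_eq hc i i hs
  have h2 : iteratedDeriv 2 (nullAlpha r g γ) t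
      = iteratedDeriv 2 (tractorNorm r (inChart g.val x)
        (fun s => chartAt (Model n) x (γ s)) (r + 2)) t :=
    Filter.EventuallyEq.iteratedDeriv_eq 2 (Set.EqOn.eventuallyEq_isOpen
      (fun s hs => h1 (r + 2) s hs) hc.isOpen ht)
  rw [thetaFour, localTheta, h2, nullEpsilon, nullAlpha, nullBeta, h1 _ t ht, h1 _ t ht,
    h1 _ t ht]

end IsCurveInChart

namespace IsNullCurve

variable [IsManifold (𝓡 n) ∞ M] {g : PseudoRiemannianMetric n M} {γ : ℝ → M} {I : Set ℝ}

/-- Every parameter has a neighbourhood for which the curve is a null curve in a chart. -/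
lemma exists_chart (h : IsNullCurve r g γ I) {t : ℝ} (ht : t ∈ I) : ∃ J ⊆ I, t ∈ J ∧
    IsCurveInChart g (γ t) γ J ∧
    IsNullCurveIn r (inChart g.val (γ t)) (chartAt (Model n) (γ t)).target
      (fun s => chartAt (Model n) (γ t) (γ s)) J := by
  have hm : Set.MapsTo γ (I ∩ γ ⁻¹' (chartAt (Model n) (γ t)).source)
    (chartAt (Model n) (γ t)).source := fun s hs => hs.2
  have hc : IsCurveInChart g (γ t) γ (I ∩ γ ⁻¹' (chartAt (Model n) (γ t)).source) :=
    ⟨⟨g.isMetricOn (γ t), h.smooth.continuousOn.isOpen_inter_preimage h.isOpen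
        (chartAt (Model n) (γ t)).open_source,
      contMDiffOn_iff_contDiffOn.mp ((contMDiffOn_chart (I := 𝓡 n) (n := ∞) (x := γ t)).comp
        (h.smooth.mono Set.inter_subset_left) hm),
      fun s hs => (chartAt (Model n) (γ t)).map_source (hm hs)⟩, hm⟩
  refine ⟨I ∩ γ ⁻¹' (chartAt (Model n) (γ t)).source, Set.inter_subset_left,
    ⟨ht, mem_chart_source _ _⟩, hc, hc.curve, fun i hi s hs => ?_, fun s hs => ?_⟩
  · rw [← hc.metricAt_eq i i hs]
    exact h.null s hs.1 i hi
  · rw [← hc.metricAt_eq r r hs]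
    exact h.not_null s hs.1

lemma gramAt_smooth (h : IsNullCurve r g γ I) (i j : ℕ) : ContDiffOn ℝ ∞ (gramAt r g γ i j) I := by
  intro t ht
  obtain ⟨J, hJ, htJ, hc, hn⟩ := h.exists_chart ht
  exact (((hn.gram_smooth i j).congr fun s hs => hc.gramAt_eq hn i j hs).contDiffAt
    (hn.isOpen.mem_nhds htJ)).contDiffWithinAt

/-- The Gram matrix of the derived tractors of a null curve. -/
theorem isGramSystem (h : IsNullCurve r g γ I) : IsGramSystem I (r + 1) 1 (gramAt r g γ) where
  isOpen := h.isOpen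
  symm i j t ht := by
    obtain ⟨J, hJ, htJ, hc, hn⟩ := h.exists_chart ht
    rw [hc.gramAt_eq hn i j htJ, hc.gramAt_eq hn j i htJ]
    exact hn.isGramSystem.symm i j t htJ
  hasDerivAt i j t ht := by
    obtain ⟨J, hJ, htJ, hc, hn⟩ := h.exists_chart ht
    rw [hc.gramAt_eq hn _ _ htJ, hc.gramAt_eq hn _ _ htJ]
    exact (hn.isGramSystem.hasDerivAt i j t htJ).congr_of_eventuallyEq
      (Set.EqOn.eventuallyEq_isOpen (fun s hs => hc.gramAt_eq hn i j hs) hn.isOpen htJ)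
  ne_zero := by simp
  vanish_zero j hj t ht := by
    obtain ⟨J, hJ, htJ, hc, hn⟩ := h.exists_chart ht
    rw [hc.gramAt_eq hn _ _ htJ]
    exact hn.isGramSystem.vanish_zero j hj t htJ

lemma gramAt_ne_zero (h : IsNullCurve r g γ I) {t : ℝ} (ht : t ∈ I) :
    gramAt r g γ 0 (2 * (r + 1)) t ≠ 0 := by
  obtain ⟨J, hJ, htJ, hc, hn⟩ := h.exists_chart ht
  rw [hc.gramAt_eq hn _ _ htJ]
  exact hn.gram_ne_zero htJ

lemma gramAt_succ_eq_zero (h : IsNullCurve r g γ I) {t : ℝ} (ht : t ∈ I) :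
    gramAt r g γ (2 * (r + 1) + 1) 0 t = 0 := by
  obtain ⟨J, hJ, htJ, hc, hn⟩ := h.exists_chart ht
  rw [h.isGramSystem.symm _ _ t ht, hc.gramAt_eq hn _ _ htJ]
  exact hn.isGramSystem.level_one (fun _ ht => hn.hasDerivAt_gram ht) 0 _ (by ring) t htJ

end IsNullCurve

/-! ### Invariance -/

/-- A conformal change in a chart. -/
lemma ConformallyEquivalent.exists_isConformalChangeOn [IsManifold (𝓡 n) ∞ M]
    {g g' : PseudoRiemannianMetric n M} (h : ConformallyEquivalent g g') (x : M) :
    ∃ υ, IsConformalChangeOn υ (inChart g.val x) (inChart g'.val x)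
      (chartAt (Model n) x).target := by
  obtain ⟨f, hf, hpos, hfg⟩ := h
  have h1 : ContDiffOn ℝ ∞ (fun y => f ((chartAt (Model n) x).symm y))
      (chartAt (Model n) x).target :=
    contMDiffOn_iff_contDiffOn.mp
      (hf.comp_contMDiffOn (contMDiffOn_chart_symm (I := 𝓡 n) (n := ∞) (x := x)))
  refine ⟨fun y => Real.log (f ((chartAt (Model n) x).symm y)) / 2, g.isMetricOn x,
    g'.isMetricOn x, (h1.log fun y _ => (hpos _).ne').div_const 2, fun y _ u v => ?_⟩
  rw [← Real.exp_nat_mul, Nat.cast_ofNat, mul_div_cancel₀ _ two_ne_zero, Real.exp_log (hpos _)]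
  exact hfg _ _ _

/-- `Θ₄` is a relative conformal invariant of weight `4`. -/
theorem IsNullCurve.isRelativeConformalInvariant [IsManifold (𝓡 n) ∞ M] (hn : 3 ≤ n)
    {g : PseudoRiemannianMetric n M} {γ : ℝ → M} {I : Set ℝ} (h : IsNullCurve r g γ I) :
    IsRelativeConformalInvariant 4 (thetaFour r) g γ I := by
  intro g' hg ψ γ' hψ hψ' hγ t ht
  have hinj : Set.InjOn ψ I := by
    -- By Rolle's theorem, equal values at two points of the interval would give a zero of `ψ'`.
    have key : ∀ a ∈ I, ∀ b ∈ I, a < b → ψ a ≠ ψ b := fun a ha b hb hab heq => by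
      obtain ⟨s, hs, hs'⟩ := exists_deriv_eq_zero hab
        (hψ.continuousOn.mono (h.ordConnected.out ha hb)) heq
      exact hψ' s (h.ordConnected.out ha hb (Set.Ioo_subset_Icc_self hs)) hs'
    intro a ha b hb heq
    rcases lt_trichotomy a b with hab | hab | hab
    · exact absurd heq (key a ha b hb hab)
    · exact hab
    · exact absurd heq.symm (key b hb a ha hab)
  obtain ⟨J, hJ, htJ, hc, hN⟩ := h.exists_chart ht
  obtain ⟨υ, hυ⟩ := hg.exists_isConformalChangeOn (γ t)
  have hN' := hυ.isNullCurveIn hn hN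
  have hR : IsReparametrizationOn ψ (fun s => chartAt (Model n) (γ t) (γ s))
      (fun s => chartAt (Model n) (γ t) (γ' s)) J :=
    ⟨hψ.mono hJ, fun s hs => hψ' s (hJ hs), hinj.mono hJ, fun s hs => by simp only [hγ s (hJ hs)]⟩
  have hN'' := hR.isNullCurveIn hN'
  have hc'' : IsCurveInChart g' (γ t) γ' (ψ '' J) := ⟨hN''.toIsCurveIn, by
    rintro _ ⟨s, hs, rfl⟩
    rw [hγ s (hJ hs)]
    exact hc.mapsTo hs⟩
  rw [hc''.thetaFour_eq hN'' (Set.mem_image_of_mem ψ htJ), hc.thetaFour_eq hN htJ,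
    ← hυ.localTheta_eq hn hN htJ, hR.localTheta_eq hN' htJ,
    inv_mul_cancel_left₀ (pow_ne_zero 4 (hψ' t ht))]

end

/-! ### The tractor equation -/

section

variable {n r : ℕ} {M : Type*} [TopologicalSpace M] [ChartedSpace (Model n) M]
  {g : PseudoRiemannianMetric n M} {γ : ℝ → M} {I : Set ℝ}

lemma tractorMetricAt_eq (g : PseudoRiemannianMetric n M) (γ : ℝ → M) (t : ℝ) (X Y : Tractor n) :
    tractorMetricAt g γ t X Y = tractorForm (inChart g.val (γ t)) (curveInChart γ t t) X Y := rfl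

lemma isTractorODECoeff_iff (t : ℝ) (c : ℕ → ℝ) : IsTractorODECoeff r g γ t c ↔
    ∀ j < 2 * r + 3, gramAt r g γ (2 * r + 3) j t
      + ∑ i ∈ Finset.range (2 * r + 3), c i * gramAt r g γ i j t = 0 := by
  simp only [IsTractorODECoeff, tractorOperatorAt, gramAt, tractorMetricAt_eq, map_add,
    LinearMap.add_apply, map_sum, map_smul, LinearMap.sum_apply, LinearMap.smul_apply, smul_eq_mul]

namespace IsNullCurve

variable [IsManifold (𝓡 n) ∞ M]

lemma det_gramAt_ne_zero (h : IsNullCurve r g γ I) {t : ℝ} (ht : t ∈ I) :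
    (Matrix.of fun j i : Fin (2 * r + 3) => gramAt r g γ i j t).det ≠ 0 :=
  h.isGramSystem.det_ne_zero ht (h.gramAt_ne_zero ht)

lemma linearIndependent_tractorAt (h : IsNullCurve r g γ I) {t : ℝ} (ht : t ∈ I) :
    LinearIndependent ℝ (fun i : Fin (2 * r + 3) => tractorAt r g γ i t) := by
  rw [Fintype.linearIndependent_iff]
  intro a ha i
  refine congrFun (Matrix.eq_zero_of_mulVec_eq_zero (h.det_gramAt_ne_zero ht) (v := a) ?_) i
  ext j
  have h1 := congrArg (fun X => tractorMetricAt g γ t X (tractorAt r g γ j t)) ha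
  simp only [tractorMetricAt_eq, map_sum, map_smul, LinearMap.sum_apply, LinearMap.smul_apply,
    smul_eq_mul, map_zero, LinearMap.zero_apply] at h1
  simp only [Matrix.mulVec, dotProduct, Matrix.of_apply, gramAt, tractorMetricAt_eq, Pi.zero_apply,
    mul_comm _ (a _)]
  exact h1

lemma tractorOperatorAt_eq_zero (h : IsNullCurve r g γ I) {t : ℝ} (ht : t ∈ I) {q : ℕ → ℝ}
    (hq : ∀ c : ℕ → ℝ, IsTractorODECoeff r g γ t c ↔ ∀ i < 2 * r + 3, c i = q i)
    (hdep : ¬ LinearIndependent ℝ (fun i : Fin (2 * r + 4) => tractorAt r g γ i t)) :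
    tractorOperatorAt r g γ t q = 0 := by
  rw [linearIndependent_finSucc'] at hdep
  have h1 : tractorAt r g γ (2 * r + 3) t ∈
      Submodule.span ℝ (Set.range fun i : Fin (2 * r + 3) => tractorAt r g γ i t) := by
    by_contra h1
    exact hdep ⟨h.linearIndependent_tractorAt ht, h1⟩
  obtain ⟨a, ha⟩ := (Submodule.mem_span_range_iff_exists_fun ℝ).mp h1
  -- A linear relation expressing `T⁽²ʳ⁺³⁾` makes the operator zero, in particular orthogonal to
  -- everything, so its coefficients must be the `q i`.
  have h2 : ∀ c : ℕ → ℝ, (∀ i : Fin (2 * r + 3), c i = -a i) →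
      tractorOperatorAt r g γ t c = 0 := fun c hc => by
    rw [tractorOperatorAt, ← ha, Finset.sum_range]
    simp [hc]
  let c : ℕ → ℝ := fun i => if hi : i < 2 * r + 3 then -a ⟨i, hi⟩ else 0
  have hc : ∀ i : Fin (2 * r + 3), c i = -a i := fun i => by simp [c]
  have h3 := (hq c).mp fun j _ => by
    rw [h2 c hc, tractorMetricAt_eq, map_zero, LinearMap.zero_apply]
  exact h2 q fun i => by rw [← h3 i i.2, hc]

/-- Pairing the operator with `T` leaves only the two highest terms; the leading one vanishes
because `h_{0,2N}` is locally constant. -/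
lemma coeff_eq_zero (h : IsNullCurve r g γ I) {t : ℝ} (ht : t ∈ I) {q : ℕ → ℝ}
    (hq : ∀ c : ℕ → ℝ, IsTractorODECoeff r g γ t c ↔ ∀ i < 2 * r + 3, c i = q i) :
    q (2 * (r + 1)) = 0 := by
  have h1 := (isTractorODECoeff_iff t q).mp ((hq q).mpr fun _ _ => rfl) 0 (by omega)
  have h2 := h.gramAt_succ_eq_zero ht
  rw [show 2 * r + 3 = 2 * (r + 1) + 1 by ring, h2, zero_add, Finset.sum_range_succ,
    Finset.sum_eq_zero, zero_add, h.isGramSystem.symm _ _ t ht] at h1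
  · exact (mul_eq_zero.mp h1).resolve_right (h.gramAt_ne_zero ht)
  · intro i hi
    rw [h.isGramSystem.symm _ _ t ht, h.isGramSystem.vanish_zero i (Finset.mem_range.mp hi) t ht,
      mul_zero]

/-- The Wilczynski invariants of the equation of a null curve. -/
theorem canonicalInvariant_eq (h : IsNullCurve r g γ I) {q : ℕ → ℝ → ℝ}
    (hq : ∀ t ∈ I, ∀ c : ℕ → ℝ, IsTractorODECoeff r g γ t c ↔ ∀ i < 2 * r + 3, c i = q i t)
    {J : Set ℝ} {φ μ : ℝ → ℝ} {p : ℕ → ℝ → ℝ}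
    (H : IsLaguerreForsythForm (2 * r + 3) q J φ μ p) {t : ℝ} (ht : t ∈ I) (htJ : t ∈ J) :
    deriv φ t ^ 3 * canonicalInvariant (2 * r + 3) 3 p (φ t) = 0 ∧
    (1 ≤ r → deriv φ t ^ 4 * canonicalInvariant (2 * r + 3) 4 p (φ t) = thetaFour r g γ t) ∧
    (1 ≤ r → deriv φ t ^ 5 * canonicalInvariant (2 * r + 3) 5 p (φ t) = 0) := by
  obtain ⟨K, hK, htK, hc, hn⟩ := h.exists_chart ht
  -- The canonical form is restricted to parameters for which the curve lies in one chart.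
  have hJK : IsOpen (J ∩ K) := H.isOpen.inter hn.isOpen
  have hn' := hn.mono' hJK Set.inter_subset_right
  have H' := H.mono hJK Set.inter_subset_left
  have sA := hn'.gram_smooth 0 (2 * (r + 1) + 2)
  have ha₁ := fun (t : ℝ) (ht : t ∈ J ∩ K) => (sA.differentiableAt_isOpen hJK ht).hasDerivAt
  have ha₂ := fun (t : ℝ) (ht : t ∈ J ∩ K) =>
    ((sA.deriv_isOpen hJK).differentiableAt_isOpen hJK ht).hasDerivAt
  have key := _root_.canonicalInvariant_eq hn'.isMetricConnectionOn_tractorDeriv (N := r + 1) hJK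
    hn'.tractorLift_smooth (by omega) (fun j hj t ht => hn'.isGramSystem.vanish_zero j hj t ht)
    (fun t ht => hn'.gram_ne_zero ht) (fun t ht => hn'.hasDerivAt_gram ht) ha₁ ha₂
    (fun s hs j hj => ?_) H' ⟨htJ, htK⟩
  · rw [hc.thetaFour_eq hn htK, hn'.localTheta_eq ha₁ ha₂ ⟨htJ, htK⟩]
    exact ⟨key.1, fun hr => key.2.1 (by omega), fun hr => key.2.2 (by omega)⟩
  · have h1 := (isTractorODECoeff_iff s _).mp ((hq s (hK hs.2) fun i => q i s).mpr
      fun _ _ => rfl) j hj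
    simp only [hc.gramAt_eq hn _ _ hs.2] at h1
    rw [Finset.sum_range_succ, add_comm, monicCoeff, if_pos rfl, one_mul, ← h1]
    congr 1
    refine Finset.sum_congr rfl fun i hi => ?_
    rw [monicCoeff, if_neg (by have := Finset.mem_range.mp hi; omega)]
    rfl

/-- Every canonical form gives the value `a`, which yields independence of the choice; the existence
of one canonical form gives the converse. -/
lemma isWilczynskiInvariant_iff (h : IsNullCurve r g γ I) {q : ℕ → ℝ → ℝ}
    (hs : ∀ i < 2 * r + 3, ContDiffOn ℝ ∞ (q i) I)
    (hq : ∀ t ∈ I, ∀ c : ℕ → ℝ, IsTractorODECoeff r g γ t c ↔ ∀ i < 2 * r + 3, c i = q i t)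
    {t : ℝ} (ht : t ∈ I) {m : ℕ} {a : ℝ}
    (ha : ∀ J φ μ p, IsLaguerreForsythForm (2 * r + 3) q J φ μ p → t ∈ J →
      deriv φ t ^ m * canonicalInvariant (2 * r + 3) m p (φ t) = a) (θ : ℝ) :
    IsWilczynskiInvariant (2 * r + 3) q m t θ ↔ θ = a := by
  constructor
  · rintro ⟨J, φ, μ, p, htJ, H, rfl⟩
    exact ha J φ μ p H htJ
  · rintro rfl
    obtain ⟨J, φ, μ, p, htJ, -, H⟩ := exists_isLaguerreForsythForm (N := r + 1) (by omega) h.isOpen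
      hs (fun t ht => h.coeff_eq_zero ht (hq t ht)) ht
    exact ⟨J, φ, μ, p, htJ, H, (ha J φ μ p H htJ).symm⟩

end IsNullCurve

end

theorem mainTheorem5 {n : ℕ} (hn : 3 ≤ n) {M : Type*} [TopologicalSpace M]
    [ChartedSpace (Model n) M] [IsManifold (𝓡 n) ∞ M]
    (g : PseudoRiemannianMetric n M) (r : ℕ) (γ : ℝ → M) (I : Set ℝ) (hγ : IsNullCurve r g γ I) :
    (∃ q : ℕ → ℝ → ℝ,
      (∀ i < 2 * r + 3, ContDiffOn ℝ ∞ (q i) I) ∧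
      (∀ t ∈ I, ∀ c : ℕ → ℝ,
        IsTractorODECoeff r g γ t c ↔ ∀ i < 2 * r + 3, c i = q i t) ∧
      (∀ t ∈ I, ¬ LinearIndependent ℝ (fun i : Fin (2 * r + 4) => tractorAt r g γ i t) →
        tractorOperatorAt r g γ t (fun i => q i t) = 0) ∧
      (∀ t ∈ I, ∀ θ : ℝ, IsWilczynskiInvariant (2 * r + 3) q 3 t θ ↔ θ = 0) ∧
      (1 ≤ r → ∀ t ∈ I, ∀ θ : ℝ,
        IsWilczynskiInvariant (2 * r + 3) q 4 t θ ↔ θ = thetaFour r g γ t) ∧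
      (1 ≤ r → ∀ t ∈ I, ∀ θ : ℝ, IsWilczynskiInvariant (2 * r + 3) q 5 t θ ↔ θ = 0)) ∧
    ContDiffOn ℝ ∞ (nullAlpha r g γ) I ∧
    IsRelativeConformalInvariant 4 (thetaFour r) g γ I := by
  obtain ⟨q, hs, hq⟩ := exists_smooth_solution (k := 2 * r + 3) hγ.gramAt_smooth
    fun t ht => hγ.det_gramAt_ne_zero ht
  have hq' : ∀ t ∈ I, ∀ c : ℕ → ℝ,
      IsTractorODECoeff r g γ t c ↔ ∀ i < 2 * r + 3, c i = q i t := fun t ht c =>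
    (isTractorODECoeff_iff t c).trans (hq t ht c)
  refine ⟨⟨q, hs, hq', fun t ht hdep => hγ.tractorOperatorAt_eq_zero ht (hq' t ht) hdep,
    fun t ht => hγ.isWilczynskiInvariant_iff hs hq' ht fun J φ μ p H htJ =>
      (hγ.canonicalInvariant_eq hq' H ht htJ).1,
    fun hr t ht => hγ.isWilczynskiInvariant_iff hs hq' ht fun J φ μ p H htJ =>
      (hγ.canonicalInvariant_eq hq' H ht htJ).2.1 hr,
    fun hr t ht => hγ.isWilczynskiInvariant_iff hs hq' ht fun J φ μ p H htJ =>
      (hγ.canonicalInvariant_eq hq' H ht htJ).2.2 hr⟩,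
    hγ.gramAt_smooth (r + 2) (r + 2), hγ.isRelativeConformalInvariant hn⟩
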